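/- Let $k=\mathbf F_8$. A smooth projective absolutely irreducible curve $C$ over $k$ is described by its function field $F$, an algebraic function field of one variable over $k$ in which $k$ is algebraically closed. The closed points of $C$ are the discrete valuation rings of $F$ containing $k$, $C(k)$ is the set of closed points with residue field $k$, and $g(C)=\max_D\,(\deg D-\dim_k L(D)+1)$ over all divisors $D$ of $C$ is the genus, where $L(D)=\{f\in F:\ f=0\text{ or } \operatorname{ord}_P(f)\ge -D(P)\text{ for all closed points }P\}$. A tower $\cdots\to C_1\to C_0$ of covers of such curves is called asymptotically good if $g(C_i)>1$ for some $i$ and $\lim_{i\to\infty}\#C_i(k)/g(C_i)$ exists and is positive. **Theorem.** There are elements $x_0,x_1,x_2,\dots$ of an algebraic closure of the rational function field $k(t)$ such that $x_0$ is transcendental over $k$ and $$x_i^2+x_i=x_{i-1}+1+\frac1{x_{i-1}}\qquad(i\ge 1).$$ For every sequence $(x_i)_{i\ge0}$ of this kind in any extension field of $k$, the fields $F_i=k(x_0,\dots,x_i)$ are the function fields of smooth projective absolutely irreducible curves $C_i$ over $k$ with $[F_{i+1}:F_i]=2$ for all $i\ge 0$; the tower $$\cdots\to C_i\to C_{i-1}\to\cdots\to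 C_1\to C_0=\mathbb P^1$$ is asymptotically good, and $$\lim_{i\to\infty}\frac{\#C_i(\mathbf F_8)}{g(C_i)}=\frac32 .$$ -/

import Mathlib

open Filter Topology

noncomputable section

/-- A place of `F` over the constant field `k`: a discrete valuation ring of `F` that contains `k`.
For an algebraic function field `F` of one variable over `k` these are the closed points of the
smooth projective curve over `k` with function field `F`. -/
structure Place (k F : Type*) [Field k] [Field F] [Algebra k F] where
  /-- the local ring at the place -/
  ring : ValuationSubring F
  isDVR : IsDiscreteValuationRing ring
  algebraMap_mem : ∀ c : k, algebraMap k F c ∈ ring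

namespace Place

variable {k F : Type*} [Field k] [Field F] [Algebra k F] (P : Place k F)

instance : IsDiscreteValuationRing P.ring := P.isDVR

instance : Algebra k P.ring :=
  ((algebraMap k F).codRestrict P.ring.toSubring P.algebraMap_mem).toAlgebra

/-- The residue field of the place. -/
abbrev residueField : Type _ := IsLocalRing.ResidueField P.ring

/-- The degree of a place, `[κ(P) : k]`. -/
def degree : ℕ := Module.finrank k P.residueField

/-- The normalized discrete valuation of the place, written multiplicatively:
`P.valuation f = exp (-ord_P f)`, and `P.valuation 0 = 0`. -/
def valuation : Valuation F (WithZero (Multiplicative ℤ)) :=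
  (IsDiscreteValuationRing.maximalIdeal P.ring).valuation F

lemma valuation_algebraMap_le_one (c : k) : P.valuation (algebraMap k F c) ≤ 1 :=
  (IsDiscreteValuationRing.maximalIdeal P.ring).valuation_le_one
    (⟨algebraMap k F c, P.algebraMap_mem c⟩ : P.ring)

end Place

section FunctionField

variable (k F : Type*) [Field k] [Field F] [Algebra k F]

/-- `F` is an algebraic function field of one variable over `k`, and `k` is algebraically closed
in `F`. Over a perfect field `k` this says that `F` is the function field of a smooth projective
absolutely irreducible curve over `k`. -/
structure IsCurveFunctionField : Prop where
  exists_finite : ∃ x : F, Transcendental k x ∧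
    FiniteDimensional (IntermediateField.adjoin k {x}) F
  exact_constants : ∀ a : F, IsAlgebraic k a → a ∈ (algebraMap k F).range

/-- Divisors: the free abelian group on the places. -/
abbrev CurveDivisor : Type _ := Place k F →₀ ℤ

variable {k F}

/-- The degree of a divisor. -/
def CurveDivisor.deg (D : CurveDivisor k F) : ℤ := D.sum fun P n => n * (P.degree : ℤ)

/-- The Riemann-Roch space `L(D)` of all `f` with `ord_P f ≥ - D(P)` for every place `P`
(and `f = 0`). -/
def riemannRochSpace (D : CurveDivisor k F) : Submodule k F where
  carrier := {f | ∀ P : Place k F, P.valuation f ≤ WithZero.exp (D P)}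
  zero_mem' P := by simp
  add_mem' hf hg P := (P.valuation.map_add _ _).trans (max_le (hf P) (hg P))
  smul_mem' c f hf P := by
    rw [Algebra.smul_def, map_mul]
    exact (mul_le_of_le_one_left' (P.valuation_algebraMap_le_one c)).trans (hf P)

variable (k F)

/-- The genus: the maximum of `deg D - dim L(D) + 1` over all divisors `D`. -/
def genus : ℤ :=
  sSup (Set.range fun D : CurveDivisor k F =>
    D.deg - (Module.finrank k (riemannRochSpace D) : ℤ) + 1)

/-- The number of `k`-rational points: the number of places of degree one. -/
def numRationalPoints : ℕ := Nat.card {P : Place k F // P.degree = 1}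

end FunctionField

section Tower

variable (k : Type*) {L : Type*} [Field k] [Field L] [Algebra k L]

/-- The ratio of the number of rational points and the genus at each level. -/
def pointGenusRatio (F : ℕ → IntermediateField k L) (i : ℕ) : ℝ :=
  (numRationalPoints k (F i) : ℝ) / (genus k (F i) : ℝ)

/-- A tower of covers of curves over `k`, given by the increasing sequence of the function fields,
is asymptotically good: some genus exceeds one, and the number of rational points divided by the
genus has a positive limit. -/
structure IsAsymptoticallyGoodTower (F : ℕ → IntermediateField k L) : Prop where
  curve : ∀ i, IsCurveFunctionField k (F i)
  mono : Monotone F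
  one_lt_genus : ∃ i, 1 < genus k (F i)
  limit_pos : ∃ l : ℝ, 0 < l ∧ Tendsto (pointGenusRatio k F) atTop (𝓝 l)

/-- `x₀` is transcendental over `k`, and `xᵢ² + xᵢ = xᵢ₋₁ + 1 + 1 / xᵢ₋₁` for `i ≥ 1`. -/
structure IsTowerSequence (x : ℕ → L) : Prop where
  transcendental : Transcendental k (x 0)
  recursion : ∀ i, x (i + 1) ^ 2 + x (i + 1) = x i + 1 + 1 / x i

/-- The function field `k(x₀, …, xᵢ)` of the `i`-th curve. -/
def towerField (x : ℕ → L) (i : ℕ) : IntermediateField k L :=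
  IntermediateField.adjoin k (x '' Set.Iic i)

end Tower

end

/-!
Let `F = k(x₀, …, xₙ)` and `x = xₙ`. The next field is `F(y)` with `y² + y = x + 1 + 1 / x`, and it
is ramified only over places where `x` takes one of the values `∞, 0, 1, ω, ω²`, a set which is
stable under the correspondence between `x` and `y`. After subtracting elements of the form
`w² + w`, the right hand side has at most simple poles: this holds in `k(x₀)`, and it passes to
`k(x₀, …, xₙ₊₁)` because this is not only the quadratic extension of `k(x₀, …, xₙ)` given by the
recursion, but also the Artin-Schreier extension of `k(x₁, …, xₙ₊₁)` generated by
`w = (x₀ + 1) / (x₁² + x₁ + 1)` with `w² + w = 1 / (x₁² + x₁ + 1)`. So every ramified place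
contributes exactly twice its degree to the different, and by Riemann-Hurwitz
`g = 4 · 2ⁿ + 1 - s`, where `s` is the total degree of the places over `∞, 0, 1, ω, ω²`.

A weighted count of these places grows at most by the factor `19 / 10` from one level to the next,
so `s = o(2ⁿ)` and `g / 2ⁿ → 4`. The six rational places with `x₀ ∈ 𝔽₈ ∖ {0, 1}` split completely in
the tower, since `a + 1 + 1 / a` has trace zero for all these `a`. Every other rational place is
counted in `s`, so the number of rational points is `6 · 2ⁿ + o(2ⁿ)`, and the limit is `6 / 4`.
-/

noncomputable section

open WithZero IsDedekindDomain

theorem lt_exp_iff_le_exp_sub_one {z : ℤᵐ⁰} {n : ℤ} : z < exp n ↔ z ≤ exp (n - 1) := by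
  rcases eq_or_ne z 0 with rfl | hz
  · simp
  · rw [← exp_log hz, exp_lt_exp, exp_le_exp, Int.le_sub_one_iff]

theorem lt_one_iff_le_exp_neg_one {z : ℤᵐ⁰} : z < 1 ↔ z ≤ exp (-1 : ℤ) := by
  rw [← exp_zero, lt_exp_iff_le_exp_sub_one, zero_sub]

theorem mul_exp_le_exp_iff {z : ℤᵐ⁰} {m n : ℤ} : z * exp m ≤ exp n ↔ z ≤ exp (n - m) := by
  rcases eq_or_ne z 0 with rfl | hz
  · simp
  · rw [← exp_log hz, ← exp_add, exp_le_exp, exp_le_exp, le_sub_iff_add_le]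

theorem mul_le_exp_add {z w : ℤᵐ⁰} {m n : ℤ} (hz : z ≤ exp m) (hw : w ≤ exp n) :
    z * w ≤ exp (m + n) :=
  (mul_le_mul' hz hw).trans_eq (exp_add m n).symm

namespace Place

section Basic

variable {k F : Type*} [Field k] [Field F] [Algebra k F]

theorem ext_ring {P Q : Place k F} (h : P.ring = Q.ring) : P = Q := by
  cases P; cases Q; cases h; rfl

variable (P : Place k F)

theorem mem_ring_iff {f : F} : f ∈ P.ring ↔ P.valuation f ≤ 1 := by
  refine ⟨fun hf => ?_, fun hf => ?_⟩
  · exact (IsDiscreteValuationRing.maximalIdeal P.ring).valuation_le_one (⟨f, hf⟩ : P.ring)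
  · obtain ⟨a, rfl⟩ := IsDiscreteValuationRing.exists_lift_of_le_one hf
    exact a.2

theorem exists_uniformizer : ∃ π : F, P.valuation π = exp (-1 : ℤ) :=
  (IsDiscreteValuationRing.maximalIdeal P.ring).valuation_exists_uniformizer F

theorem exists_valuation_eq_exp (n : ℤ) : ∃ f : F, P.valuation f = exp n := by
  obtain ⟨π, hπ⟩ := P.exists_uniformizer
  exact ⟨π ^ (-n), by rw [map_zpow₀, hπ, ← exp_zsmul]; simp⟩

theorem exists_eq_exp {f : F} (hf : f ≠ 0) : ∃ n : ℤ, P.valuation f = exp n :=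
  ⟨_, (exp_log ((map_ne_zero _).2 hf)).symm⟩

theorem mem_maximalIdeal_iff (f : P.ring) :
    f ∈ IsLocalRing.maximalIdeal P.ring ↔ P.valuation (f : F) < 1 :=
  ((IsDiscreteValuationRing.maximalIdeal P.ring).valuation_lt_one_iff_mem (K := F) f).symm

theorem residue_eq_zero_iff (f : P.ring) :
    IsLocalRing.residue P.ring f = 0 ↔ P.valuation (f : F) < 1 := by
  rw [IsLocalRing.residue_eq_zero_iff, mem_maximalIdeal_iff]

theorem residue_eq_iff (f g : P.ring) :
    IsLocalRing.residue P.ring f = IsLocalRing.residue P.ring g ↔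
      P.valuation ((f : F) - g) < 1 := by
  rw [← sub_eq_zero, ← map_sub, residue_eq_zero_iff, P.ring.coe_sub]

theorem valuation_algebraMap {c : k} (hc : c ≠ 0) : P.valuation (algebraMap k F c) = 1 := by
  refine le_antisymm (P.valuation_algebraMap_le_one c) ?_
  have hinv := P.valuation_algebraMap_le_one c⁻¹
  rw [map_inv₀, map_inv₀] at hinv
  have hne : P.valuation (algebraMap k F c) ≠ 0 := by simpa using hc
  exact (inv_le_one₀ (zero_lt_iff.2 hne)).1 hinv

theorem ring_ne_top : P.ring ≠ ⊤ := by
  intro h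
  obtain ⟨f, hf⟩ := P.exists_valuation_eq_exp 1
  have hmem : f ∈ P.ring := h ▸ ValuationSubring.mem_top f
  rw [mem_ring_iff, hf, ← exp_zero, exp_le_exp] at hmem
  exact absurd hmem (by decide)

theorem eq_of_ring_le {P Q : Place k F} (h : P.ring ≤ Q.ring) : P = Q :=
  ext_ring (ValuationSubring.eq_of_le_of_ne_top _ h Q.ring_ne_top)

theorem mem_ring_of_isIntegral {A : Type*} [CommRing A] [Algebra A F]
    (hA : ∀ a, algebraMap A F a ∈ P.ring) {z : F} (hz : IsIntegral A z) : z ∈ P.ring := by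
  let φ : A →+* P.ring := (algebraMap A F).codRestrict P.ring.toSubring hA
  have hz' : IsIntegral P.ring z := hz.map_of_comp_eq φ (RingHom.id F) (RingHom.ext fun _ => rfl)
  obtain ⟨y, rfl⟩ := IsIntegrallyClosed.isIntegral_iff.1 hz'
  exact y.2

/-- The place defined by a nontrivial discrete valuation that is trivial on the constants. The
valuation need not be normalized. -/
def ofValuation (v : Valuation F ℤᵐ⁰) [v.IsNontrivial]
    (hk : ∀ c : k, v (algebraMap k F c) ≤ 1) : Place k F where
  ring := v.valuationSubring
  isDVR := inferInstance
  algebraMap_mem c := hk c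

theorem exists_eq_valuation_pow {v : Valuation F ℤᵐ⁰} (h : v.valuationSubring = P.ring) :
    ∃ e : ℕ, 0 < e ∧ ∀ f, v f = P.valuation f ^ e := by
  have hequiv : P.valuation.IsEquiv v :=
    Valuation.isEquiv_iff_val_le_one.2 fun {f} => by
      rw [← mem_ring_iff, ← h, Valuation.mem_valuationSubring_iff]
  obtain ⟨π, hπ⟩ := P.exists_uniformizer
  have hπ0 : v π ≠ 0 := (map_ne_zero v).2 fun h0 => exp_ne_zero (by rw [← hπ, h0, map_zero])
  obtain ⟨m, hm⟩ : ∃ m : ℤ, v π = exp (-m) := ⟨-log (v π), by rw [neg_neg, exp_log hπ0]⟩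
  have hmpos : 0 < m := by
    have hlt : v π < 1 := hequiv.lt_one_iff_lt_one.1 (by rw [hπ, ← exp_zero, exp_lt_exp]; decide)
    rw [hm, ← exp_zero, exp_lt_exp] at hlt
    omega
  lift m to ℕ using hmpos.le
  refine ⟨m, by exact_mod_cast hmpos, fun f => ?_⟩
  rcases eq_or_ne f 0 with rfl | hf
  · rw [map_zero, map_zero, zero_pow (by omega)]
  obtain ⟨n, hn⟩ := P.exists_eq_exp hf
  have hunit : v (f * π ^ n) = 1 := hequiv.eq_one_iff_eq_one.1 <| by
    rw [map_mul, map_zpow₀, hn, hπ, ← exp_zsmul, ← exp_add]; simp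
  rw [map_mul, map_zpow₀, hm, ← exp_zsmul] at hunit
  rw [eq_inv_of_mul_eq_one_left hunit, hn, ← exp_neg, ← exp_nsmul, exp_inj]
  simp only [smul_eq_mul, nsmul_eq_mul]
  ring

theorem valuation_eq_of_valuationSubring_eq {v : Valuation F ℤᵐ⁰}
    (hv : ∃ π, v π = exp (-1 : ℤ)) (h : v.valuationSubring = P.ring) : P.valuation = v := by
  obtain ⟨e, -, he⟩ := P.exists_eq_valuation_pow h
  obtain ⟨π, hπ⟩ := hv
  obtain ⟨n, hn⟩ := P.exists_eq_exp (f := π) fun h0 => exp_ne_zero (by rw [← hπ, h0, map_zero])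
  have hmul : (e : ℤ) * n = -1 := by
    rw [he, hn, ← exp_nsmul, exp_inj, nsmul_eq_mul] at hπ
    exact hπ
  have he1 : e = 1 := by
    have hdvd : (e : ℤ) ∣ 1 := ⟨-n, by rw [mul_neg, hmul, neg_neg]⟩
    exact_mod_cast Int.eq_one_of_dvd_one (Int.natCast_nonneg e) hdvd
  ext f
  rw [he, he1, pow_one]

end Basic

section OfPrime

variable {k F B : Type*} [Field k] [Field F] [Algebra k F] [CommRing B] [IsDedekindDomain B]
  [Algebra B F] [IsFractionRing B F]

theorem exists_maximalIdeal_comap (P : Place k F) (h : ∀ b : B, algebraMap B F b ∈ P.ring) :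
    ∃ q : HeightOneSpectrum B, ∀ b, b ∈ q.asIdeal ↔ P.valuation (algebraMap B F b) < 1 := by
  let φ : B →+* P.ring := (algebraMap B F).codRestrict P.ring.toSubring h
  let I : Ideal B := (IsLocalRing.maximalIdeal P.ring).comap φ
  have memI (b : B) : b ∈ I ↔ P.valuation (algebraMap B F b) < 1 := by
    rw [Ideal.mem_comap, mem_maximalIdeal_iff]; rfl
  refine ⟨⟨I, Ideal.comap_isPrime _ _, fun hI => P.ring_ne_top (eq_top_iff.2 fun f _ => ?_)⟩, memI⟩
  obtain ⟨a, b, hb, rfl⟩ := IsFractionRing.div_surjective (A := B) f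
  have hb1 : P.valuation (algebraMap B F b) = 1 := by
    refine le_antisymm (P.mem_ring_iff.1 (h b)) (not_lt.1 fun hlt => ?_)
    rw [← memI, hI] at hlt
    exact nonZeroDivisors.ne_zero hb hlt
  rw [mem_ring_iff, map_div₀, hb1, div_one]
  exact P.mem_ring_iff.1 (h a)

variable [Algebra k B] [IsScalarTower k B F]

variable (k F) in
/-- The place defined by a nonzero prime ideal of a Dedekind domain with fraction field `F`. -/
def ofPrime (q : HeightOneSpectrum B) : Place k F :=
  ofValuation (q.valuation F) fun c => by
    rw [IsScalarTower.algebraMap_apply k B F]; exact q.valuation_le_one _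

theorem ofPrime_valuation (q : HeightOneSpectrum B) :
    (ofPrime k F q).valuation = q.valuation F :=
  valuation_eq_of_valuationSubring_eq _ (q.valuation_exists_uniformizer F) rfl

theorem ofPrime_injective :
    Function.Injective (ofPrime k F : HeightOneSpectrum B → Place k F) := fun p q h =>
  HeightOneSpectrum.eq_of_valuation_isEquiv_valuation (K := F) <| by
    rw [← ofPrime_valuation (k := k), ← ofPrime_valuation (k := k), h]

theorem exists_eq_ofPrime (P : Place k F) (h : ∀ b : B, algebraMap B F b ∈ P.ring) :
    ∃ q : HeightOneSpectrum B, P = ofPrime k F q := by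
  obtain ⟨q, hq⟩ := P.exists_maximalIdeal_comap h
  refine ⟨q, (eq_of_ring_le fun f hf => ?_).symm⟩
  obtain ⟨n, d, hnd⟩ := q.exists_primeCompl_mul_eq_of_integer f hf
  have hd : P.valuation (algebraMap B F d) = 1 :=
    le_antisymm (P.mem_ring_iff.1 (h d)) (not_lt.1 fun hlt => d.2 ((hq _).2 hlt))
  have hval := congrArg P.valuation hnd
  rw [map_mul, hd, mul_one] at hval
  rw [mem_ring_iff, hval]
  exact P.mem_ring_iff.1 (h n)

theorem ofPrime_degree (q : HeightOneSpectrum B) :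
    (ofPrime k F q).degree = Module.finrank k (B ⧸ q.asIdeal) := by
  set P := ofPrime k F q
  have hv : P.valuation = q.valuation F := ofPrime_valuation q
  have hmem (b : B) : algebraMap B F b ∈ P.ring := by
    rw [mem_ring_iff, hv]; exact q.valuation_le_one b
  let φ : B →ₐ[k] P.ring :=
    { (algebraMap B F).codRestrict P.ring.toSubring hmem with
      commutes' := fun c => Subtype.ext (IsScalarTower.algebraMap_apply k B F c).symm }
  let ψ : B →ₐ[k] P.residueField := (IsScalarTower.toAlgHom k P.ring P.residueField).comp φ
  have hψ : Function.Surjective ψ := by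
    intro r
    obtain ⟨f, rfl⟩ := IsLocalRing.residue_surjective r
    have hf : q.valuation F (f : F) ≤ 1 := by rw [← hv]; exact P.mem_ring_iff.1 f.2
    obtain ⟨b, hb⟩ := q.exists_valuation_sub_lt_of_integer hf 1
    refine ⟨b, ?_⟩
    change IsLocalRing.residue P.ring (φ b) = _
    rw [residue_eq_iff, hv]
    exact (by simpa using hb : q.valuation F (algebraMap B F b - f) < 1)
  have hker : RingHom.ker ψ = q.asIdeal := by
    ext b
    rw [RingHom.mem_ker]
    change IsLocalRing.residue P.ring (φ b) = 0 ↔ _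
    rw [residue_eq_zero_iff, hv]
    exact q.valuation_lt_one_iff_mem b
  let e : (B ⧸ q.asIdeal) ≃ₐ[k] P.residueField :=
    (Ideal.quotientEquivAlgOfEq k hker.symm).trans (Ideal.quotientKerAlgEquivOfSurjective hψ)
  exact e.toLinearEquiv.finrank_eq.symm

end OfPrime

section Extension

variable {k F F' : Type*} [Field k] [Field F] [Field F'] [Algebra k F'] [Algebra F F']
  [Algebra.IsAlgebraic F F']

instance comap_valuation_isNontrivial (P' : Place k F') :
    (P'.valuation.comap (algebraMap F F')).IsNontrivial := by
  by_contra hn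
  refine P'.ring_ne_top (eq_top_iff.2 fun z _ =>
    P'.mem_ring_of_isIntegral (A := F) (fun f => ?_) (Algebra.IsIntegral.isIntegral z))
  by_contra hf
  rw [mem_ring_iff, not_le] at hf
  exact hn ⟨f, (zero_lt_one.trans hf).ne', hf.ne'⟩

variable [Algebra k F] [IsScalarTower k F F']

variable (F) in
/-- The place of the subfield `F` below a place of an algebraic extension `F'`. -/
def restrict (P' : Place k F') : Place k F :=
  ofValuation (P'.valuation.comap (algebraMap F F')) fun c => by
    rw [Valuation.comap_apply, ← IsScalarTower.algebraMap_apply]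
    exact P'.valuation_algebraMap_le_one c

theorem mem_restrict_ring (P' : Place k F') (f : F) :
    f ∈ (P'.restrict F).ring ↔ algebraMap F F' f ∈ P'.ring := by
  rw [mem_ring_iff P']; rfl

theorem restrict_eq_iff (P : Place k F) (P' : Place k F') :
    P'.restrict F = P ↔ ∀ f ∈ P.ring, algebraMap F F' f ∈ P'.ring := by
  constructor
  · rintro rfl f hf
    exact (mem_restrict_ring P' f).1 hf
  · intro h
    exact (eq_of_ring_le fun f hf => (mem_restrict_ring P' f).2 (h f hf)).symm

theorem exists_valuation_algebraMap_eq_pow (P' : Place k F') :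
    ∃ e : ℕ, 0 < e ∧ ∀ f : F, P'.valuation (algebraMap F F' f) = (P'.restrict F).valuation f ^ e :=
  (P'.restrict F).exists_eq_valuation_pow (v := P'.valuation.comap (algebraMap F F')) rfl

variable (F) in
/-- The ramification index over `F` of a place of an algebraic extension `F'`. -/
def ramIdx (P' : Place k F') : ℕ :=
  (P'.exists_valuation_algebraMap_eq_pow (F := F)).choose

theorem ramIdx_pos (P' : Place k F') : 0 < P'.ramIdx F :=
  (P'.exists_valuation_algebraMap_eq_pow (F := F)).choose_spec.1

theorem valuation_algebraMap_eq_pow (P' : Place k F') (f : F) :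
    P'.valuation (algebraMap F F' f) = (P'.restrict F).valuation f ^ P'.ramIdx F :=
  (P'.exists_valuation_algebraMap_eq_pow (F := F)).choose_spec.2 f

theorem valuation_algebraMap_lt_one_iff (P' : Place k F') (f : F) :
    P'.valuation (algebraMap F F' f) < 1 ↔ (P'.restrict F).valuation f < 1 := by
  rw [valuation_algebraMap_eq_pow, pow_lt_one_iff P'.ramIdx_pos.ne']

theorem valuation_algebraMap_le_one_iff (P' : Place k F') (f : F) :
    P'.valuation (algebraMap F F' f) ≤ 1 ↔ (P'.restrict F).valuation f ≤ 1 := by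
  rw [valuation_algebraMap_eq_pow, pow_le_one_iff P'.ramIdx_pos.ne']

theorem ramIdx_eq_of_valuation_algebraMap_eq_pow {P' : Place k F'} {e : ℕ}
    (h : ∀ f : F, P'.valuation (algebraMap F F' f) = (P'.restrict F).valuation f ^ e) :
    P'.ramIdx F = e := by
  obtain ⟨f, hf⟩ := (P'.restrict F).exists_valuation_eq_exp 1
  have hpow := h f
  rw [valuation_algebraMap_eq_pow, hf, ← exp_nsmul, ← exp_nsmul, exp_inj] at hpow
  simpa using hpow

end Extension

section FundamentalIdentity

variable {k F F' B : Type*} [Field k] [Field F] [Field F'] [Algebra k F] [Algebra k F']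
  [Algebra F F'] [IsScalarTower k F F'] [FiniteDimensional F F'] (P : Place k F)
  [CommRing B] [IsDedekindDomain B] [Algebra P.ring B] [Module.Finite P.ring B]
  [Algebra B F'] [IsFractionRing B F'] [IsScalarTower P.ring B F']
  [Algebra k B] [IsScalarTower k B F']

include F' in
omit [Algebra k F'] [IsScalarTower k F F'] [FiniteDimensional F F'] [IsDedekindDomain B]
  [Module.Finite P.ring B] [IsFractionRing B F'] [Algebra k B] [IsScalarTower k B F'] in
theorem faithfulSMul_of_isScalarTower : FaithfulSMul P.ring B := by
  have hinj : Function.Injective ((algebraMap B F').comp (algebraMap P.ring B)) := by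
    rw [← IsScalarTower.algebraMap_eq, IsScalarTower.algebraMap_eq P.ring F F']
    exact (algebraMap F F').injective.comp Subtype.coe_injective
  exact (faithfulSMul_iff_algebraMap_injective _ _).2 (Function.Injective.of_comp hinj)

include F' in
omit [Algebra k F'] [IsScalarTower k F F'] [FiniteDimensional F F'] [IsFractionRing B F']
  [Algebra k B] [IsScalarTower k B F'] in
theorem liesOver_maximalIdeal (q : HeightOneSpectrum B) :
    q.asIdeal.LiesOver (IsLocalRing.maximalIdeal P.ring) :=
  have := P.faithfulSMul_of_isScalarTower (F' := F') (B := B)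
  have := q.isMaximal
  ⟨(IsLocalRing.eq_maximalIdeal (Ideal.IsMaximal.under P.ring q.asIdeal)).symm⟩

omit [Module.Finite P.ring B] in
theorem restrict_ofPrime (q : HeightOneSpectrum B) : (ofPrime k F' q).restrict F = P := by
  rw [restrict_eq_iff]
  intro f hf
  have hfB : algebraMap F F' f = algebraMap B F' (algebraMap P.ring B ⟨f, hf⟩) := by
    rw [← IsScalarTower.algebraMap_apply P.ring B F', IsScalarTower.algebraMap_apply P.ring F F']
    rfl
  rw [mem_ring_iff, ofPrime_valuation, hfB]
  exact q.valuation_le_one _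

theorem exists_eq_ofPrime_of_restrict_eq {P' : Place k F'} (h : P'.restrict F = P) :
    ∃ q : HeightOneSpectrum B, P' = ofPrime k F' q := by
  refine P'.exists_eq_ofPrime fun b => P'.mem_ring_of_isIntegral (A := P.ring) (fun f => ?_)
    ((Algebra.IsIntegral.isIntegral b).algebraMap)
  rw [IsScalarTower.algebraMap_apply P.ring F F']
  exact (restrict_eq_iff P P').1 h f f.2

theorem ramIdx_ofPrime (q : HeightOneSpectrum B) :
    (ofPrime k F' q).ramIdx F = q.asIdeal.ramificationIdx P.ring := by
  have := P.faithfulSMul_of_isScalarTower (F' := F') (B := B)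
  have hq : q.asIdeal.LiesOver (IsDiscreteValuationRing.maximalIdeal P.ring).asIdeal :=
    P.liesOver_maximalIdeal (F' := F') q
  refine ramIdx_eq_of_valuation_algebraMap_eq_pow fun f => ?_
  rw [ofPrime_valuation, restrict_ofPrime P q,
    ← Ideal.ramificationIdx'_eq_ramificationIdx _ _ (IsDiscreteValuationRing.maximalIdeal _).ne_bot]
  exact (HeightOneSpectrum.valuation_liesOver F'
    (IsDiscreteValuationRing.maximalIdeal P.ring) q f).symm

omit [IsScalarTower k F F'] [FiniteDimensional F F'] in
theorem degree_ofPrime_eq_mul_inertiaDeg [IsScalarTower k P.ring B] (q : HeightOneSpectrum B) :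
    (ofPrime k F' q).degree = P.degree * q.asIdeal.inertiaDeg P.ring := by
  have hq : q.asIdeal.LiesOver (IsLocalRing.maximalIdeal P.ring) :=
    P.liesOver_maximalIdeal (F' := F') q
  have := q.isMaximal
  have : IsScalarTower k (P.ring ⧸ IsLocalRing.maximalIdeal P.ring) (B ⧸ q.asIdeal) :=
    IsScalarTower.of_algebraMap_eq (R := k) (S := P.ring ⧸ IsLocalRing.maximalIdeal P.ring)
      (A := B ⧸ q.asIdeal) fun c => by
      change Ideal.Quotient.mk q.asIdeal (algebraMap k B c) =
        Ideal.Quotient.mk q.asIdeal (algebraMap P.ring B (algebraMap k P.ring c))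
      rw [← IsScalarTower.algebraMap_apply k P.ring B]
  let _ : Field (P.ring ⧸ IsLocalRing.maximalIdeal P.ring) := Ideal.Quotient.field _
  rw [ofPrime_degree,
    Ideal.inertiaDeg_eq_of_isMaximal (IsLocalRing.maximalIdeal P.ring) q.asIdeal]
  exact (Module.finrank_mul_finrank k (P.ring ⧸ IsLocalRing.maximalIdeal P.ring) _).symm

variable (F' B) in
/-- Maximal ideals over the local ring at `P`, in a model `B` of its integral closure, correspond
to the places above `P`. -/
def primesOverEquivPlaces : (IsLocalRing.maximalIdeal P.ring).primesOver B ≃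
    {P' : Place k F' // P'.restrict F = P} := by
  have := P.faithfulSMul_of_isScalarTower (F' := F') (B := B)
  let toPrime (I : (IsLocalRing.maximalIdeal P.ring).primesOver B) : HeightOneSpectrum B :=
    have := I.2.2
    ⟨I.1, I.2.1, Ideal.ne_bot_of_liesOver_of_ne_bot (IsDiscreteValuationRing.not_a_field P.ring) _⟩
  refine Equiv.ofBijective (fun I => ⟨ofPrime k F' (toPrime I), restrict_ofPrime P _⟩)
    ⟨fun I J h => ?_, fun ⟨P', hP'⟩ => ?_⟩
  · exact Subtype.ext (congrArg HeightOneSpectrum.asIdeal (ofPrime_injective (Subtype.ext_iff.1 h)))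
  · obtain ⟨q, rfl⟩ := P.exists_eq_ofPrime_of_restrict_eq (B := B) hP'
    exact ⟨⟨q.asIdeal, q.isPrime, P.liesOver_maximalIdeal (F' := F') q⟩, rfl⟩

theorem exists_primesOverEquivPlaces_apply
    (I : (IsLocalRing.maximalIdeal P.ring).primesOver B) : ∃ q : HeightOneSpectrum B,
    q.asIdeal = I.1 ∧ (P.primesOverEquivPlaces F' B I : Place k F') = ofPrime k F' q :=
  ⟨_, rfl, rfl⟩

include B in
variable (B) in
theorem finite_restrict_eq : {P' : Place k F' | P'.restrict F = P}.Finite :=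
  have : Finite ((IsLocalRing.maximalIdeal P.ring).primesOver B) :=
    Algebra.QuasiFinite.finite_primesOver _
  Finite.of_equiv _ (P.primesOverEquivPlaces F' B)

variable (B) in
theorem sum_restrict_eq_ramIdx_mul_degree [IsScalarTower k P.ring B]
    [Fintype {P' : Place k F' // P'.restrict F = P}] :
    ∑ P' : {P' : Place k F' // P'.restrict F = P}, P'.1.ramIdx F * P'.1.degree =
      Module.finrank F F' * P.degree := by
  have := P.faithfulSMul_of_isScalarTower (F' := F') (B := B)
  have := (Algebra.QuasiFinite.finite_primesOver (S := B) (IsLocalRing.maximalIdeal P.ring)).fintype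
  rw [IsFractionRing.finrank_eq P.ring F B F',
    ← Ideal.sum_ramification_inertia_eq_finrank (IsLocalRing.maximalIdeal P.ring) B, Finset.sum_mul,
    ← (P.primesOverEquivPlaces F' B).sum_comp]
  refine Finset.sum_congr rfl fun I _ => ?_
  obtain ⟨q, hqI, hq⟩ := P.exists_primesOverEquivPlaces_apply (F' := F') I
  rw [hq, ramIdx_ofPrime P q, degree_ofPrime_eq_mul_inertiaDeg P q, hqI]
  ring

end FundamentalIdentity

section Fiber

variable {k F F' : Type*} [Field k] [Field F] [Field F'] [Algebra k F] [Algebra k F']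
  [Algebra F F'] [IsScalarTower k F F'] [FiniteDimensional F F'] [Algebra.IsSeparable F F']

instance isScalarTower_ring (P : Place k F) : IsScalarTower k P.ring F' :=
  IsScalarTower.of_algebraMap_eq fun c => by
    rw [IsScalarTower.algebraMap_apply k F F', IsScalarTower.algebraMap_apply P.ring F F']; rfl

instance isDedekindDomain_integralClosure (P : Place k F) :
    IsDedekindDomain (integralClosure P.ring F') :=
  integralClosure.isDedekindDomain P.ring F F'

instance isFractionRing_integralClosure (P : Place k F) :
    IsFractionRing (integralClosure P.ring F') F' :=
  integralClosure.isFractionRing_of_finite_extension F F'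

instance finite_integralClosure (P : Place k F) :
    Module.Finite P.ring (integralClosure P.ring F') :=
  IsIntegralClosure.finite P.ring F F' _

variable (F') (P : Place k F) in
/-- The finite set of places above a given place. -/
def fiber : Finset (Place k F') :=
  (P.finite_restrict_eq (F' := F') (integralClosure P.ring F')).toFinset

@[simp] theorem mem_fiber {P : Place k F} {P' : Place k F'} :
    P' ∈ P.fiber F' ↔ P'.restrict F = P := by
  rw [fiber, Set.Finite.mem_toFinset, Set.mem_ofPred_eq]

theorem sum_ramIdx_mul_degree (P : Place k F) :
    ∑ P' ∈ P.fiber F', P'.ramIdx F * P'.degree = Module.finrank F F' * P.degree := by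
  have := Fintype.subtype (P.fiber F') fun P' => mem_fiber
  rw [← P.sum_restrict_eq_ramIdx_mul_degree (integralClosure P.ring F')]
  exact Finset.sum_subtype _ (fun _ => mem_fiber) _

theorem exists_degree_eq_mul (P' : Place k F') :
    ∃ f : ℕ, 0 < f ∧ P'.degree = (P'.restrict F).degree * f := by
  obtain ⟨q, hq⟩ := (P'.restrict F).exists_eq_ofPrime_of_restrict_eq
    (B := integralClosure (P'.restrict F).ring F') rfl
  refine ⟨q.asIdeal.inertiaDeg (P'.restrict F).ring, Ideal.inertiaDeg_pos _ _, ?_⟩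
  rw [← degree_ofPrime_eq_mul_inertiaDeg (F' := F'), ← hq]

theorem degree_restrict_dvd (P' : Place k F') : (P'.restrict F).degree ∣ P'.degree := by
  obtain ⟨f, -, hf⟩ := P'.exists_degree_eq_mul (F := F)
  exact ⟨f, hf⟩

theorem degree_pos_of_restrict (P' : Place k F') (h : 0 < (P'.restrict F).degree) :
    0 < P'.degree := by
  obtain ⟨f, hf0, hf⟩ := P'.exists_degree_eq_mul (F := F)
  exact hf ▸ Nat.mul_pos h hf0

theorem degree_restrict_le (P' : Place k F') (h : 0 < (P'.restrict F).degree) :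
    (P'.restrict F).degree ≤ P'.degree :=
  Nat.le_of_dvd (P'.degree_pos_of_restrict h) P'.degree_restrict_dvd

theorem fiber_nonempty {P : Place k F} (hP : 0 < P.degree) : (P.fiber F').Nonempty := by
  by_contra hempty
  have hsum := P.sum_ramIdx_mul_degree (F' := F')
  rw [Finset.not_nonempty_iff_eq_empty.1 hempty, Finset.sum_empty] at hsum
  exact (Nat.mul_pos Module.finrank_pos hP).ne hsum

end Fiber

end Place

namespace Place

variable {k F F' : Type*} [Field k] [Field F] [Field F'] [Algebra k F] [Algebra k F']
  [Algebra F F'] [IsScalarTower k F F'] [Algebra.IsAlgebraic F F']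

theorem exists_valuation_sub_algebraMap_lt_one {P' : Place k F'}
    (h0 : 0 < (P'.restrict F).degree) (hd : P'.degree = (P'.restrict F).degree) {z : F'}
    (hz : P'.valuation z ≤ 1) :
    ∃ c : F, (P'.restrict F).valuation c ≤ 1 ∧ P'.valuation (z - algebraMap F F' c) < 1 := by
  set P := P'.restrict F
  let φ : P.ring →ₐ[k] P'.ring :=
    { ((algebraMap F F').comp P.ring.subtype).codRestrict P'.ring.toSubring
        fun f => (mem_restrict_ring P' (f : F)).1 f.2 with
      commutes' := fun c => Subtype.ext (IsScalarTower.algebraMap_apply k F F' c).symm }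
  let ψ : P.ring →ₐ[k] P'.residueField := (IsScalarTower.toAlgHom k P'.ring P'.residueField).comp φ
  have hψ (f : P.ring) (hf : f ∈ IsLocalRing.maximalIdeal P.ring) : ψ f = 0 := by
    change IsLocalRing.residue P'.ring (φ f) = 0
    rw [residue_eq_zero_iff]
    exact (valuation_algebraMap_lt_one_iff P' (f : F)).2 ((mem_maximalIdeal_iff _ _).1 hf)
  let χ : P.residueField →ₐ[k] P'.residueField :=
    Ideal.Quotient.liftₐ (IsLocalRing.maximalIdeal P.ring) ψ hψ
  have : FiniteDimensional k P'.residueField :=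
    FiniteDimensional.of_finrank_pos (h0.trans_eq hd.symm)
  have : FiniteDimensional k P.residueField := FiniteDimensional.of_finrank_pos h0
  have hχ : Function.Surjective χ.toLinearMap :=
    (LinearMap.injective_iff_surjective_of_finrank_eq_finrank hd.symm).1 χ.toRingHom.injective
  obtain ⟨r, hr⟩ := hχ (IsLocalRing.residue P'.ring ⟨z, P'.mem_ring_iff.2 hz⟩)
  obtain ⟨c, rfl⟩ := IsLocalRing.residue_surjective r
  refine ⟨c, P.mem_ring_iff.1 c.2, ?_⟩
  rw [Valuation.map_sub_swap]
  exact (P'.residue_eq_iff (φ c) ⟨z, P'.mem_ring_iff.2 hz⟩).1 hr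

end Place

namespace CurveDivisor

variable {k F : Type*} [Field k] [Field F] [Algebra k F]

theorem deg_add (D E : CurveDivisor k F) : deg (D + E) = deg D + deg E :=
  Finsupp.sum_add_index' (fun _ => by simp) fun _ _ _ => by ring

theorem deg_zero : deg (0 : CurveDivisor k F) = 0 := Finsupp.sum_zero_index

theorem deg_sub (D E : CurveDivisor k F) : deg (D - E) = deg D - deg E := by
  rw [eq_sub_iff_add_eq, ← deg_add, sub_add_cancel]

theorem deg_single (P : Place k F) (n : ℤ) :
    deg (Finsupp.single P n : CurveDivisor k F) = n * P.degree :=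
  Finsupp.sum_single_index (by simp)

theorem le_add_single (D : CurveDivisor k F) (P : Place k F) {n : ℤ} (hn : 0 ≤ n) :
    D ≤ D + Finsupp.single P n :=
  le_add_of_nonneg_right (Finsupp.single_nonneg.2 hn)

theorem le_induction {D : CurveDivisor k F} {p : CurveDivisor k F → Prop} (h0 : p D)
    (hs : ∀ D₁ (P : Place k F), D ≤ D₁ → p D₁ → p (D₁ + Finsupp.single P 1)) (D₁) (h : D ≤ D₁) :
    p D₁ := by
  suffices key : ∀ (E : Place k F →₀ ℕ) (D₁ : CurveDivisor k F), D ≤ D₁ → p D₁ →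
      p (D₁ + E.mapRange Nat.cast Nat.cast_zero) by
    convert key ((D₁ - D).mapRange Int.toNat rfl) D le_rfl h0
    ext P
    have hP := h P
    simp only [Finsupp.add_apply, Finsupp.mapRange_apply, Finsupp.sub_apply]
    omega
  intro E
  induction E using Finsupp.induction_linear with
  | zero => intro D₁ _ hD₁; simpa using hD₁
  | add E E' ihE ihE' =>
    intro D₁ hle hD₁
    rw [Finsupp.mapRange_add Nat.cast_add, ← add_assoc]
    exact ihE' _ (hle.trans (le_add_of_nonneg_right fun P => by simp)) (ihE _ hle hD₁)
  | single P n =>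
    intro D₁ hle hD₁
    rw [Finsupp.mapRange_single]
    induction n with
    | zero => simpa using hD₁
    | succ n ih =>
      rw [Nat.cast_succ, Finsupp.single_add, ← add_assoc]
      exact hs _ P (hle.trans (D₁.le_add_single P (Int.natCast_nonneg n))) ih

end CurveDivisor

section LeadingCoefficient

variable {k F : Type*} [Field k] [Field F] [Algebra k F] (P : Place k F) (n : ℤ)

namespace Place

/-- The functions with a pole of order at most `n` at `P`. -/
def poleOrderLE : Submodule k F where
  carrier := {f | P.valuation f ≤ exp n}
  zero_mem' := by simp
  add_mem' hf hg := (P.valuation.map_add _ _).trans (max_le hf hg)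
  smul_mem' c f hf := by
    rw [Algebra.smul_def, Set.mem_ofPred_eq, map_mul]
    exact (mul_le_of_le_one_left' (P.valuation_algebraMap_le_one c)).trans hf

variable {P n} in
theorem mem_poleOrderLE {f : F} : f ∈ P.poleOrderLE n ↔ P.valuation f ≤ exp n := Iff.rfl

theorem valuation_choose_mul_le_one_iff {f : F} :
    P.valuation ((P.exists_valuation_eq_exp (-n)).choose * f) ≤ 1 ↔ P.valuation f ≤ exp n := by
  rw [map_mul, (P.exists_valuation_eq_exp (-n)).choose_spec, mul_comm, ← exp_zero,
    mul_exp_le_exp_iff, sub_neg_eq_add, zero_add]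

/-- The coefficient of `π ^ (-n)` in the Laurent expansion of a function with a pole of order at
most `n`, up to the choice of a local parameter: the residue of `t * f` for a fixed `t` of
order `n`. -/
def leadingCoeff : P.poleOrderLE n →ₗ[k] P.residueField :=
  (IsScalarTower.toAlgHom k P.ring P.residueField).toLinearMap ∘ₗ
    { toFun := fun f => ⟨(P.exists_valuation_eq_exp (-n)).choose * f,
        P.mem_ring_iff.2 ((P.valuation_choose_mul_le_one_iff n).2 f.2)⟩
      map_add' := fun f g => Subtype.ext (by simp [mul_add])
      map_smul' := fun c f => by
        rw [RingHom.id_apply, Algebra.smul_def]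
        refine Subtype.ext ?_
        change _ * (c • (f : F)) = algebraMap k F c * _
        rw [Algebra.smul_def, mul_left_comm] }

theorem leadingCoeff_eq_iff (f g : P.poleOrderLE n) :
    P.leadingCoeff n f = P.leadingCoeff n g ↔ P.valuation (f - g : F) ≤ exp (n - 1) := by
  refine (P.residue_eq_iff _ _).trans ?_
  change P.valuation ((P.exists_valuation_eq_exp (-n)).choose * f -
    (P.exists_valuation_eq_exp (-n)).choose * g) < 1 ↔ _
  rw [← mul_sub, map_mul, (P.exists_valuation_eq_exp (-n)).choose_spec, mul_comm,
    lt_one_iff_le_exp_neg_one, mul_exp_le_exp_iff, sub_neg_eq_add, neg_add_eq_sub]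

theorem leadingCoeff_surjective : Function.Surjective (P.leadingCoeff n) := by
  intro r
  obtain ⟨s, rfl⟩ := IsLocalRing.residue_surjective r
  set t := (P.exists_valuation_eq_exp (-n)).choose with ht
  have ht0 : t ≠ 0 := fun h0 => exp_ne_zero (a := -n) <| by
    rw [← (P.exists_valuation_eq_exp (-n)).choose_spec, ← ht, h0, map_zero]
  have hts : t * (t⁻¹ * s) = s := mul_inv_cancel_left₀ ht0 _
  refine ⟨⟨t⁻¹ * s, ?_⟩, congrArg (IsLocalRing.residue P.ring) (Subtype.ext hts)⟩
  rw [mem_poleOrderLE, ← valuation_choose_mul_le_one_iff, hts]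
  exact P.mem_ring_iff.1 s.2

end Place

end LeadingCoefficient

section RiemannRoch

variable {k F : Type*} [Field k] [Field F] [Algebra k F]

theorem mem_riemannRochSpace {D : CurveDivisor k F} {f : F} :
    f ∈ riemannRochSpace D ↔ ∀ P : Place k F, P.valuation f ≤ exp (D P) := Iff.rfl

theorem riemannRochSpace_mono {D E : CurveDivisor k F} (h : D ≤ E) :
    riemannRochSpace D ≤ riemannRochSpace E := fun _ hf P =>
  (hf P).trans (exp_le_exp.2 (h P))

theorem mem_riemannRochSpace_add_single_iff {D : CurveDivisor k F} {P : Place k F} {n : ℤ} {f : F} :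
    f ∈ riemannRochSpace (D + Finsupp.single P n) ↔
      P.valuation f ≤ exp (D P + n) ∧ ∀ Q ≠ P, Q.valuation f ≤ exp (D Q) := by
  refine ⟨fun hf => ⟨by simpa using hf P, fun Q hQ => by
    simpa [Finsupp.single_apply, hQ.symm] using hf Q⟩, fun ⟨hP, hf⟩ Q => ?_⟩
  by_cases hQ : Q = P
  · simpa [hQ] using hP
  · simpa [Finsupp.single_apply, Ne.symm hQ] using hf Q hQ

theorem riemannRochSpace_add_single_le (D : CurveDivisor k F) (P : Place k F) (n : ℤ) :
    riemannRochSpace (D + Finsupp.single P n) ≤ P.poleOrderLE (D P + n) :=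
  fun _ hf => (mem_riemannRochSpace_add_single_iff.1 hf).1

/-- The leading coefficient at `P` of the functions in `L(D + P)`, with kernel `L(D)`. -/
def residueMap (D : CurveDivisor k F) (P : Place k F) :
    riemannRochSpace (D + Finsupp.single P 1) →ₗ[k] P.residueField :=
  P.leadingCoeff (D P + 1) ∘ₗ Submodule.inclusion (riemannRochSpace_add_single_le D P 1)

theorem residueMap_eq_leadingCoeff_iff {D : CurveDivisor k F} {P : Place k F}
    (f : riemannRochSpace (D + Finsupp.single P 1)) (g : P.poleOrderLE (D P + 1)) :
    residueMap D P f = P.leadingCoeff (D P + 1) g ↔ P.valuation (f - g : F) ≤ exp (D P) := by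
  refine (P.leadingCoeff_eq_iff _ _ g).trans ?_
  rw [add_sub_cancel_right]
  rfl

theorem ker_residueMap (D : CurveDivisor k F) (P : Place k F) :
    LinearMap.ker (residueMap D P) = (riemannRochSpace D).comap (riemannRochSpace _).subtype := by
  ext f
  rw [LinearMap.mem_ker, ← map_zero (P.leadingCoeff (D P + 1)), residueMap_eq_leadingCoeff_iff,
    ZeroMemClass.coe_zero, sub_zero, Submodule.mem_comap, Submodule.coe_subtype]
  refine ⟨fun h Q => ?_, fun h => h P⟩
  by_cases hQ : Q = P
  · rwa [hQ]
  · exact (mem_riemannRochSpace_add_single_iff.1 f.2).2 Q hQ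

theorem residueMap_surjective_iff {D : CurveDivisor k F} {P : Place k F} :
    Function.Surjective (residueMap D P) ↔ ∀ h : F, P.valuation h ≤ exp (D P + 1) →
      ∃ f ∈ riemannRochSpace (D + Finsupp.single P 1), P.valuation (f - h) ≤ exp (D P) := by
  refine ⟨fun hs h hh => ?_, fun hs r => ?_⟩
  · obtain ⟨f, hf⟩ := hs (P.leadingCoeff (D P + 1) ⟨h, hh⟩)
    exact ⟨f, f.2, (residueMap_eq_leadingCoeff_iff f ⟨h, hh⟩).1 hf⟩
  · obtain ⟨g, rfl⟩ := P.leadingCoeff_surjective (D P + 1) r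
    obtain ⟨f, hf, hfg⟩ := hs g g.2
    exact ⟨⟨f, hf⟩, (residueMap_eq_leadingCoeff_iff ⟨f, hf⟩ g).2 hfg⟩

/-- The isomorphism of `ker (residueMap D P)` with `L(D)`. -/
def kerResidueMapEquiv (D : CurveDivisor k F) (P : Place k F) :
    LinearMap.ker (residueMap D P) ≃ₗ[k] riemannRochSpace D :=
  (LinearEquiv.ofEq _ _ (ker_residueMap D P)).trans
    (Submodule.comapSubtypeEquivOfLe (riemannRochSpace_mono (D.le_add_single P zero_le_one)))

theorem finiteDimensional_add_single {D : CurveDivisor k F} {P : Place k F} (hP : 0 < P.degree)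
    [FiniteDimensional k (riemannRochSpace D)] :
    FiniteDimensional k (riemannRochSpace (D + Finsupp.single P 1)) :=
  have : FiniteDimensional k P.residueField := FiniteDimensional.of_finrank_pos hP
  have : FiniteDimensional k (LinearMap.ker (residueMap D P)) :=
    Module.Finite.equiv (kerResidueMapEquiv D P).symm
  have : FiniteDimensional k (_ ⧸ LinearMap.ker (residueMap D P)) :=
    Module.Finite.equiv (residueMap D P).quotKerEquivRange.symm
  Module.Finite.of_submodule_quotient (LinearMap.ker (residueMap D P))

theorem finiteDimensional_riemannRochSpace_of_le (hdeg : ∀ P : Place k F, 0 < P.degree)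
    {D E : CurveDivisor k F} (h : D ≤ E) [FiniteDimensional k (riemannRochSpace D)] :
    FiniteDimensional k (riemannRochSpace E) :=
  CurveDivisor.le_induction (p := fun E => FiniteDimensional k (riemannRochSpace E))
    inferInstance (fun _ P _ _ => finiteDimensional_add_single (hdeg P)) E h

/-- The quantity `deg D - dim L(D) + 1`, whose maximum over all divisors is the genus. -/
def CurveDivisor.defect (D : CurveDivisor k F) : ℤ :=
  D.deg - (Module.finrank k (riemannRochSpace D) : ℤ) + 1

theorem defect_add_single {D : CurveDivisor k F} {P : Place k F} (hP : 0 < P.degree)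
    [FiniteDimensional k (riemannRochSpace D)] :
    (D + Finsupp.single P 1).defect =
      D.defect + (P.degree - Module.finrank k (LinearMap.range (residueMap D P))) := by
  have := finiteDimensional_add_single (D := D) hP
  have hrank := (residueMap D P).finrank_range_add_finrank_ker
  rw [(kerResidueMapEquiv D P).finrank_eq] at hrank
  rw [CurveDivisor.defect, CurveDivisor.defect, CurveDivisor.deg_add, CurveDivisor.deg_single]
  omega

theorem defect_le_defect_add_single {D : CurveDivisor k F} {P : Place k F} (hP : 0 < P.degree)
    [FiniteDimensional k (riemannRochSpace D)] :
    D.defect ≤ (D + Finsupp.single P 1).defect := by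
  have : FiniteDimensional k P.residueField := FiniteDimensional.of_finrank_pos hP
  have hle : Module.finrank k (LinearMap.range (residueMap D P)) ≤ P.degree :=
    Submodule.finrank_le _
  rw [defect_add_single hP]
  omega

theorem defect_add_single_eq_iff {D : CurveDivisor k F} {P : Place k F} (hP : 0 < P.degree)
    [FiniteDimensional k (riemannRochSpace D)] :
    (D + Finsupp.single P 1).defect = D.defect ↔ Function.Surjective (residueMap D P) := by
  have : FiniteDimensional k P.residueField := FiniteDimensional.of_finrank_pos hP
  rw [← LinearMap.range_eq_top, defect_add_single hP, add_eq_left, sub_eq_zero, Nat.cast_inj,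
    Place.degree, eq_comm]
  exact ⟨Submodule.eq_top_of_finrank_eq, fun h => h ▸ finrank_top k _⟩

theorem defect_mono (hdeg : ∀ P : Place k F, 0 < P.degree) {D E : CurveDivisor k F} (h : D ≤ E)
    [FiniteDimensional k (riemannRochSpace D)] : D.defect ≤ E.defect :=
  CurveDivisor.le_induction (p := fun E => D.defect ≤ E.defect) le_rfl (fun _ P hE ih =>
    have := finiteDimensional_riemannRochSpace_of_le hdeg hE
    ih.trans (defect_le_defect_add_single (hdeg P))) E h

variable (k F) in
/-- Riemann's theorem for `F` with genus `g`: the spaces `L(D)` are finite-dimensional and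
`deg D - dim L(D) + 1` takes the constant value `g` for all large `D`. -/
structure HasGenus (g : ℤ) : Prop where
  degree_pos : ∀ P : Place k F, 0 < P.degree
  finite : ∀ D : CurveDivisor k F, FiniteDimensional k (riemannRochSpace D)
  exists_forall_ge : ∃ D₀ : CurveDivisor k F, ∀ D, D₀ ≤ D → D.defect = g

theorem HasGenus.genus_eq {g : ℤ} (h : HasGenus k F g) : genus k F = g := by
  obtain ⟨D₀, hD₀⟩ := h.exists_forall_ge
  refine IsGreatest.csSup_eq ⟨⟨D₀, hD₀ D₀ le_rfl⟩, ?_⟩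
  rintro _ ⟨D, rfl⟩
  have := h.finite D
  rw [← hD₀ (D ⊔ D₀) le_sup_right]
  exact defect_mono h.degree_pos le_sup_left

/-- Strong approximation relative to the divisor `D`: any function can be approximated at `P` to
the order prescribed by `D`, by a function whose poles elsewhere are bounded by `D`. -/
def StrongApprox (D : CurveDivisor k F) : Prop :=
  ∀ (P : Place k F) (h : F), ∃ f : F, P.valuation (f - h) ≤ exp (D P) ∧
    ∀ Q, Q ≠ P → Q.valuation f ≤ exp (D Q)

theorem StrongApprox.mono {D E : CurveDivisor k F} (h : StrongApprox D) (hDE : D ≤ E) :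
    StrongApprox E := by
  intro P g
  obtain ⟨f, hf, hf'⟩ := h P g
  exact ⟨f, hf.trans (exp_le_exp.2 (hDE P)), fun Q hQ => (hf' Q hQ).trans (exp_le_exp.2 (hDE Q))⟩

theorem StrongApprox.residueMap_surjective {D : CurveDivisor k F} (h : StrongApprox D)
    (P : Place k F) : Function.Surjective (residueMap D P) := by
  refine residueMap_surjective_iff.2 fun b hb => ?_
  obtain ⟨f, hfP, hf⟩ := h P b
  refine ⟨f, mem_riemannRochSpace_add_single_iff.2 ⟨?_, hf⟩, hfP⟩
  rw [← sub_add_cancel f b]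
  exact (P.valuation.map_add _ _).trans (max_le (hfP.trans (exp_le_exp.2 (by omega))) hb)

theorem strongApprox_of_residueMap_surjective {D : CurveDivisor k F}
    (h : ∀ E, D ≤ E → ∀ P, Function.Surjective (residueMap E P)) : StrongApprox D := by
  intro P b
  suffices key : ∀ (m : ℕ) (b : F), P.valuation b ≤ exp (D P + m) → ∃ f : F,
      P.valuation (f - b) ≤ exp (D P) ∧ ∀ Q, Q ≠ P → Q.valuation f ≤ exp (D Q) by
    rcases eq_or_ne b 0 with rfl | hb
    · exact ⟨0, by simp, by simp⟩
    · obtain ⟨n, hn⟩ := P.exists_eq_exp hb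
      exact key (n - D P).toNat b (by rw [hn, exp_le_exp]; omega)
  intro m
  induction m with
  | zero => exact fun b hb => ⟨0, by simpa using hb, by simp⟩
  | succ m ih =>
    intro b hb
    have hsurj := h _ (D.le_add_single P (Int.natCast_nonneg m)) P
    obtain ⟨f, hf, hfb⟩ := residueMap_surjective_iff.1 hsurj b (by simpa [add_assoc] using hb)
    rw [add_assoc, ← Finsupp.single_add, mem_riemannRochSpace_add_single_iff] at hf
    obtain ⟨f', hf', hf''⟩ := ih (b - f) (by rw [Valuation.map_sub_swap]; simpa using hfb)
    refine ⟨f + f', ?_, fun Q hQ =>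
      (Q.valuation.map_add _ _).trans (max_le (hf.2 Q hQ) (hf'' Q hQ))⟩
    rwa [show f + f' - b = f' - (b - f) by ring]

theorem hasGenus_of_strongApprox (hdeg : ∀ P : Place k F, 0 < P.degree) {D₀ : CurveDivisor k F}
    [FiniteDimensional k (riemannRochSpace D₀)] (h : StrongApprox D₀) :
    HasGenus k F D₀.defect where
  degree_pos := hdeg
  finite D :=
    have := finiteDimensional_riemannRochSpace_of_le hdeg (le_sup_right : D₀ ≤ D ⊔ D₀)
    Submodule.finiteDimensional_of_le (riemannRochSpace_mono (le_sup_left : D ≤ D ⊔ D₀))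
  exists_forall_ge := ⟨D₀, CurveDivisor.le_induction rfl fun _ P hD ih =>
    have := finiteDimensional_riemannRochSpace_of_le hdeg hD
    ((defect_add_single_eq_iff (hdeg P)).2 ((h.mono hD).residueMap_surjective P)).trans ih⟩

theorem HasGenus.exists_strongApprox {g : ℤ} (h : HasGenus k F g) :
    ∃ D₀ : CurveDivisor k F, StrongApprox D₀ ∧ ∀ D, D₀ ≤ D → D.defect = g := by
  obtain ⟨D₀, hD₀⟩ := h.exists_forall_ge
  refine ⟨D₀, strongApprox_of_residueMap_surjective fun E hE P => ?_, hD₀⟩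
  have := h.finite E
  rw [← defect_add_single_eq_iff (h.degree_pos P), hD₀ E hE]
  exact hD₀ _ (hE.trans (E.le_add_single P zero_le_one))

end RiemannRoch

/-- `F'` is the quadratic extension of `F`, in characteristic two, generated by a root `y` of the
Artin-Schreier equation `y² + y = u`. -/
structure IsArtinSchreier {F F' : Type*} [Field F] [Field F'] [Algebra F F'] (y : F') (u : F) :
    Prop where
  two_eq_zero : (2 : F) = 0
  eq : y ^ 2 + y = algebraMap F F' u
  ne_algebraMap : ∀ a, y ≠ algebraMap F F' a
  span : ∀ z, ∃ a b, z = algebraMap F F' a + algebraMap F F' b * y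

namespace IsArtinSchreier

open Polynomial in
/-- The polynomial `X² + X - u` whose roots solve the Artin-Schreier equation. -/
def poly {F : Type*} [Field F] (u : F) : F[X] := X ^ 2 + X - C u

variable {F F' : Type*} [Field F] [Field F'] [Algebra F F'] {y : F'} {u : F}

theorem monic_poly : (poly u).Monic := by
  unfold poly; monicity!

theorem natDegree_poly : (poly u).natDegree = 2 := by
  unfold poly; compute_degree!

variable (h : IsArtinSchreier y u)
include h

theorem map_two_eq_zero : (2 : F') = 0 := by
  rw [← map_ofNat (algebraMap F F') 2, h.two_eq_zero, map_zero]

theorem aeval_poly : Polynomial.aeval y (poly u) = 0 := by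
  simp [poly, h.eq]

theorem minpoly_eq : minpoly F y = poly u := by
  have hy : IsIntegral F y := ⟨poly u, monic_poly, h.aeval_poly⟩
  refine (Polynomial.eq_of_monic_of_dvd_of_natDegree_le (minpoly.monic hy) monic_poly
    (minpoly.dvd F y h.aeval_poly) ?_).symm
  rw [natDegree_poly, minpoly.two_le_natDegree_iff hy]
  rintro ⟨a, ha⟩
  exact h.ne_algebraMap a ha.symm

theorem adjoin_eq_top : IntermediateField.adjoin F {y} = ⊤ := by
  rw [eq_top_iff]
  rintro z -
  obtain ⟨a, b, rfl⟩ := h.span z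
  exact add_mem (IntermediateField.algebraMap_mem _ a) (mul_mem
    (IntermediateField.algebraMap_mem _ b) (IntermediateField.mem_adjoin_simple_self F y))

theorem finrank_eq : Module.finrank F F' = 2 := by
  rw [← IntermediateField.finrank_top', ← h.adjoin_eq_top, IntermediateField.adjoin.finrank
    ⟨poly u, monic_poly, h.aeval_poly⟩, h.minpoly_eq, natDegree_poly]

theorem finiteDimensional : FiniteDimensional F F' :=
  FiniteDimensional.of_finrank_pos (by rw [h.finrank_eq]; norm_num)

theorem isSeparable : Algebra.IsSeparable F F' := by
  have hsep : IsSeparable F y := by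
    have hderiv : Polynomial.derivative (poly u) = 1 := by
      simpa [poly, one_add_one_eq_two] using h.two_eq_zero
    rw [IsSeparable, h.minpoly_eq, Polynomial.separable_def, hderiv]
    exact isCoprime_one_right
  have := (IntermediateField.isSeparable_adjoin_simple_iff_isSeparable F F').2 hsep
  rw [h.adjoin_eq_top] at this
  exact Algebra.IsSeparable.of_algHom F (⊤ : IntermediateField F F')
    (IntermediateField.topEquiv (F := F) (E := F')).symm.toAlgHom

theorem add (w : F) : IsArtinSchreier (y + algebraMap F F' w) (u + w ^ 2 + w) where
  two_eq_zero := h.two_eq_zero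
  eq := by
    simp only [map_add, map_pow]
    linear_combination h.eq + y * algebraMap F F' w * h.map_two_eq_zero
  ne_algebraMap a ha := h.ne_algebraMap (a - w) (by rw [map_sub, ← ha]; ring)
  span z := by
    obtain ⟨a, b, rfl⟩ := h.span z
    exact ⟨a - b * w, b, by simp only [map_sub, map_mul]; ring⟩

theorem exists_algEquiv_apply_eq_add_one : ∃ σ : F' ≃ₐ[F] F', σ y = y + 1 := by
  have := h.finiteDimensional
  have : Algebra.IsQuadraticExtension F F' := ⟨h.finrank_eq⟩
  have hconj : IsConjRoot F y (y + 1) := by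
    have hpoly : poly (u + 1 ^ 2 + 1) = poly u := by
      rw [one_pow, add_assoc, one_add_one_eq_two, h.two_eq_zero, add_zero]
    rw [IsConjRoot, ← map_one (algebraMap F F'), (h.add 1).minpoly_eq, h.minpoly_eq, hpoly]
  obtain ⟨σ, hσ⟩ := isConjRoot_iff_exists_algEquiv.1 hconj.symm
  exact ⟨σ, hσ⟩

end IsArtinSchreier

namespace Place

section Conjugation

variable {k F F' : Type*} [Field k] [Field F] [Field F'] [Algebra k F] [Algebra k F']
  [Algebra F F'] [IsScalarTower k F F'] (σ : F' ≃ₐ[F] F') (P' : Place k F')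

omit [Algebra k F] [IsScalarTower k F F'] in
theorem exists_comap_algEquiv_eq_exp_neg_one :
    ∃ π, P'.valuation.comap (σ : F' →+* F') π = exp (-1 : ℤ) := by
  obtain ⟨π, hπ⟩ := P'.exists_uniformizer
  exact ⟨σ.symm π, by rw [Valuation.comap_apply, RingHom.coe_coe, σ.apply_symm_apply, hπ]⟩

instance comap_algEquiv_isNontrivial :
    (P'.valuation.comap (σ : F' →+* F')).IsNontrivial := by
  obtain ⟨π, hπ⟩ := P'.exists_comap_algEquiv_eq_exp_neg_one σ
  exact ⟨π, by rw [hπ]; exact exp_ne_zero, by rw [hπ, ← exp_zero, Ne, exp_inj]; decide⟩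

/-- The place with valuation `v ∘ σ`, for `v` the valuation of the given place and `σ` an
automorphism of the field. -/
def conj : Place k F' :=
  ofValuation (P'.valuation.comap (σ : F' →+* F')) fun c => by
    rw [Valuation.comap_apply, IsScalarTower.algebraMap_apply k F F', RingHom.coe_coe, σ.commutes,
      ← IsScalarTower.algebraMap_apply]
    exact P'.valuation_algebraMap_le_one c

theorem valuation_conj (z : F') : (P'.conj σ).valuation z = P'.valuation (σ z) := by
  rw [valuation_eq_of_valuationSubring_eq _ (P'.exists_comap_algEquiv_eq_exp_neg_one σ) rfl]
  rfl

theorem restrict_conj [Algebra.IsAlgebraic F F'] :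
    (P'.conj σ).restrict F = P'.restrict F := by
  rw [restrict_eq_iff]
  intro f hf
  rw [mem_ring_iff, valuation_conj, σ.commutes, ← mem_ring_iff]
  exact (mem_restrict_ring P' f).1 hf

end Conjugation

section Fiber

variable {k F F' : Type*} [Field k] [Field F] [Field F'] [Algebra k F] [Algebra k F']
  [Algebra F F'] [IsScalarTower k F F'] [FiniteDimensional F F'] [Algebra.IsSeparable F F']
  {P : Place k F} {P' : Place k F'} (hP : 0 < P.degree)

include hP in
theorem degree_le_of_mem_fiber (hP' : P' ∈ P.fiber F') : P.degree ≤ P'.degree := by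
  obtain rfl := mem_fiber.1 hP'
  exact P'.degree_restrict_le hP

theorem ramIdx_mul_degree_le_of_mem_fiber (hP' : P' ∈ P.fiber F') :
    P'.ramIdx F * P'.degree ≤ Module.finrank F F' * P.degree := by
  rw [← P.sum_ramIdx_mul_degree (F' := F')]
  exact Finset.single_le_sum (f := fun Q : Place k F' => Q.ramIdx F * Q.degree)
    (fun _ _ => Nat.zero_le _) hP'

include hP in
theorem ramIdx_le_finrank (hP' : P' ∈ P.fiber F') : P'.ramIdx F ≤ Module.finrank F F' :=
  Nat.le_of_mul_le_mul_right ((Nat.mul_le_mul_left _ (degree_le_of_mem_fiber hP hP')).trans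
    (ramIdx_mul_degree_le_of_mem_fiber hP')) hP

include hP in
theorem completely_split {s : Finset (Place k F')} (hs : s ⊆ P.fiber F')
    (hcard : Module.finrank F F' ≤ s.card) :
    s = P.fiber F' ∧ ∀ P' ∈ P.fiber F', P'.ramIdx F = 1 ∧ P'.degree = P.degree := by
  have hsum := P.sum_ramIdx_mul_degree (F' := F')
  have hle : ∀ Q ∈ P.fiber F', P.degree ≤ Q.ramIdx F * Q.degree := fun Q hQ =>
    (degree_le_of_mem_fiber hP hQ).trans (Nat.le_mul_of_pos_left _ Q.ramIdx_pos)
  have hcard_le : (P.fiber F').card ≤ Module.finrank F F' := by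
    refine Nat.le_of_mul_le_mul_right ?_ hP
    simpa only [hsum, smul_eq_mul] using Finset.card_nsmul_le_sum _ _ _ hle
  obtain rfl := Finset.eq_of_subset_of_card_le hs (hcard_le.trans hcard)
  refine ⟨rfl, fun P' hP' => ?_⟩
  have heq : P.degree = P'.ramIdx F * P'.degree := by
    refine (Finset.sum_eq_sum_iff_of_le hle).1 ?_ P' hP'
    rw [hsum, Finset.sum_const, smul_eq_mul, hcard_le.antisymm hcard]
  have hdeg : P'.degree = P.degree :=
    ((Nat.le_mul_of_pos_left _ P'.ramIdx_pos).trans_eq heq.symm).antisymm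
      (degree_le_of_mem_fiber hP hP')
  refine ⟨Nat.eq_of_mul_eq_mul_right hP ?_, hdeg⟩
  rw [one_mul, ← hdeg, ← heq, hdeg]

include hP in
theorem totally_ramified (hP' : P' ∈ P.fiber F') (he : P'.ramIdx F = Module.finrank F F') :
    P.fiber F' = {P'} ∧ P'.degree = P.degree := by
  classical
  have hsum := P.sum_ramIdx_mul_degree (F' := F')
  have hle := degree_le_of_mem_fiber hP hP'
  have hmul := Nat.mul_le_mul_left (Module.finrank F F') hle
  rw [← Finset.add_sum_erase _ _ hP', he] at hsum
  refine ⟨Finset.eq_singleton_iff_unique_mem.2 ⟨hP', fun Q hQ => by_contra fun hne => ?_⟩, ?_⟩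
  · have hQ_le := Finset.single_le_sum (f := fun Q : Place k F' => Q.ramIdx F * Q.degree)
      (fun _ _ => Nat.zero_le _) (Finset.mem_erase.2 ⟨hne, hQ⟩)
    have hQ_pos := Nat.mul_pos (Q.ramIdx_pos (F := F)) (hP.trans_le (degree_le_of_mem_fiber hP hQ))
    omega
  · exact Nat.eq_of_mul_eq_mul_left (Module.finrank_pos (R := F) (M := F')) (by omega)

end Fiber

end Place

section SqAddSelf

variable {F Γ : Type*} [Field F] [LinearOrderedCommGroupWithZero Γ] (v : Valuation F Γ) {z : F}

theorem valuation_sq_add_self_of_one_lt (hz : 1 < v z) : v (z ^ 2 + z) = v z ^ 2 := by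
  rw [Valuation.map_add_eq_of_lt_left, map_pow]
  rw [map_pow, sq]
  exact lt_mul_of_one_lt_left (zero_lt_one.trans hz) hz

theorem valuation_sq_add_self_le_one_iff : v (z ^ 2 + z) ≤ 1 ↔ v z ≤ 1 := by
  refine ⟨fun h => not_lt.1 fun hz => ?_, fun h => (v.map_add _ _).trans (max_le ?_ h)⟩
  · rw [valuation_sq_add_self_of_one_lt v hz] at h
    exact h.not_gt (one_lt_pow₀ hz two_ne_zero)
  · rw [map_pow]
    exact pow_le_one₀ zero_le h

end SqAddSelf

namespace Place

variable {k F : Type*} [Field k] [Field F] [Algebra k F] {P : Place k F} {u : F}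

theorem exists_valuation_sub_sq_lt_one [Finite k] (h2 : (2 : F) = 0) (hP : 0 < P.degree) {c : F}
    (hc : P.valuation c ≤ 1) : ∃ d : F, P.valuation d ≤ 1 ∧ P.valuation (c - d ^ 2) < 1 := by
  have : FiniteDimensional k P.residueField := FiniteDimensional.of_finrank_pos hP
  have : Finite P.residueField := Module.finite_of_finite k
  have hchar : CharP P.residueField 2 := by
    refine CharTwo.of_one_ne_zero_of_two_eq_zero one_ne_zero ?_
    rw [← map_ofNat (IsLocalRing.residue P.ring) 2, (Subtype.ext h2 : (2 : P.ring) = 0), map_zero]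
  obtain ⟨r, hr⟩ := (bijective_frobenius P.residueField 2).surjective
    (IsLocalRing.residue P.ring ⟨c, P.mem_ring_iff.2 hc⟩)
  obtain ⟨d, rfl⟩ := IsLocalRing.residue_surjective r
  refine ⟨d, P.mem_ring_iff.1 d.2, ?_⟩
  rw [frobenius_def, ← map_pow, eq_comm, P.residue_eq_iff] at hr
  exact hr

variable (P u) in
/-- The Artin-Schreier class of `u` can be represented, locally at `P`, by an element with at most
a simple pole. -/
def WeakAt : Prop :=
  ∃ w : F, P.valuation (u + w ^ 2 + w) ≤ exp (1 : ℤ)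

theorem WeakAt.of_add_sq_add (h2 : (2 : F) = 0) {w : F} (h : P.WeakAt (u + w ^ 2 + w)) :
    P.WeakAt u := by
  obtain ⟨w', hw'⟩ := h
  refine ⟨w + w', ?_⟩
  rwa [show u + (w + w') ^ 2 + (w + w') = u + w ^ 2 + w + w' ^ 2 + w' by
    linear_combination w * w' * h2]

variable (P u) in
open Classical in
/-- The local conductor indicator: `0` if the Artin-Schreier class of `u` is represented by an
element integral at `P`, and `1` otherwise. -/
def wild : ℕ :=
  if ∃ w : F, P.valuation (u + w ^ 2 + w) ≤ 1 then 0 else 1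

theorem WeakAt.exists_eq_wild (h : P.WeakAt u) :
    (∃ w, P.wild u = 0 ∧ P.valuation (u + w ^ 2 + w) ≤ 1) ∨
    (∃ w, P.wild u = 1 ∧ P.valuation (u + w ^ 2 + w) = exp (1 : ℤ)) := by
  by_cases hu : ∃ w : F, P.valuation (u + w ^ 2 + w) ≤ 1
  · obtain ⟨w, hw⟩ := hu
    exact Or.inl ⟨w, if_pos ⟨w, hw⟩, hw⟩
  · obtain ⟨w, hw⟩ := h
    refine Or.inr ⟨w, if_neg hu, hw.antisymm (not_lt.1 fun hlt => hu ⟨w, ?_⟩)⟩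
    rwa [lt_exp_iff_le_exp_sub_one, sub_self, exp_zero] at hlt

end Place

namespace IsArtinSchreier

variable {k F F' : Type*} [Field k] [Field F] [Field F'] [Algebra k F] [Algebra k F']
  [Algebra F F'] [IsScalarTower k F F'] [FiniteDimensional F F'] [Algebra.IsSeparable F F']
  {y : F'} {u : F} (h : IsArtinSchreier y u) {P : Place k F}
include h

theorem valuation_lt_one_or (hu : P.valuation u < 1) {P' : Place k F'} (hP' : P' ∈ P.fiber F') :
    P'.valuation y < 1 ∨ P'.valuation (y + 1) < 1 := by
  by_contra! hcon
  have hlt : P'.valuation (algebraMap F F' u) < 1 := by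
    rwa [P'.valuation_algebraMap_lt_one_iff, Place.mem_fiber.1 hP']
  rw [← h.eq, show y ^ 2 + y = y * (y + 1) by ring, map_mul] at hlt
  exact hlt.not_ge (one_le_mul hcon.1 hcon.2)

variable (hP : 0 < P.degree)
include hP

theorem exists_mem_fiber_valuation_lt_one (hu : P.valuation u < 1) :
    ∃ P₀ ∈ P.fiber F', ∃ P₁ ∈ P.fiber F', P₀.valuation y < 1 ∧ P₁.valuation (y + 1) < 1 := by
  obtain ⟨σ, hσ⟩ := h.exists_algEquiv_apply_eq_add_one
  obtain ⟨P', hP'⟩ := Place.fiber_nonempty (F' := F') hP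
  have hconj : P'.conj σ ∈ P.fiber F' := by
    rw [Place.mem_fiber, Place.restrict_conj, Place.mem_fiber.1 hP']
  rcases h.valuation_lt_one_or hu hP' with hv | hv
  · refine ⟨P', hP', P'.conj σ, hconj, hv, ?_⟩
    rwa [Place.valuation_conj, map_add, map_one, hσ, add_assoc, one_add_one_eq_two,
      h.map_two_eq_zero, add_zero]
  · exact ⟨P'.conj σ, hconj, P', hP', by rwa [Place.valuation_conj, hσ], hv⟩

theorem split (hu : P.valuation u < 1) :
    ∃ P₀ P₁ : Place k F', P₀ ≠ P₁ ∧ (∀ P', P' ∈ P.fiber F' ↔ P' = P₀ ∨ P' = P₁) ∧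
      (∀ P' ∈ P.fiber F', P'.ramIdx F = 1 ∧ P'.degree = P.degree) ∧
      P₀.valuation y < 1 ∧ P₁.valuation (y + 1) < 1 := by
  classical
  obtain ⟨P₀, hP₀, P₁, hP₁, hv₀, hv₁⟩ := h.exists_mem_fiber_valuation_lt_one hP hu
  have hne : P₀ ≠ P₁ := by
    rintro rfl
    have hone := P₀.valuation.map_sub_lt hv₁ hv₀
    rw [add_sub_cancel_left, map_one] at hone
    exact lt_irrefl _ hone
  obtain ⟨hfib, hsplit⟩ := Place.completely_split hP (s := {P₀, P₁})
    (Finset.insert_subset hP₀ (Finset.singleton_subset_iff.2 hP₁))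
    (by rw [h.finrank_eq, Finset.card_pair hne])
  exact ⟨P₀, P₁, hne, fun P' => by rw [← hfib, Finset.mem_insert, Finset.mem_singleton], hsplit,
    hv₀, hv₁⟩

theorem ramIdx_eq_one (hu : P.valuation u ≤ 1) {P' : Place k F'} (hP' : P' ∈ P.fiber F') :
    P'.ramIdx F = 1 := by
  have hr := Place.mem_fiber.1 hP'
  by_contra hne
  have he : P'.ramIdx F = 2 := by
    have hpos := P'.ramIdx_pos (F := F)
    have hle := Place.ramIdx_le_finrank hP hP'
    rw [h.finrank_eq] at hle
    omega
  have hd : P'.degree = P.degree :=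
    (Place.totally_ramified hP hP' (he.trans h.finrank_eq.symm)).2
  have hy : P'.valuation y ≤ 1 := by
    rwa [← valuation_sq_add_self_le_one_iff, h.eq, P'.valuation_algebraMap_le_one_iff, hr]
  -- A totally ramified place has the residue field of `P`, so `y` is congruent to some `c ∈ F`;
  -- then `u + c² + c` vanishes at `P`, and `P` splits.
  obtain ⟨c, hc, hyc⟩ := P'.exists_valuation_sub_algebraMap_lt_one (F := F) (by rwa [hr])
    (by rw [hd, hr]) hy
  have hlt : P.valuation (u + c ^ 2 + c) < 1 := by
    rw [← hr, ← P'.valuation_algebraMap_lt_one_iff, show algebraMap F F' (u + c ^ 2 + c) =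
      (y - algebraMap F F' c) * (y + algebraMap F F' c + 1) by
        rw [map_add, map_add, ← h.eq, map_pow]
        linear_combination (algebraMap F F' c + algebraMap F F' c ^ 2) * h.map_two_eq_zero, map_mul]
    refine mul_lt_one_of_nonneg_of_lt_one_left zero_le hyc ?_
    refine P'.valuation.map_add_le (P'.valuation.map_add_le hy ?_) (map_one _).le
    rwa [P'.valuation_algebraMap_le_one_iff]
  obtain ⟨_, _, _, _, hsplit, _⟩ := (h.add c).split hP hlt
  exact hne (hsplit P' hP').1

theorem ramified (hu : P.valuation u = exp (1 : ℤ)) :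
    ∃ P' : Place k F', P.fiber F' = {P'} ∧ P'.ramIdx F = 2 ∧ P'.degree = P.degree ∧
      P'.valuation y = exp (1 : ℤ) := by
  obtain ⟨P', hP'⟩ := Place.fiber_nonempty (F' := F') hP
  have hpos := P'.ramIdx_pos (F := F)
  have hle := Place.ramIdx_le_finrank hP hP'
  have hval := congrArg P'.valuation h.eq
  rw [P'.valuation_algebraMap_eq_pow, Place.mem_fiber.1 hP', hu, ← exp_nsmul] at hval
  have hgt : 1 < P'.valuation y := by
    rw [← not_le, ← valuation_sq_add_self_le_one_iff, hval, ← exp_zero, exp_le_exp]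
    simpa using hpos.ne'
  rw [valuation_sq_add_self_of_one_lt _ hgt] at hval
  obtain ⟨n, hn⟩ := P'.exists_eq_exp (f := y) fun h0 => by simp [h0] at hgt
  rw [hn, ← exp_nsmul, exp_inj] at hval
  simp only [nsmul_eq_mul, Nat.cast_ofNat, mul_one] at hval
  rw [h.finrank_eq] at hle
  have he : P'.ramIdx F = 2 := by omega
  obtain ⟨hfib, hdeg⟩ := Place.totally_ramified hP hP' (he.trans h.finrank_eq.symm)
  exact ⟨P', hfib, he, hdeg, by rw [hn, exp_inj]; omega⟩

theorem sum_degree_fiber (hw : P.WeakAt u) :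
    ∑ P' ∈ P.fiber F', P'.degree + P.wild u * P.degree = 2 * P.degree := by
  rcases hw.exists_eq_wild with ⟨w, h0, hw⟩ | ⟨w, h1, hw⟩
  · rw [h0, zero_mul, add_zero, ← h.finrank_eq, ← P.sum_ramIdx_mul_degree (F' := F')]
    exact Finset.sum_congr rfl fun P' hP' => by rw [(h.add w).ramIdx_eq_one hP hw hP', one_mul]
  · obtain ⟨P', hfib, -, hd, -⟩ := (h.add w).ramified hP hw
    rw [hfib, Finset.sum_singleton, h1, hd]
    ring

theorem weakAt_algebraMap_of_eq_exp_one [Finite k] (hu : P.valuation u = exp (1 : ℤ)) {u₂ : F}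
    (hu₂ : P.valuation u₂ = exp (1 : ℤ)) {P' : Place k F'} (hP' : P' ∈ P.fiber F') :
    P'.WeakAt (algebraMap F F' u₂) := by
  obtain ⟨P'', hfib, he, -, hy⟩ := h.ramified hP hu
  obtain rfl := Finset.mem_singleton.1 (hfib ▸ hP')
  have hr := Place.mem_fiber.1 hP'
  have hu0 : u ≠ 0 := fun h0 => exp_ne_zero (hu.symm.trans (h0 ▸ map_zero _))
  have hc : P.valuation (u₂ / u) ≤ 1 := by rw [map_div₀, hu, hu₂, div_self exp_ne_zero]
  -- Subtracting `d² y²`, with `d` a square root of `u₂ / u` in the residue field, lowers the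
  -- order of the pole of `u₂ = (u₂ / u) (y² + y)` from two to one.
  obtain ⟨d, hd, hcd⟩ := P.exists_valuation_sub_sq_lt_one h.two_eq_zero hP hc
  have hu₂y : algebraMap F F' u₂ = algebraMap F F' (u₂ / u) * (y ^ 2 + y) := by
    rw [h.eq, ← map_mul, div_mul_cancel₀ _ hu0]
  have hexpand : algebraMap F F' u₂ + (algebraMap F F' d * y) ^ 2 + algebraMap F F' d * y =
      algebraMap F F' (u₂ / u - d ^ 2) * y ^ 2 +
        (algebraMap F F' (u₂ / u) * y + algebraMap F F' d * y) := by
    rw [map_sub, map_pow]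
    linear_combination hu₂y + algebraMap F F' d ^ 2 * y ^ 2 * h.map_two_eq_zero
  refine ⟨algebraMap F F' d * y, ?_⟩
  rw [hexpand]
  refine P'.valuation.map_add_le ?_ (P'.valuation.map_add_le ?_ ?_)
  · rw [map_mul, map_pow, hy, P'.valuation_algebraMap_eq_pow, he, hr, ← mul_pow]
    have hle : P.valuation (u₂ / u - d ^ 2) * exp (1 : ℤ) ≤ 1 := by
      simpa using mul_le_exp_add (lt_one_iff_le_exp_neg_one.1 hcd) (le_refl (exp (1 : ℤ)))
    exact (pow_le_one₀ zero_le hle).trans (by rw [← exp_zero, exp_le_exp]; norm_num)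
  all_goals
    rw [map_mul, hy]
    exact mul_le_of_le_one_left' ((P'.valuation_algebraMap_le_one_iff _).2 (by rwa [hr]))

theorem weakAt_algebraMap [Finite k] {u₂ : F} (hu : P.WeakAt u) (hu₂ : P.WeakAt u₂)
    {P' : Place k F'} (hP' : P' ∈ P.fiber F') : P'.WeakAt (algebraMap F F' u₂) := by
  have hr := Place.mem_fiber.1 hP'
  rcases hu.exists_eq_wild with ⟨w, -, hw⟩ | ⟨w, -, hw⟩
  · obtain ⟨w₂, hw₂⟩ := hu₂
    refine ⟨algebraMap F F' w₂, ?_⟩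
    rwa [← map_pow, ← map_add, ← map_add, P'.valuation_algebraMap_eq_pow,
      (h.add w).ramIdx_eq_one hP hw hP', pow_one, hr]
  · rcases hu₂.exists_eq_wild with ⟨w₂, -, hw₂⟩ | ⟨w₂, -, hw₂⟩
    · refine ⟨algebraMap F F' w₂, ?_⟩
      rw [← map_pow, ← map_add, ← map_add]
      refine ((P'.valuation_algebraMap_le_one_iff _).2 (by rwa [hr])).trans ?_
      rw [← exp_zero, exp_le_exp]; norm_num
    · refine Place.WeakAt.of_add_sq_add h.map_two_eq_zero (w := algebraMap F F' w₂) ?_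
      rw [← map_pow, ← map_add, ← map_add]
      exact (h.add w).weakAt_algebraMap_of_eq_exp_one hP hw hw₂ hP'

end IsArtinSchreier

section Conorm

variable {k F F' : Type*} [Field k] [Field F] [Field F'] [Algebra k F] [Algebra k F']
  [Algebra F F'] [IsScalarTower k F F'] [FiniteDimensional F F'] [Algebra.IsSeparable F F']

namespace CurveDivisor

variable (F') in
open Classical in
/-- The conorm of a divisor: its pullback to an extension, with multiplicities given by the
ramification indices. -/
def conorm (D : CurveDivisor k F) : CurveDivisor k F' :=
  Finsupp.onFinset (D.support.biUnion fun P => P.fiber F')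
    (fun P' => (P'.ramIdx F : ℤ) * D (P'.restrict F)) fun P' hP' => by
      rw [Finset.mem_biUnion]
      exact ⟨P'.restrict F, Finsupp.mem_support_iff.2 (right_ne_zero_of_mul hP'),
        Place.mem_fiber.2 rfl⟩

theorem conorm_apply (D : CurveDivisor k F) (P' : Place k F') :
    D.conorm F' P' = (P'.ramIdx F : ℤ) * D (P'.restrict F) := rfl

theorem deg_conorm (D : CurveDivisor k F) :
    deg (D.conorm F') = Module.finrank F F' * deg D := by
  classical
  unfold deg conorm
  rw [Finsupp.onFinset_sum _ (fun _ => by simp), Finset.sum_biUnion, Finsupp.sum, Finset.mul_sum]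
  · refine Finset.sum_congr rfl fun P _ => ?_
    calc ∑ P' ∈ P.fiber F', (P'.ramIdx F * D (P'.restrict F)) * P'.degree
      _ = D P * ((∑ P' ∈ P.fiber F', P'.ramIdx F * P'.degree : ℕ) : ℤ) := by
        rw [Nat.cast_sum, Finset.mul_sum]
        refine Finset.sum_congr rfl fun P' hP' => ?_
        rw [Place.mem_fiber.1 hP']
        push_cast
        ring
      _ = Module.finrank F F' * (D P * P.degree) := by
        rw [P.sum_ramIdx_mul_degree]
        push_cast
        ring
  · intro P _ Q _ hPQ
    refine Finset.disjoint_left.2 fun P' hP hQ => hPQ ?_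
    rw [← Place.mem_fiber.1 hP, Place.mem_fiber.1 hQ]

theorem exists_le_conorm (D : CurveDivisor k F) (D' : CurveDivisor k F') :
    ∃ E, D ≤ E ∧ D' ≤ E.conorm F' := by
  classical
  set G : CurveDivisor k F := ∑ P' ∈ D'.support, Finsupp.single (P'.restrict F) |D' P'|
  have hG_nonneg : 0 ≤ G := Finset.sum_nonneg fun P' _ => Finsupp.single_nonneg.2 (abs_nonneg _)
  have hD'_le (P' : Place k F') : D' P' ≤ G (P'.restrict F) := by
    by_cases hP' : P' ∈ D'.support
    · have hle := Finset.single_le_sum (f := fun P' : Place k F' =>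
        (Finsupp.single (P'.restrict F) |D' P'| : CurveDivisor k F))
        (fun Q _ => Finsupp.single_nonneg.2 (abs_nonneg _)) hP' (P'.restrict F)
      simp only [Finsupp.single_eq_same] at hle
      exact (le_abs_self _).trans hle
    · rw [Finsupp.notMem_support_iff.1 hP']
      exact hG_nonneg _
  refine ⟨(D ⊔ 0) + G, le_sup_left.trans (le_add_of_nonneg_right hG_nonneg), fun P' => ?_⟩
  have hsup : 0 ≤ (D ⊔ 0) (P'.restrict F) := (le_sup_right : (0 : CurveDivisor k F) ≤ D ⊔ 0) _
  have hG_apply : 0 ≤ G (P'.restrict F) := hG_nonneg _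
  have hpos : (1 : ℤ) ≤ P'.ramIdx F := by exact_mod_cast P'.ramIdx_pos (F := F)
  rw [conorm_apply, Finsupp.add_apply]
  nlinarith [hD'_le P']

end CurveDivisor

theorem algebraMap_mem_riemannRochSpace_conorm_iff (hdeg : ∀ P : Place k F, 0 < P.degree)
    {D : CurveDivisor k F} {a : F} :
    algebraMap F F' a ∈ riemannRochSpace (D.conorm F') ↔ a ∈ riemannRochSpace D := by
  have hiff (P' : Place k F') : P'.valuation (algebraMap F F' a) ≤ exp (D.conorm F' P') ↔
      (P'.restrict F).valuation a ≤ exp (D (P'.restrict F)) := by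
    rw [P'.valuation_algebraMap_eq_pow, CurveDivisor.conorm_apply, ← nsmul_eq_mul, exp_nsmul]
    exact pow_le_pow_iff_left₀ zero_le zero_le P'.ramIdx_pos.ne'
  simp only [mem_riemannRochSpace, hiff]
  refine ⟨fun h P => ?_, fun h P' => h _⟩
  obtain ⟨P', hP'⟩ := Place.fiber_nonempty (F' := F') (hdeg P)
  exact Place.mem_fiber.1 hP' ▸ h P'

end Conorm

theorem StrongApprox.exists_forall_valuation_sub_le {k F : Type*} [Field k] [Field F]
    [Algebra k F] {D : CurveDivisor k F} (h : StrongApprox D) (f : Place k F →₀ F) :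
    ∃ a, ∀ P, P.valuation (a - f P) ≤ exp (D P) := by
  classical
  choose g hg hg' using fun P => h P (f P)
  refine ⟨∑ P ∈ f.support, g P, fun P => ?_⟩
  by_cases hP : P ∈ f.support
  · rw [← Finset.add_sum_erase _ _ hP, add_sub_right_comm]
    exact P.valuation.map_add_le (hg P) (P.valuation.map_sum_le fun Q hQ =>
      hg' Q P (Finset.ne_of_mem_erase hQ).symm)
  · rw [Finsupp.notMem_support_iff.1 hP, sub_zero]
    exact P.valuation.map_sum_le fun Q hQ => hg' Q P fun hPQ => hP (hPQ ▸ hQ)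

namespace Place

variable {k F : Type*} [Field k] [Field F] [Algebra k F] (P : Place k F)

theorem valuation_sq_le_exp_iff (c : F) (m : ℤ) {j : ℤ} (hj : 0 ≤ j) (hj' : j < 2) :
    P.valuation c ^ 2 ≤ exp (2 * m + j) ↔ P.valuation c ≤ exp m := by
  rcases eq_or_ne c 0 with rfl | hc
  · simp
  · obtain ⟨n, hn⟩ := P.exists_eq_exp hc
    rw [hn, ← exp_nsmul, exp_le_exp, exp_le_exp]
    simp only [nsmul_eq_mul, Nat.cast_ofNat]
    omega

theorem valuation_sq_ne_valuation_sq_mul_exp_one (a : F) {b : F} (hb : b ≠ 0) :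
    P.valuation a ^ 2 ≠ P.valuation b ^ 2 * exp (1 : ℤ) := by
  obtain ⟨n, hn⟩ := P.exists_eq_exp hb
  rcases eq_or_ne a 0 with rfl | ha
  · simp [hn]
  · obtain ⟨m, hm⟩ := P.exists_eq_exp ha
    rw [hm, hn, ← exp_nsmul, ← exp_nsmul, ← exp_add, Ne, exp_inj]
    simp only [nsmul_eq_mul, Nat.cast_ofNat]
    omega

theorem wild_eq_zero {P : Place k F} {u : F} (hu : P.valuation u ≤ 1) : P.wild u = 0 :=
  if_pos ⟨0, by simpa using hu⟩

end Place

namespace IsArtinSchreier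

theorem trace_apply {F F' : Type*} [Field F] [Field F'] [Algebra F F'] {y : F'} {u : F}
    (h : IsArtinSchreier y u) (a b : F) :
    Algebra.trace F F' (algebraMap F F' a + algebraMap F F' b * y) = b := by
  have := h.finiteDimensional
  have htrace_y : Algebra.trace F F' y = 1 := by
    have hcoeff : (poly u).nextCoeff = 1 := by
      rw [Polynomial.nextCoeff_of_natDegree_pos (by rw [natDegree_poly]; exact two_pos),
        natDegree_poly]
      simp [poly, Polynomial.coeff_X]
    rw [trace_eq_finrank_mul_minpoly_nextCoeff, h.adjoin_eq_top, IntermediateField.finrank_top,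
      h.minpoly_eq, hcoeff]
    linear_combination -h.two_eq_zero
  rw [map_add, Algebra.trace_algebraMap, h.finrank_eq, two_nsmul, ← two_mul, h.two_eq_zero,
    ← Algebra.smul_def, map_smul, htrace_y, smul_eq_mul, zero_mul, zero_add, mul_one]

section Local

variable {k F F' : Type*} [Field k] [Field F] [Field F'] [Algebra k F] [Algebra k F']
  [Algebra F F'] [IsScalarTower k F F'] [FiniteDimensional F F'] [Algebra.IsSeparable F F']
  {y : F'} {u : F} (h : IsArtinSchreier y u) {P : Place k F} (hP : 0 < P.degree)
include h hP

theorem forall_fiber_le_iff_of_le_one (hu : P.valuation u ≤ 1) (a b : F) (n : ℤ) :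
    (∀ P' ∈ P.fiber F', P'.valuation (algebraMap F F' a + algebraMap F F' b * y) ≤
      exp ((P'.ramIdx F : ℤ) * n)) ↔ P.valuation b ≤ exp n ∧ P.valuation a ≤ exp n := by
  have hramIdx (P' : Place k F') (hP' : P' ∈ P.fiber F') : P'.ramIdx F = 1 :=
    h.ramIdx_eq_one hP hu hP'
  have hval (P' : Place k F') (hP' : P' ∈ P.fiber F') (f : F) :
      P'.valuation (algebraMap F F' f) = P.valuation f := by
    rw [P'.valuation_algebraMap_eq_pow, hramIdx P' hP', pow_one, Place.mem_fiber.1 hP']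
  have hy (P' : Place k F') (hP' : P' ∈ P.fiber F') : P'.valuation y ≤ 1 := by
    rwa [← valuation_sq_add_self_le_one_iff, h.eq, hval P' hP']
  have hby (P' : Place k F') (hP' : P' ∈ P.fiber F') (hb : P.valuation b ≤ exp n) :
      P'.valuation (algebraMap F F' b * y) ≤ exp n := by
    rw [map_mul, hval P' hP']
    exact (mul_le_of_le_one_right' (hy P' hP')).trans hb
  constructor
  · intro hle
    replace hle (P' : Place k F') (hP' : P' ∈ P.fiber F') :
        P'.valuation (algebraMap F F' a + algebraMap F F' b * y) ≤ exp n := by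
      simpa [hramIdx P' hP'] using hle P' hP'
    obtain ⟨σ, hσ⟩ := h.exists_algEquiv_apply_eq_add_one
    obtain ⟨P', hP'⟩ := Place.fiber_nonempty (F' := F') hP
    have hconj : P'.conj σ ∈ P.fiber F' := by
      rw [Place.mem_fiber, Place.restrict_conj, Place.mem_fiber.1 hP']
    -- `b` is the difference of `z = a + b y` and its conjugate.
    have hb : P.valuation b ≤ exp n := by
      have hsub := P'.valuation.map_sub_le (Place.valuation_conj σ P' _ ▸ hle _ hconj)
        (hle P' hP')
      rwa [← hval P' hP', show algebraMap F F' b = σ (algebraMap F F' a + algebraMap F F' b * y) -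
        (algebraMap F F' a + algebraMap F F' b * y) by simp [hσ]; ring]
    refine ⟨hb, ?_⟩
    rw [← hval P' hP', ← add_sub_cancel_right (algebraMap F F' a) (algebraMap F F' b * y)]
    exact P'.valuation.map_sub_le (hle P' hP') (hby P' hP' hb)
  · rintro ⟨hb, ha⟩ P' hP'
    rw [hramIdx P' hP', Nat.cast_one, one_mul]
    exact P'.valuation.map_add_le (by rwa [hval P' hP']) (hby P' hP' hb)

theorem forall_fiber_le_iff_of_eq_exp_one (hu : P.valuation u = exp (1 : ℤ)) (a b : F) (n : ℤ) :
    (∀ P' ∈ P.fiber F', P'.valuation (algebraMap F F' a + algebraMap F F' b * y) ≤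
      exp ((P'.ramIdx F : ℤ) * n)) ↔ P.valuation b ≤ exp (n - 1) ∧ P.valuation a ≤ exp n := by
  obtain ⟨P', hfib, he, -, hy⟩ := h.ramified hP hu
  have hval (f : F) : P'.valuation (algebraMap F F' f) = P.valuation f ^ 2 := by
    rw [P'.valuation_algebraMap_eq_pow, he,
      Place.mem_fiber.1 (hfib ▸ Finset.mem_singleton_self P')]
  have hmax : P'.valuation (algebraMap F F' a + algebraMap F F' b * y) =
      max (P.valuation a ^ 2) (P.valuation b ^ 2 * exp (1 : ℤ)) := by
    rcases eq_or_ne b 0 with rfl | hb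
    · simp [hval]
    · rw [Valuation.map_add_of_distinct_val, map_mul, hval, hval, hy]
      rw [map_mul, hval, hval, hy]
      exact P.valuation_sq_ne_valuation_sq_mul_exp_one a hb
  have ha := P.valuation_sq_le_exp_iff a n le_rfl two_pos
  have hb := P.valuation_sq_le_exp_iff b (n - 1) zero_le_one one_lt_two
  rw [add_zero] at ha
  rw [show 2 * (n - 1) + 1 = 2 * n - 1 by ring, ← mul_exp_le_exp_iff] at hb
  simp only [hfib, Finset.mem_singleton, forall_eq]
  rw [hmax, he, Nat.cast_ofNat, max_le_iff, ha, hb, and_comm]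

theorem forall_fiber_le_iff {w : F}
    (hw : P.wild u = 0 ∧ P.valuation (u + w ^ 2 + w) ≤ 1 ∨
      P.wild u = 1 ∧ P.valuation (u + w ^ 2 + w) = exp (1 : ℤ)) (a b : F) (n : ℤ) :
    (∀ P' ∈ P.fiber F', P'.valuation (algebraMap F F' a + algebraMap F F' b * y) ≤
      exp ((P'.ramIdx F : ℤ) * n)) ↔
      P.valuation b ≤ exp (n - P.wild u) ∧ P.valuation (a - b * w) ≤ exp n := by
  have hz : algebraMap F F' a + algebraMap F F' b * y =
      algebraMap F F' (a - b * w) + algebraMap F F' b * (y + algebraMap F F' w) := by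
    simp only [map_sub, map_mul]
    ring
  rw [hz]
  rcases hw with ⟨h0, hw⟩ | ⟨h1, hw⟩
  · rw [(h.add w).forall_fiber_le_iff_of_le_one hP hw, h0, Nat.cast_zero, sub_zero]
  · rw [(h.add w).forall_fiber_le_iff_of_eq_exp_one hP hw, h1, Nat.cast_one]

end Local

end IsArtinSchreier

section RiemannHurwitz

variable {k F F' : Type*} [Field k] [Field F] [Field F'] [Algebra k F] [Algebra k F']
  [Algebra F F'] [IsScalarTower k F F'] {y : F'} {u : F} {w : Place k F →₀ F}
  {E : CurveDivisor k F}

variable (u w E) in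
/-- A reduction of the Artin-Schreier class of `u`: for each place a representative
`u + w² + w` that is either integral or has a simple pole, together with the divisor `E` of the
places where the pole cannot be removed. The different of the extension is `2 E`. -/
structure IsReduction : Prop where
  apply_eq_wild : ∀ P : Place k F, E P = P.wild u
  wild_eq : ∀ P : Place k F, P.wild u = 0 ∧ P.valuation (u + w P ^ 2 + w P) ≤ 1 ∨
    P.wild u = 1 ∧ P.valuation (u + w P ^ 2 + w P) = exp (1 : ℤ)

theorem exists_isReduction (hweak : ∀ P : Place k F, P.WeakAt u) (S : Finset (Place k F))
    (hS : ∀ P ∉ S, P.valuation u ≤ 1) :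
    ∃ (w : Place k F →₀ F) (E : CurveDivisor k F), IsReduction u w E ∧
      E.deg = ∑ P ∈ S, (P.wild u * P.degree : ℕ) := by
  classical
  have hw (P : Place k F) : ∃ w, (w ≠ 0 → P ∈ S) ∧
      (P.wild u = 0 ∧ P.valuation (u + w ^ 2 + w) ≤ 1 ∨
        P.wild u = 1 ∧ P.valuation (u + w ^ 2 + w) = exp (1 : ℤ)) := by
    by_cases hP : P ∈ S
    · rcases (hweak P).exists_eq_wild with ⟨w, hw⟩ | ⟨w, hw⟩
      · exact ⟨w, fun _ => hP, Or.inl hw⟩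
      · exact ⟨w, fun _ => hP, Or.inr hw⟩
    · exact ⟨0, fun h => (h rfl).elim,
        Or.inl ⟨Place.wild_eq_zero (hS P hP), by simpa using hS P hP⟩⟩
  choose w hw_mem hw using hw
  have hmem (P : Place k F) (hP : (P.wild u : ℤ) ≠ 0) : P ∈ S := by
    by_contra hPS
    exact hP (by rw [Place.wild_eq_zero (hS P hPS), Nat.cast_zero])
  refine ⟨Finsupp.onFinset S w hw_mem, Finsupp.onFinset S (fun P => (P.wild u : ℤ)) hmem,
    ⟨fun _ => rfl, hw⟩, ?_⟩
  rw [CurveDivisor.deg, Finsupp.onFinset_sum _ (fun _ => by simp), Nat.cast_sum]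
  exact Finset.sum_congr rfl fun P _ => (Nat.cast_mul _ _).symm

namespace IsReduction

variable [FiniteDimensional F F'] [Algebra.IsSeparable F F'] (r : IsReduction u w E)
  (h : IsArtinSchreier y u)
include r h

theorem mem_riemannRochSpace_conorm_iff (hdeg : ∀ P : Place k F, 0 < P.degree)
    (D : CurveDivisor k F) (a b : F) :
    algebraMap F F' a + algebraMap F F' b * y ∈ riemannRochSpace (D.conorm F') ↔
      b ∈ riemannRochSpace (D - E) ∧ ∀ P, P.valuation (a - b * w P) ≤ exp (D P) := by
  simp only [mem_riemannRochSpace, Finsupp.sub_apply, r.apply_eq_wild, ← forall_and,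
    ← h.forall_fiber_le_iff (hdeg _) (r.wild_eq _), CurveDivisor.conorm_apply]
  exact ⟨fun H P P' hP' => Place.mem_fiber.1 hP' ▸ H P',
    fun H P' => H _ P' (Place.mem_fiber.2 rfl)⟩

theorem trace_mem (hdeg : ∀ P : Place k F, 0 < P.degree) (D : CurveDivisor k F) {z : F'}
    (hz : z ∈ riemannRochSpace (D.conorm F')) :
    Algebra.trace F F' z ∈ riemannRochSpace (D - E) := by
  obtain ⟨a, b, rfl⟩ := h.span z
  rw [h.trace_apply]
  exact ((r.mem_riemannRochSpace_conorm_iff h hdeg D a b).1 hz).1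

theorem exists_trace_eq (hdeg : ∀ P : Place k F, 0 < P.degree) {D : CurveDivisor k F}
    (hD : StrongApprox D) {b : F} (hb : b ∈ riemannRochSpace (D - E)) :
    ∃ z ∈ riemannRochSpace (D.conorm F'), Algebra.trace F F' z = b := by
  obtain ⟨a, ha⟩ := hD.exists_forall_valuation_sub_le (w.mapRange (b * ·) (mul_zero b))
  exact ⟨_, (r.mem_riemannRochSpace_conorm_iff h hdeg D a b).2 ⟨hb, ha⟩, h.trace_apply a b⟩

/-- The trace `L(D) → L(D - E)`, where the first divisor is pulled back to the extension. -/
def traceMap (hdeg : ∀ P : Place k F, 0 < P.degree) (D : CurveDivisor k F) :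
    riemannRochSpace (D.conorm F') →ₗ[k] riemannRochSpace (D - E) :=
  ((Algebra.trace F F').restrictScalars k).restrict fun _ => r.trace_mem h hdeg D

/-- The kernel of the trace on `L(D)` is the space `L(D)` of the base field. -/
def kerTraceMapEquiv (hdeg : ∀ P : Place k F, 0 < P.degree) (D : CurveDivisor k F) :
    riemannRochSpace D ≃ₗ[k] LinearMap.ker (r.traceMap h hdeg D) := by
  refine LinearEquiv.ofBijective (LinearMap.codRestrict _
    (((IsScalarTower.toAlgHom k F F').toLinearMap.restrict fun a ha =>
      (algebraMap_mem_riemannRochSpace_conorm_iff hdeg).2 ha)) fun a => ?_) ⟨?_, ?_⟩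
  · refine Subtype.ext ?_
    have htrace := h.trace_apply (a : F) 0
    rwa [map_zero, zero_mul, add_zero] at htrace
  · intro a b hab
    exact Subtype.ext ((algebraMap F F').injective (congrArg (fun z => z.1.1) hab))
  · rintro ⟨⟨z, hz⟩, hz0⟩
    obtain ⟨a, b, rfl⟩ := h.span z
    obtain rfl : b = 0 := (h.trace_apply a b).symm.trans (congrArg Subtype.val hz0)
    have hz_eq : algebraMap F F' a = algebraMap F F' a + algebraMap F F' 0 * y := by simp
    rw [← hz_eq] at hz
    exact ⟨⟨a, (algebraMap_mem_riemannRochSpace_conorm_iff hdeg).1 hz⟩,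
      Subtype.ext (Subtype.ext hz_eq)⟩

theorem finiteDimensional_conorm {g : ℤ} (hg : HasGenus k F g) (D : CurveDivisor k F) :
    FiniteDimensional k (riemannRochSpace (D.conorm F')) := by
  have := hg.finite D
  have := hg.finite (D - E)
  let T := r.traceMap h hg.degree_pos D
  have : FiniteDimensional k (LinearMap.ker T) :=
    Module.Finite.equiv (r.kerTraceMapEquiv h hg.degree_pos D)
  have : FiniteDimensional k (_ ⧸ LinearMap.ker T) := Module.Finite.equiv T.quotKerEquivRange.symm
  exact Module.Finite.of_submodule_quotient (LinearMap.ker T)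

theorem defect_conorm {g : ℤ} (hg : HasGenus k F g) {D : CurveDivisor k F}
    (hD : StrongApprox D) (hD_defect : D.defect = g) (hDE_defect : (D - E).defect = g) :
    (D.conorm F').defect = 2 * g - 1 + E.deg := by
  have := r.finiteDimensional_conorm h hg D
  have hrange : LinearMap.range (r.traceMap h hg.degree_pos D) = ⊤ := by
    rw [LinearMap.range_eq_top]
    rintro ⟨b, hb⟩
    obtain ⟨z, hz, rfl⟩ := r.exists_trace_eq h hg.degree_pos hD hb
    exact ⟨⟨z, hz⟩, rfl⟩
  have hrank := (r.traceMap h hg.degree_pos D).finrank_range_add_finrank_ker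
  rw [hrange, finrank_top, ← (r.kerTraceMapEquiv h hg.degree_pos D).finrank_eq] at hrank
  rw [CurveDivisor.defect] at hD_defect hDE_defect ⊢
  rw [CurveDivisor.deg_sub] at hDE_defect
  rw [CurveDivisor.deg_conorm, h.finrank_eq, Nat.cast_ofNat]
  omega

theorem hasGenus {g : ℤ} (hg : HasGenus k F g) : HasGenus k F' (2 * g - 1 + E.deg) := by
  have hdeg' (P' : Place k F') : 0 < P'.degree := P'.degree_pos_of_restrict (hg.degree_pos _)
  have hfinite (D' : CurveDivisor k F') : FiniteDimensional k (riemannRochSpace D') := by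
    obtain ⟨D, -, hD⟩ := CurveDivisor.exists_le_conorm (0 : CurveDivisor k F) D'
    have := r.finiteDimensional_conorm h hg D
    exact Submodule.finiteDimensional_of_le (riemannRochSpace_mono hD)
  obtain ⟨D₀, hsa, hD₀⟩ := hg.exists_strongApprox
  have hE : 0 ≤ E := fun P => by simp [r.apply_eq_wild]
  have hdefect (D : CurveDivisor k F) (hD : D₀ + E ≤ D) :
      (D.conorm F').defect = 2 * g - 1 + E.deg := by
    have hD₀_le : D₀ ≤ D := (le_add_of_nonneg_right hE).trans hD
    exact r.defect_conorm h hg (hsa.mono hD₀_le) (hD₀ D hD₀_le) (hD₀ _ (le_sub_iff_add_le.2 hD))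
  refine ⟨hdeg', hfinite, (D₀ + E).conorm F', fun D' hD' => le_antisymm ?_ ?_⟩
  · obtain ⟨D, hD_le, hD⟩ := CurveDivisor.exists_le_conorm (D₀ + E) D'
    rw [← hdefect D hD_le]
    exact defect_mono hdeg' hD
  · rw [← hdefect (D₀ + E) le_rfl]
    exact defect_mono hdeg' hD'

end IsReduction

/-- The Riemann-Hurwitz formula: each place with `wild = 1` contributes twice its degree to the
different. -/
theorem IsArtinSchreier.hasGenus [FiniteDimensional F F'] [Algebra.IsSeparable F F']
    (h : IsArtinSchreier y u) {g : ℤ} (hg : HasGenus k F g)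
    (hweak : ∀ P : Place k F, P.WeakAt u) (S : Finset (Place k F))
    (hS : ∀ P ∉ S, P.valuation u ≤ 1) :
    HasGenus k F' (2 * g - 1 + ∑ P ∈ S, (P.wild u * P.degree : ℕ)) := by
  obtain ⟨w, E, r, hE⟩ := exists_isReduction hweak S hS
  exact hE ▸ r.hasGenus h hg

end RiemannHurwitz

open Polynomial in
/-- `x` is transcendental over `k` and `F = k(x)`. -/
structure IsRationalGenerator (k : Type*) {F : Type*} [Field k] [Field F] [Algebra k F] (x : F) :
    Prop where
  transcendental : Transcendental k x
  exists_div : ∀ f : F, ∃ p q : k[X], q ≠ 0 ∧ f = aeval x p / aeval x q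

section PolynomialValues

open Polynomial

variable {k F : Type*} [Field k] [Field F] [Algebra k F] {x : F}

theorem Place.valuation_aeval_le_one {P : Place k F} (hP : P.valuation x ≤ 1) (q : k[X]) :
    P.valuation (aeval x q) ≤ 1 := by
  rw [aeval_eq_sum_range]
  refine P.valuation.map_sum_le fun i _ => ?_
  rw [Algebra.smul_def, map_mul, map_pow]
  exact mul_le_one' (P.valuation_algebraMap_le_one _) (pow_le_one₀ zero_le hP)

theorem Place.valuation_aeval_le_pow {P : Place k F} (hP : 1 < P.valuation x) {q : k[X]} {n : ℕ}
    (hn : q.natDegree ≤ n) : P.valuation (aeval x q) ≤ P.valuation x ^ n := by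
  rw [aeval_eq_sum_range]
  refine P.valuation.map_sum_le fun i hi => ?_
  rw [Algebra.smul_def, map_mul, map_pow]
  exact (mul_le_of_le_one_left' (P.valuation_algebraMap_le_one _)).trans
    (pow_le_pow_right₀ hP.le (by grind))

theorem Place.valuation_aeval_eq_pow {P : Place k F} (hP : 1 < P.valuation x) {q : k[X]}
    (hq : q ≠ 0) : P.valuation (aeval x q) = P.valuation x ^ q.natDegree := by
  have hlead : P.valuation (aeval x (C q.leadingCoeff * X ^ q.natDegree)) =
      P.valuation x ^ q.natDegree := by
    rw [map_mul, aeval_C, map_mul, P.valuation_algebraMap (leadingCoeff_ne_zero.2 hq), one_mul,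
      map_pow, aeval_X, map_pow]
  conv_lhs => rw [← eraseLead_add_C_mul_X_pow q, map_add]
  rcases eraseLead_natDegree_lt_or_eraseLead_eq_zero q with hlt | h0
  · rw [P.valuation.map_add_eq_of_lt_right, hlead]
    rw [hlead]
    exact (valuation_aeval_le_pow hP le_rfl).trans_lt (pow_lt_pow_right₀ hP hlt)
  · rw [h0, map_zero, zero_add, hlead]

end PolynomialValues

namespace IsRationalGenerator

open Polynomial

variable {k F : Type*} [Field k] [Field F] [Algebra k F] {x : F}

section Basic

variable (hx : IsRationalGenerator k x)
include hx

theorem ne_zero : x ≠ 0 := by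
  rintro rfl
  exact hx.transcendental isAlgebraic_zero

theorem aeval_ne_zero {q : k[X]} (hq : q ≠ 0) : aeval x q ≠ 0 := fun h0 =>
  hx.transcendental ⟨q, hq, h0⟩

theorem inv : IsRationalGenerator k x⁻¹ where
  transcendental h := hx.transcendental (by simpa using h.inv)
  exists_div f := by
    obtain ⟨p, q, hq, rfl⟩ := hx.exists_div f
    have hx0 := hx.ne_zero
    refine ⟨p.reverse * X ^ q.natDegree, q.reverse * X ^ p.natDegree,
      mul_ne_zero (by simpa using hq) (pow_ne_zero _ X_ne_zero), ?_⟩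
    have aeval_reverse (r : k[X]) : aeval x⁻¹ r.reverse = aeval x r * x⁻¹ ^ r.natDegree := by
      let _ := invertibleOfNonzero hx0
      have hr := eval₂_reverse_mul_pow (algebraMap k F) x r
      rw [invOf_eq_inv] at hr
      rw [aeval_def, aeval_def, ← hr, mul_assoc, ← mul_pow, mul_inv_cancel₀ hx0, one_pow, mul_one]
    simp only [map_mul, map_pow, aeval_X, aeval_reverse]
    have hq0 := hx.aeval_ne_zero hq
    field_simp

end Basic

section Places

/-- The structure of `k[X]`-algebra on `F` given by `X ↦ x`. It is not an instance, since it
depends on `x`. -/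
abbrev polynomialAlgebra (k : Type*) {F : Type*} [Field k] [Field F] [Algebra k F] (x : F) :
    Algebra k[X] F :=
  (aeval x).toRingHom.toAlgebra

theorem algebraMap_eq_aeval (q : k[X]) :
    letI := polynomialAlgebra k x
    algebraMap k[X] F q = aeval x q :=
  rfl

theorem isScalarTower :
    letI := polynomialAlgebra k x
    IsScalarTower k k[X] F :=
  let _ := polynomialAlgebra k x
  IsScalarTower.of_algebraMap_eq fun c => by
    rw [algebraMap_eq_aeval, algebraMap_eq, aeval_C]

variable (hx : IsRationalGenerator k x)
include hx

theorem isFractionRing :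
    letI := polynomialAlgebra k x
    IsFractionRing k[X] F :=
  let _ := polynomialAlgebra k x
  have : FaithfulSMul k[X] F := (faithfulSMul_iff_algebraMap_injective _ _).2 <|
    (injective_iff_map_eq_zero _).2 fun q hq => by_contra fun h0 => hx.aeval_ne_zero h0 hq
  IsFractionRing.of_field _ _ fun z => by
    obtain ⟨p, q, -, hz⟩ := hx.exists_div z
    exact ⟨p, q, hz⟩

/-- The place of `k(x)` given by an irreducible polynomial in `x`. -/
def place {p : k[X]} (hp : Irreducible p) : Place k F :=
  letI := polynomialAlgebra k x
  have := isScalarTower (k := k) (x := x)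
  have := hx.isFractionRing
  Place.ofPrime k F (⟨Ideal.span {p}, (Ideal.span_singleton_prime hp.ne_zero).2 hp.prime,
    by simpa using hp.ne_zero⟩ : HeightOneSpectrum k[X])

variable {p : k[X]} (hp : Irreducible p)

theorem valuation_place_le_one : (hx.place hp).valuation x ≤ 1 := by
  let _ := polynomialAlgebra k x
  have := isScalarTower (k := k) (x := x)
  have := hx.isFractionRing
  have hX : (hx.place hp).valuation (aeval x (X : k[X])) ≤ 1 := by
    rw [place, Place.ofPrime_valuation]
    exact HeightOneSpectrum.valuation_le_one _ _
  rwa [aeval_X] at hX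

theorem valuation_place_aeval : (hx.place hp).valuation (aeval x p) = exp (-1 : ℤ) := by
  let _ := polynomialAlgebra k x
  have := isScalarTower (k := k) (x := x)
  have := hx.isFractionRing
  rw [place, Place.ofPrime_valuation, ← algebraMap_eq_aeval,
    HeightOneSpectrum.valuation_of_algebraMap]
  exact HeightOneSpectrum.intValuation_singleton _ hp.ne_zero rfl

theorem degree_place : (hx.place hp).degree = p.natDegree := by
  let _ := polynomialAlgebra k x
  have := isScalarTower (k := k) (x := x)
  have := hx.isFractionRing
  rw [place, Place.ofPrime_degree]
  exact finrank_quotient_span_eq_natDegree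

theorem eq_place_of_valuation_aeval_lt_one {P : Place k F} (hP : P.valuation x ≤ 1)
    (hPp : P.valuation (aeval x p) < 1) : P = hx.place hp := by
  let _ := polynomialAlgebra k x
  have := isScalarTower (k := k) (x := x)
  have := hx.isFractionRing
  obtain ⟨q, rfl⟩ := P.exists_eq_ofPrime (B := k[X]) fun b => by
    rw [P.mem_ring_iff, algebraMap_eq_aeval]; exact P.valuation_aeval_le_one hP b
  rw [Place.ofPrime_valuation, ← algebraMap_eq_aeval, q.valuation_lt_one_iff_mem] at hPp
  have hle : Ideal.span {p} ≤ q.asIdeal := (Ideal.span_singleton_le_iff_mem _).2 hPp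
  have hmax : (Ideal.span {p}).IsMaximal := PrincipalIdealRing.isMaximal_of_irreducible hp
  exact congrArg _ (HeightOneSpectrum.ext (hmax.eq_of_le q.isPrime.ne_top hle).symm)

theorem exists_eq_place {P : Place k F} (hP : P.valuation x ≤ 1) :
    ∃ (p : k[X]) (hp : Irreducible p), P = hx.place hp := by
  let _ := polynomialAlgebra k x
  have := isScalarTower (k := k) (x := x)
  have := hx.isFractionRing
  obtain ⟨q, hq⟩ := P.exists_eq_ofPrime (B := k[X]) fun b => by
    rw [P.mem_ring_iff, algebraMap_eq_aeval]; exact P.valuation_aeval_le_one hP b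
  obtain ⟨p, hpq, hp⟩ := q.isPrime.exists_mem_prime_of_ne_bot q.ne_bot
  refine ⟨p, hp.irreducible, hx.eq_place_of_valuation_aeval_lt_one hp.irreducible hP ?_⟩
  rwa [hq, Place.ofPrime_valuation, ← algebraMap_eq_aeval, q.valuation_lt_one_iff_mem]

theorem exists_valuation_place_sub_aeval_lt_one {g : F} (hg : (hx.place hp).valuation g ≤ 1) :
    ∃ c : k[X], c.degree < p.degree ∧ (hx.place hp).valuation (aeval x c - g) < 1 := by
  let _ := polynomialAlgebra k x
  have := isScalarTower (k := k) (x := x)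
  have := hx.isFractionRing
  have hval : (hx.place hp).valuation = _ := Place.ofPrime_valuation _
  rw [hval] at hg
  obtain ⟨b, hb⟩ := HeightOneSpectrum.exists_valuation_sub_lt_of_integer _ hg 1
  rw [← hval, algebraMap_eq_aeval, Units.val_one] at hb
  refine ⟨b % p, degree_mod_lt b hp.ne_zero, ?_⟩
  have hdiv : aeval x (b % p) - g = aeval x b - g - aeval x p * aeval x (b / p) := by
    have h := congrArg (aeval x) (EuclideanDomain.div_add_mod b p)
    rw [map_add, map_mul] at h
    linear_combination h
  rw [hdiv]
  refine (Valuation.map_sub _ _ _).trans_lt (max_lt hb ?_)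
  rw [map_mul, valuation_place_aeval, lt_one_iff_le_exp_neg_one]
  exact mul_le_of_le_one_right' (Place.valuation_aeval_le_one (hx.valuation_place_le_one hp) _)

theorem exists_eq_aeval {f : F} (hf : ∀ P : Place k F, P.valuation x ≤ 1 → P.valuation f ≤ 1) :
    ∃ q : k[X], f = aeval x q := by
  let _ := polynomialAlgebra k x
  have := isScalarTower (k := k) (x := x)
  have := hx.isFractionRing
  obtain ⟨q, hq⟩ := HeightOneSpectrum.mem_integers_of_valuation_le_one (R := k[X]) F f fun q => by
    rw [← Place.ofPrime_valuation (k := k)]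
    refine hf _ ?_
    rw [← aeval_X (R := k) x, Place.ofPrime_valuation]
    exact q.valuation_le_one _
  exact ⟨q, hq.symm⟩

/-- The pole of `x` in `k(x)`. -/
def placeInfty : Place k F :=
  hx.inv.place irreducible_X

theorem valuation_placeInfty : hx.placeInfty.valuation x = exp (1 : ℤ) := by
  have h := hx.inv.valuation_place_aeval irreducible_X
  rw [aeval_X, map_inv₀, inv_eq_iff_eq_inv, ← exp_neg, neg_neg] at h
  exact h

theorem degree_placeInfty : hx.placeInfty.degree = 1 := by
  rw [placeInfty, degree_place, natDegree_X]

theorem eq_placeInfty {P : Place k F} (hP : 1 < P.valuation x) : P = hx.placeInfty := by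
  refine hx.inv.eq_place_of_valuation_aeval_lt_one irreducible_X ?_ ?_
  · rw [map_inv₀]
    exact inv_le_one_of_one_le₀ hP.le
  · rw [aeval_X, map_inv₀]
    exact inv_lt_one_of_one_lt₀ hP

end Places

section Genus

variable (hx : IsRationalGenerator k x)
include hx

theorem degree_pos (P : Place k F) : 0 < P.degree := by
  rcases le_or_gt (P.valuation x) 1 with h | h
  · obtain ⟨p, hp, rfl⟩ := hx.exists_eq_place h
    rw [degree_place]
    exact hp.natDegree_pos
  · rw [hx.eq_placeInfty h, degree_placeInfty]
    exact one_pos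

theorem valuation_aeval_div_pow_le_one {p c : k[X]} (hp : Irreducible p) (hc : c.degree < p.degree)
    {n : ℕ} (hn : n ≠ 0) {Q : Place k F} (hQ : Q ≠ hx.place hp) :
    Q.valuation (aeval x c / aeval x p ^ n) ≤ 1 := by
  rw [map_div₀, map_pow]
  rcases le_or_gt (Q.valuation x) 1 with hQx | hQx
  · have hQp : Q.valuation (aeval x p) = 1 := (Place.valuation_aeval_le_one hQx p).antisymm
      (not_lt.1 fun h => hQ (hx.eq_place_of_valuation_aeval_lt_one hp hQx h))
    rw [hQp, one_pow, div_one]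
    exact Place.valuation_aeval_le_one hQx c
  · rw [Place.valuation_aeval_eq_pow hQx hp.ne_zero, ← pow_mul]
    exact div_le_one_of_le₀ (Place.valuation_aeval_le_pow hQx
      ((natDegree_le_natDegree hc.le).trans (Nat.le_mul_of_pos_right _ (by omega)))) zero_le

theorem residueMap_place_surjective {D : CurveDivisor k F} (hD : 0 ≤ D) {p : k[X]}
    (hp : Irreducible p) : Function.Surjective (residueMap D (hx.place hp)) := by
  set P := hx.place hp
  refine residueMap_surjective_iff.2 fun b hb => ?_
  obtain ⟨m, hm⟩ := Int.eq_ofNat_of_zero_le (hD P)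
  have hPp : P.valuation (aeval x p ^ (m + 1)) = exp (-(m + 1) : ℤ) := by
    rw [map_pow, hx.valuation_place_aeval, ← exp_nsmul]
    simp
  have hp0 : aeval x p ^ (m + 1) ≠ 0 := pow_ne_zero _ (hx.aeval_ne_zero hp.ne_zero)
  obtain ⟨c, hc, hcb⟩ := hx.exists_valuation_place_sub_aeval_lt_one hp
    (g := b * aeval x p ^ (m + 1)) (by
      rw [map_mul, hPp, ← exp_zero, mul_exp_le_exp_iff]
      simpa [hm] using hb)
  have hfb : P.valuation (aeval x c / aeval x p ^ (m + 1) - b) ≤ exp (D P) := by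
    rw [div_sub' hp0, mul_comm _ b, map_div₀, hPp, div_eq_mul_inv, ← exp_neg, mul_exp_le_exp_iff]
    rw [lt_one_iff_le_exp_neg_one] at hcb
    simpa [hm] using hcb
  refine ⟨_, mem_riemannRochSpace_add_single_iff.2 ⟨?_, fun Q hQ => ?_⟩, hfb⟩
  · rw [← sub_add_cancel (aeval x c / _) b]
    exact (P.valuation.map_add _ _).trans (max_le (hfb.trans (exp_le_exp.2 (by omega))) hb)
  · exact (hx.valuation_aeval_div_pow_le_one hp hc m.succ_ne_zero hQ).trans
      (exp_zero.ge.trans (exp_le_exp.2 (hD Q)))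

theorem residueMap_surjective {D : CurveDivisor k F} (hD : 0 ≤ D) (P : Place k F) :
    Function.Surjective (residueMap D P) := by
  rcases le_or_gt (P.valuation x) 1 with hP | hP
  · obtain ⟨p, hp, rfl⟩ := hx.exists_eq_place hP
    exact hx.residueMap_place_surjective hD hp
  · rw [hx.eq_placeInfty hP]
    exact hx.inv.residueMap_place_surjective hD irreducible_X

theorem riemannRochSpace_zero : riemannRochSpace (0 : CurveDivisor k F) = Submodule.span k {1} := by
  refine le_antisymm (fun f hf => ?_) ?_
  · have hf' (P : Place k F) : P.valuation f ≤ 1 := hf P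
    obtain ⟨q, rfl⟩ := hx.exists_eq_aeval fun P _ => hf' P
    have hinfty : 1 < hx.placeInfty.valuation x := by
      rw [hx.valuation_placeInfty, ← exp_zero, exp_lt_exp]; exact one_pos
    have hq : q.natDegree = 0 := by
      by_contra hq
      have hpole := hf' hx.placeInfty
      rw [Place.valuation_aeval_eq_pow hinfty (ne_zero_of_natDegree_gt (Nat.pos_of_ne_zero hq))]
        at hpole
      exact hpole.not_gt (one_lt_pow₀ hinfty hq)
    rw [eq_C_of_natDegree_eq_zero hq, aeval_C, Submodule.mem_span_singleton]
    exact ⟨_, (Algebra.algebraMap_eq_smul_one _).symm⟩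
  · rw [Submodule.span_singleton_le_iff_mem]
    exact fun P => (map_one P.valuation).le

theorem hasGenus_zero : HasGenus k F 0 := by
  have : FiniteDimensional k (riemannRochSpace (0 : CurveDivisor k F)) := by
    rw [hx.riemannRochSpace_zero]; infer_instance
  have h := hasGenus_of_strongApprox hx.degree_pos
    (strongApprox_of_residueMap_surjective fun E hE => hx.residueMap_surjective hE)
  rwa [CurveDivisor.defect, hx.riemannRochSpace_zero, finrank_span_singleton one_ne_zero,
    CurveDivisor.deg_zero] at h

end Genus

end IsRationalGenerator

section CardEight

variable {k : Type*} [Field k] (hk : Nat.card k = 8)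
include hk

omit [Field k] in
theorem finite_of_card_eq_eight : Finite k := Nat.finite_of_card_ne_zero (by omega)

theorem pow_eight_of_card_eq_eight (a : k) : a ^ 8 = a := by
  have := finite_of_card_eq_eight hk
  have := Fintype.ofFinite k
  have h := FiniteField.pow_card a
  rwa [← Nat.card_eq_fintype_card, hk] at h

theorem two_eq_zero_of_card_eq_eight : (2 : k) = 0 := by
  have := finite_of_card_eq_eight hk
  have := Fintype.ofFinite k
  have hcard : ((Nat.card k : ℕ) : k) = 0 := by
    rw [Nat.card_eq_fintype_card, FiniteField.cast_card_eq_zero]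
  rw [hk] at hcard
  refine pow_eq_zero_iff three_ne_zero |>.1 ?_
  rw [← hcard]
  norm_num

theorem pow_seven_of_card_eq_eight {a : k} (ha : a ≠ 0) : a ^ 7 = 1 :=
  mul_right_cancel₀ ha (by linear_combination pow_eight_of_card_eq_eight hk a)

theorem sq_add_self_add_one_ne_zero_of_card_eq_eight (a : k) : a ^ 2 + a + 1 ≠ 0 := by
  intro h
  have ha : a ≠ 0 := by rintro rfl; simp at h
  have hpow : a ^ 3 = 1 := by linear_combination (a - 1) * h
  have ha1 : a = 1 := by
    linear_combination pow_seven_of_card_eq_eight hk ha - (a ^ 4 + a) * hpow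
  rw [ha1] at h
  exact one_ne_zero (α := k) (by linear_combination h - two_eq_zero_of_card_eq_eight hk)

/-- If `z` has trace `z + z² + z⁴ = 0` to `𝔽₂`, then `c = z + z⁴` solves `c² + c = z`. -/
theorem exists_sq_add_self_eq_of_trace_eq_zero {z : k} (hz : z ^ 4 + z ^ 2 + z = 0) :
    ∃ c : k, c ^ 2 + c = z :=
  have h2 := two_eq_zero_of_card_eq_eight hk
  have h8 := pow_eight_of_card_eq_eight hk z
  ⟨z + z ^ 4, by linear_combination hz + h8 + z ^ 5 * h2⟩

theorem exists_sq_add_self_eq {a : k} (ha : a ≠ 0) (ha1 : a ≠ 1) :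
    ∃ c : k, c ^ 2 + c = a + 1 + 1 / a := by
  have h2 := two_eq_zero_of_card_eq_eight hk
  have h7 := pow_seven_of_card_eq_eight hk ha
  have hgeom : a ^ 6 + a ^ 5 + a ^ 4 + a ^ 3 + a ^ 2 + a + 1 = 0 := by
    refine (mul_eq_zero.1 (?_ : (a - 1) * _ = 0)).resolve_left (sub_ne_zero.2 ha1)
    linear_combination h7
  have hinv : 1 / a = a ^ 6 := by
    rw [div_eq_iff ha, ← h7]
    ring
  refine exists_sq_add_self_eq_of_trace_eq_zero hk ?_
  have hsq : (a + 1 + 1 / a) ^ 2 = a ^ 2 + 1 + a ^ 5 := by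
    rw [hinv]
    linear_combination (a + a ^ 6 + a ^ 7) * h2 + a ^ 5 * h7
  have hfour : (a + 1 + 1 / a) ^ 4 = a ^ 4 + 1 + a ^ 3 := by
    rw [pow_mul _ 2 2, hsq]
    linear_combination (a ^ 2 + a ^ 5 + a ^ 7) * h2 + a ^ 3 * h7
  rw [hfour, hsq, hinv]
  linear_combination hgeom + h2

end CardEight

namespace Place

variable {k F : Type*} [Field k] [Field F] [Algebra k F]

theorem exists_valuation_sub_algebraMap_lt_one_of_degree_eq_one {P : Place k F}
    (hd : P.degree = 1) {f : F} (hf : P.valuation f ≤ 1) :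
    ∃ c : k, P.valuation (f - algebraMap k F c) < 1 := by
  obtain ⟨c, hc⟩ := (finrank_eq_one_iff_of_nonzero' (1 : P.residueField) one_ne_zero).1 hd
    (IsLocalRing.residue P.ring ⟨f, P.mem_ring_iff.2 hf⟩)
  refine ⟨c, ?_⟩
  rw [Algebra.smul_def, mul_one] at hc
  change IsLocalRing.residue P.ring (algebraMap k P.ring c) = _ at hc
  rw [eq_comm, P.residue_eq_iff] at hc
  exact hc

theorem valuation_le_one_of_isAlgebraic (P : Place k F) {a : F} (ha : IsAlgebraic k a) :
    P.valuation a ≤ 1 :=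
  P.mem_ring_iff.1 (P.mem_ring_of_isIntegral P.algebraMap_mem ha.isIntegral)

theorem mem_range_of_isAlgebraic {P : Place k F} (hd : P.degree = 1) {a : F}
    (ha : IsAlgebraic k a) : a ∈ (algebraMap k F).range := by
  obtain ⟨c, hc⟩ := exists_valuation_sub_algebraMap_lt_one_of_degree_eq_one hd
    (P.valuation_le_one_of_isAlgebraic ha)
  have hinv := P.valuation_le_one_of_isAlgebraic (ha.sub (isAlgebraic_algebraMap c)).inv
  refine ⟨c, (sub_eq_zero.1 (by_contra fun h0 => ?_)).symm⟩
  rw [map_inv₀, inv_le_one₀ (zero_lt_iff.2 ((map_ne_zero _).2 h0))] at hinv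
  exact hinv.not_gt hc

theorem WeakAt.of_valuation_le {P : Place k F} {u : F} (h : P.valuation u ≤ exp (1 : ℤ)) :
    P.WeakAt u :=
  ⟨0, by simpa using h⟩

/-- The value of `x` at `P` is one of `∞, 0, 1, ω, ω²`, where `ω² + ω + 1 = 0`. This set is stable
under the correspondence `y² + y = x + 1 + 1 / x` in both directions, and the ramification of the
tower lies over it. -/
def IsBad (P : Place k F) (x : F) : Prop :=
  1 < P.valuation x ∨ P.valuation x < 1 ∨ P.valuation (x + 1) < 1 ∨
    P.valuation (x ^ 2 + x + 1) < 1

theorem valuation_eq_one_of_not_isBad {P : Place k F} {x : F} (hx : ¬ P.IsBad x) :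
    P.valuation x = 1 := by
  simp only [IsBad, not_or, not_lt] at hx
  exact hx.1.antisymm hx.2.1

theorem exists_valuation_sub_lt_one_of_not_isBad (h2 : (2 : F) = 0) {P : Place k F}
    (hd : P.degree = 1) {x : F} (hx : ¬ P.IsBad x) :
    ∃ a : k, a ≠ 0 ∧ a ≠ 1 ∧ P.valuation (x - algebraMap k F a) < 1 := by
  have hv := valuation_eq_one_of_not_isBad hx
  simp only [IsBad, not_or, not_lt] at hx
  obtain ⟨a, ha⟩ := exists_valuation_sub_algebraMap_lt_one_of_degree_eq_one hd hv.le
  refine ⟨a, ?_, ?_, ha⟩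
  · rintro rfl
    rw [map_zero, sub_zero, hv] at ha
    exact lt_irrefl _ ha
  · rintro rfl
    rw [map_one, show x - 1 = x + 1 by linear_combination -h2] at ha
    exact hx.2.2.1.not_gt ha

end Place

section Polynomial

open Polynomial

theorem natDegree_sq_add_X_add_one {k : Type*} [Field k] :
    (X ^ 2 + X + 1 : k[X]).natDegree = 2 := by
  compute_degree!

theorem irreducible_sq_add_X_add_one {k : Type*} [Field k]
    (hk : ∀ a : k, a ^ 2 + a + 1 ≠ 0) :
    Irreducible (X ^ 2 + X + 1 : k[X]) := by
  refine irreducible_of_degree_le_three_of_not_isRoot ?_ fun a ha => hk a (by simpa using ha)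
  rw [natDegree_sq_add_X_add_one]
  decide

end Polynomial

namespace IsRationalGenerator

open Polynomial

variable {k F : Type*} [Field k] [Field F] [Algebra k F] {x : F} (hx : IsRationalGenerator k x)
include hx

theorem eq_place_iff {p : k[X]} (hp : Irreducible p) {P : Place k F} :
    P = hx.place hp ↔ P.valuation x ≤ 1 ∧ P.valuation (aeval x p) < 1 := by
  refine ⟨?_, fun h => hx.eq_place_of_valuation_aeval_lt_one hp h.1 h.2⟩
  rintro rfl
  rw [valuation_place_aeval, ← exp_zero, exp_lt_exp]
  exact ⟨hx.valuation_place_le_one hp, by norm_num⟩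

theorem eq_placeInfty_iff {P : Place k F} : P = hx.placeInfty ↔ 1 < P.valuation x := by
  refine ⟨?_, hx.eq_placeInfty⟩
  rintro rfl
  rw [valuation_placeInfty, ← exp_zero, exp_lt_exp]
  exact one_pos

theorem place_ne_placeInfty {p : k[X]} (hp : Irreducible p) : hx.place hp ≠ hx.placeInfty := by
  rw [Ne, eq_placeInfty_iff, not_lt]
  exact hx.valuation_place_le_one hp

theorem valuation_place_aeval_lt_one_iff {p : k[X]} (hp : Irreducible p) {q : k[X]} :
    (hx.place hp).valuation (aeval x q) < 1 ↔ p ∣ q := by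
  let _ := polynomialAlgebra k x
  have := isScalarTower (k := k) (x := x)
  have := hx.isFractionRing
  rw [place, Place.ofPrime_valuation, ← algebraMap_eq_aeval,
    HeightOneSpectrum.valuation_lt_one_iff_mem]
  exact Ideal.mem_span_singleton

theorem place_ne_place {p q : k[X]} (hp : Irreducible p) (hq : Irreducible q) (hp' : p.Monic)
    (hq' : q.Monic) (hpq : p ≠ q) : hx.place hp ≠ hx.place hq := by
  intro h
  have hdvd := (hx.valuation_place_aeval_lt_one_iff hp).1 ((hx.eq_place_iff hq).1 h).2
  exact hpq (eq_of_monic_of_associated hp' hq' (hp.associated_of_dvd hq hdvd))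

theorem valuation_le_exp_one (P : Place k F) : P.valuation x ≤ exp (1 : ℤ) := by
  rcases le_or_gt (P.valuation x) 1 with h | h
  · exact h.trans (by rw [← exp_zero, exp_le_exp]; exact zero_le_one)
  · rw [hx.eq_placeInfty h, valuation_placeInfty]

theorem valuation_inv_aeval_le_exp_one {p : k[X]} (hp : Irreducible p) (P : Place k F) :
    P.valuation (aeval x p)⁻¹ ≤ exp (1 : ℤ) := by
  rw [map_inv₀]
  rcases le_or_gt 1 (P.valuation (aeval x p)) with h | h
  · exact (inv_le_one_of_one_le₀ h).trans (by rw [← exp_zero, exp_le_exp]; exact zero_le_one)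
  · have hP : P.valuation x ≤ 1 := by
      by_contra! hP
      rw [Place.valuation_aeval_eq_pow hP hp.ne_zero] at h
      exact h.not_ge (one_le_pow₀ hP.le)
    rw [hx.eq_place_of_valuation_aeval_lt_one hp hP h, valuation_place_aeval, ← exp_neg, neg_neg]

theorem weakAt_inv_aeval {p : k[X]} (hp : Irreducible p) (P : Place k F) :
    P.WeakAt (aeval x p)⁻¹ :=
  .of_valuation_le (hx.valuation_inv_aeval_le_exp_one hp P)

theorem weakAt_add_one_add_inv (P : Place k F) : P.WeakAt (x + 1 + 1 / x) := by
  have hinv := hx.valuation_inv_aeval_le_exp_one irreducible_X P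
  rw [aeval_X] at hinv
  refine .of_valuation_le (P.valuation.map_add_le (P.valuation.map_add_le
    (hx.valuation_le_exp_one P) ?_) (by rwa [one_div]))
  rw [map_one, ← exp_zero, exp_le_exp]
  exact zero_le_one

section BadPlaces

variable (hq : Irreducible (X ^ 2 + X + 1 : k[X]))

open Classical in
/-- The places of `k(x)` at which `x` takes one of the values `ω, ω², 0, -1, ∞`. -/
def badPlaces : Finset (Place k F) :=
  {hx.place hq, hx.place irreducible_X, hx.place (irreducible_X_sub_C (-1 : k)), hx.placeInfty}

theorem mem_badPlaces {P : Place k F} : P ∈ hx.badPlaces hq ↔ P.IsBad x := by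
  simp only [badPlaces, Finset.mem_insert, Finset.mem_singleton, eq_place_iff, eq_placeInfty_iff,
    map_add, map_pow, aeval_X, map_one, map_neg, sub_neg_eq_add, ← not_lt, Place.IsBad]
  tauto

theorem sum_degree_badPlaces : ∑ P ∈ hx.badPlaces hq, P.degree = 5 := by
  classical
  have hmonic : (X ^ 2 + X + 1 : k[X]).Monic := by monicity!
  have hne_of_natDegree {p : k[X]} (hp : p.natDegree = 1) : X ^ 2 + X + 1 ≠ p := by
    rintro rfl
    rw [natDegree_sq_add_X_add_one] at hp
    exact absurd hp (by norm_num)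
  have hωX := hx.place_ne_place hq irreducible_X hmonic monic_X (hne_of_natDegree natDegree_X)
  have hω1 := hx.place_ne_place hq (irreducible_X_sub_C (-1 : k)) hmonic (monic_X_sub_C _)
    (hne_of_natDegree (natDegree_X_sub_C _))
  have hX1 := hx.place_ne_place irreducible_X (irreducible_X_sub_C (-1 : k)) monic_X
    (monic_X_sub_C _) (by simp)
  have hinfty {p : k[X]} (hp : Irreducible p) := hx.place_ne_placeInfty hp
  rw [badPlaces, Finset.sum_insert, Finset.sum_insert, Finset.sum_pair (hinfty _)]
  · simp only [degree_place, degree_placeInfty, natDegree_sq_add_X_add_one, natDegree_X,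
      natDegree_X_sub_C, Nat.reduceAdd]
  · simp only [Finset.mem_insert, Finset.mem_singleton, hX1, hinfty, or_self, not_false_iff]
  · simp only [Finset.mem_insert, Finset.mem_singleton, hωX, hω1, hinfty, or_self, not_false_iff]

end BadPlaces

section RationalPlaces

section Finset

variable [Finite k]

open Classical in
/-- The rational places of `k(x)` at which `x` takes a value different from `0, 1, ∞`. -/
def goodRationalPlaces : Finset (Place k F) :=
  let _ := Fintype.ofFinite k
  ((Finset.univ.erase 0).erase 1).image fun a : k => hx.place (irreducible_X_sub_C a)

theorem card_goodRationalPlaces : hx.goodRationalPlaces.card = Nat.card k - 2 := by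
  classical
  let _ := Fintype.ofFinite k
  rw [goodRationalPlaces, Finset.card_image_of_injective, Finset.card_erase_of_mem (by simp),
    Finset.card_erase_of_mem (by simp), Finset.card_univ, Nat.card_eq_fintype_card]
  · rfl
  · intro a b hab
    by_contra hne
    exact hx.place_ne_place _ _ (monic_X_sub_C a) (monic_X_sub_C b)
      (fun h => hne (by simpa using h)) hab

theorem mem_goodRationalPlaces_iff_exists {P : Place k F} :
    P ∈ hx.goodRationalPlaces ↔
      ∃ a : k, a ≠ 0 ∧ a ≠ 1 ∧ P = hx.place (irreducible_X_sub_C a) := by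
  simp only [goodRationalPlaces, Finset.mem_image, Finset.mem_erase, Finset.mem_univ, and_true,
    and_assoc, @eq_comm _ _ P]
  exact exists_congr fun a => and_left_comm

end Finset

variable (h2 : (2 : k) = 0)
include h2

theorem not_isBad_place_X_sub_C {a : k} (ha0 : a ≠ 0) (ha1 : a ≠ 1) (ha : a ^ 2 + a + 1 ≠ 0) :
    ¬ (hx.place (irreducible_X_sub_C a)).IsBad x := by
  have hval (q : k[X]) (hqa : q.eval a ≠ 0) :
      ¬ (hx.place (irreducible_X_sub_C a)).valuation (aeval x q) < 1 := by
    rwa [valuation_place_aeval_lt_one_iff, dvd_iff_isRoot]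
  have hX := hval X (by simpa using ha0)
  have hX1 := hval (X + 1) (by
    simp only [eval_add, eval_X, eval_one]
    exact fun h => ha1 (by linear_combination h - h2))
  have hq := hval (X ^ 2 + X + 1) (by simpa using ha)
  simp only [map_add, map_pow, aeval_X, map_one] at hX hX1 hq
  simp only [Place.IsBad, hX, hX1, hq, or_false, not_lt]
  exact hx.valuation_place_le_one _

theorem mem_goodRationalPlaces [Finite k] (hk : ∀ a : k, a ^ 2 + a + 1 ≠ 0) {P : Place k F} :
    P ∈ hx.goodRationalPlaces ↔ P.degree = 1 ∧ ¬ P.IsBad x := by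
  rw [mem_goodRationalPlaces_iff_exists]
  constructor
  · rintro ⟨a, ha0, ha1, rfl⟩
    rw [degree_place, natDegree_X_sub_C]
    exact ⟨rfl, hx.not_isBad_place_X_sub_C h2 ha0 ha1 (hk a)⟩
  · rintro ⟨hd, hbad⟩
    have h2F : (2 : F) = 0 := by rw [← map_ofNat (algebraMap k F) 2, h2, map_zero]
    obtain ⟨a, ha0, ha1, ha⟩ := Place.exists_valuation_sub_lt_one_of_not_isBad h2F hd hbad
    exact ⟨a, ha0, ha1,
      (hx.eq_place_iff _).2 ⟨not_lt.1 fun h => hbad (Or.inl h), by simpa using ha⟩⟩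

end RationalPlaces

end IsRationalGenerator

section Correspondence

variable {K Γ₀ : Type*} [Field K] [LinearOrderedCommGroupWithZero Γ₀] (v : Valuation K Γ₀)
  {x y : K}

theorem valuation_eq_one_of_valuation_add_one_lt_one (h : v (x + 1) < 1) : v x = 1 := by
  have hx := v.map_sub_eq_of_lt_right (x := x + 1) (y := 1) (by rwa [map_one])
  rwa [add_sub_cancel_right, map_one] at hx

theorem valuation_sq_add_self_lt_one_iff :
    v (x ^ 2 + x) < 1 ↔ v x < 1 ∨ v (x + 1) < 1 := by
  rw [show x ^ 2 + x = x * (x + 1) by ring, map_mul]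
  constructor
  · contrapose!
    exact fun h => one_le_mul h.1 h.2
  · rintro (h | h)
    · exact mul_lt_one_of_nonneg_of_lt_one_left zero_le h (v.map_add_le h.le (map_one v).le)
    · exact mul_lt_one_of_nonneg_of_lt_one_right
        (valuation_eq_one_of_valuation_add_one_lt_one v h).le zero_le h

theorem valuation_eq_one_of_valuation_sq_add_self_add_one_lt_one (h : v (x ^ 2 + x + 1) < 1) :
    v x = 1 ∧ v (x + 1) = 1 := by
  have hsq := valuation_eq_one_of_valuation_add_one_lt_one v h
  have hx : v x ≤ 1 := (valuation_sq_add_self_le_one_iff v).1 hsq.le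
  have hnot := (valuation_sq_add_self_lt_one_iff v).not.1 hsq.not_lt
  rw [not_or, not_lt, not_lt] at hnot
  exact ⟨hx.antisymm hnot.1, (v.map_add_le hx (map_one v).le).antisymm hnot.2⟩

theorem valuation_add_one_add_inv_of_one_lt (hx : 1 < v x) : v (x + 1 + 1 / x) = v x := by
  rw [add_assoc, v.map_add_eq_of_lt_left]
  refine (v.map_add_le (map_one v).le ?_).trans_lt hx
  rw [one_div, map_inv₀]
  exact inv_le_one_of_one_le₀ hx.le

theorem valuation_add_one_add_inv_of_lt_one (hx0 : x ≠ 0) (hx : v x < 1) :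
    v (x + 1 + 1 / x) = (v x)⁻¹ := by
  have hinv : 1 < v x⁻¹ := by
    rw [map_inv₀]
    exact (one_lt_inv₀ (zero_lt_iff.2 ((map_ne_zero v).2 hx0))).2 hx
  rw [← map_inv₀, ← valuation_add_one_add_inv_of_one_lt v hinv, one_div, one_div, inv_inv]
  congr 1
  ring

theorem valuation_add_one_add_inv_of_eq_one (hx : v x = 1) :
    v (x + 1 + 1 / x) = v (x ^ 2 + x + 1) := by
  have hx0 : x ≠ 0 := by rintro rfl; simp at hx
  rw [show x ^ 2 + x + 1 = (x + 1 + 1 / x) * x by field_simp, map_mul, hx, mul_one]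

theorem valuation_add_one_add_inv_le_one (hx : v x = 1) : v (x + 1 + 1 / x) ≤ 1 := by
  rw [valuation_add_one_add_inv_of_eq_one v hx]
  exact v.map_add_le ((valuation_sq_add_self_le_one_iff v).2 hx.le) (map_one v).le

theorem valuation_add_one_add_inv_add_one (hx : v x = 1) :
    v (x + 1 + 1 / x + 1) = v (x + 1) ^ 2 := by
  have hx0 : x ≠ 0 := by rintro rfl; simp at hx
  rw [← map_pow, show (x + 1) ^ 2 = (x + 1 + 1 / x + 1) * x by field_simp; ring, map_mul, hx,
    mul_one]

variable (hxy : y ^ 2 + y = x + 1 + 1 / x)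
include hxy

theorem one_lt_valuation_of_sq_add_self_eq (hx0 : x ≠ 0) (hx : v x ≠ 1) : 1 < v y := by
  rw [← not_le, ← valuation_sq_add_self_le_one_iff v, hxy, not_le]
  rcases hx.lt_or_gt with hx | hx
  · rw [valuation_add_one_add_inv_of_lt_one v hx0 hx]
    exact (one_lt_inv₀ (zero_lt_iff.2 ((map_ne_zero v).2 hx0))).2 hx
  · rwa [valuation_add_one_add_inv_of_one_lt v hx]

theorem valuation_le_one_of_sq_add_self_eq (hx : v x = 1) : v y ≤ 1 := by
  rw [← valuation_sq_add_self_le_one_iff v, hxy]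
  exact valuation_add_one_add_inv_le_one v hx

theorem valuation_sq_add_self_add_one_lt_one_iff (hx : v x = 1) :
    v (y ^ 2 + y + 1) < 1 ↔ v (x + 1) < 1 := by
  rw [hxy, valuation_add_one_add_inv_add_one v hx, pow_lt_one_iff_of_nonneg zero_le two_ne_zero]

theorem valuation_lt_one_or_valuation_add_one_lt_one_iff (hx : v x = 1) :
    v y < 1 ∨ v (y + 1) < 1 ↔ v (x ^ 2 + x + 1) < 1 := by
  rw [← valuation_sq_add_self_lt_one_iff, hxy, valuation_add_one_add_inv_of_eq_one v hx]

end Correspondence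

namespace Place

variable {k F : Type*} [Field k] [Field F] [Algebra k F] (P : Place k F) {x y : F}

theorem isBad_iff_isBad (hx0 : x ≠ 0) (hxy : y ^ 2 + y = x + 1 + 1 / x) :
    P.IsBad y ↔ P.IsBad x := by
  by_cases hx : P.valuation x = 1
  · have hy := (valuation_le_one_of_sq_add_self_eq _ hxy hx).not_gt
    rw [IsBad, IsBad, valuation_sq_add_self_add_one_lt_one_iff _ hxy hx,
      ← or_assoc (a := P.valuation y < 1),
      valuation_lt_one_or_valuation_add_one_lt_one_iff _ hxy hx, hx]
    simp only [hy, lt_irrefl, false_or]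
    exact or_comm
  · have hy : P.IsBad y := Or.inl (one_lt_valuation_of_sq_add_self_eq _ hxy hx0 hx)
    have hx : P.IsBad x := (lt_or_gt_of_ne hx).elim (fun h => Or.inr (Or.inl h)) Or.inl
    exact iff_of_true hy hx

section Weight

open Classical in
/-- The weight of a bad place, through which the total degree of the bad places is controlled.
With `n` the order at `P` of `x`, of `x + 1` or of `x² + x + 1`, it is a multiple of `√|n|`, and
the factors `15 / 4` and `5 / 2` are chosen such that passing to the two-sheeted cover
`y² + y = x + 1 + 1 / x` multiplies the total weight by at most `19 / 10 < 2`. -/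
def weight (x : F) : ℝ :=
  if P.valuation x ≠ 1 then √(|log (P.valuation x)| : ℤ)
  else if P.valuation (x + 1) < 1 then 15 / 4 * √(|log (P.valuation (x + 1))| : ℤ)
  else 5 / 2 * √(|log (P.valuation (x ^ 2 + x + 1))| : ℤ)

theorem one_le_sqrt_abs_log_valuation {f : F} (hf : f ≠ 0) (h : P.valuation f ≠ 1) :
    (1 : ℝ) ≤ √(|log (P.valuation f)| : ℤ) := by
  obtain ⟨n, hn⟩ := P.exists_eq_exp hf
  rw [hn, Ne, exp_eq_one] at h
  rw [Real.one_le_sqrt, hn, log_exp]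
  exact_mod_cast Int.one_le_abs h

theorem one_le_weight (hx : P.IsBad x) (hx0 : x ≠ 0) (hx1 : x + 1 ≠ 0)
    (hx2 : x ^ 2 + x + 1 ≠ 0) : 1 ≤ P.weight x := by
  unfold weight
  split_ifs with hne hlt
  · exact P.one_le_sqrt_abs_log_valuation hx0 hne
  · linarith [P.one_le_sqrt_abs_log_valuation hx1 hlt.ne]
  · have hω : P.valuation (x ^ 2 + x + 1) < 1 := by
      simpa [IsBad, not_not.1 hne, hlt] using hx
    linarith [P.one_le_sqrt_abs_log_valuation hx2 hω.ne]

theorem weight_of_valuation_eq {n : ℤ} (hn : n ≠ 0) (h : P.valuation x = exp n) :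
    P.weight x = √(|n| : ℤ) := by
  rw [weight, if_pos (by rw [h]; simpa using hn), h, log_exp]

theorem weight_of_valuation_add_one_eq {n : ℤ} (hn : n < 0) (h : P.valuation (x + 1) = exp n) :
    P.weight x = 15 / 4 * √(|n| : ℤ) := by
  have hlt : P.valuation (x + 1) < 1 := by rwa [h, ← exp_zero, exp_lt_exp]
  rw [weight, if_neg (not_not.2 (valuation_eq_one_of_valuation_add_one_lt_one _ hlt)), if_pos hlt,
    h, log_exp]

theorem weight_of_valuation_sq_add_self_add_one_eq {n : ℤ} (hn : n < 0)
    (h : P.valuation (x ^ 2 + x + 1) = exp n) : P.weight x = 5 / 2 * √(|n| : ℤ) := by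
  have hlt : P.valuation (x ^ 2 + x + 1) < 1 := by rwa [h, ← exp_zero, exp_lt_exp]
  obtain ⟨hx, hx1⟩ := valuation_eq_one_of_valuation_sq_add_self_add_one_lt_one _ hlt
  rw [weight, if_neg (not_not.2 hx), if_neg hx1.not_lt, h, log_exp]

end Weight

end Place

theorem sqrt_mul_le_mul_sqrt {e r : ℝ} (he : 1 ≤ e) : √(e * r) ≤ e * √r := by
  rw [Real.sqrt_mul (by linarith)]
  exact mul_le_mul_of_nonneg_right
    ((Real.sqrt_le_left (by linarith)).2 (le_self_pow₀ he two_ne_zero)) (Real.sqrt_nonneg r)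

/-- If `x ≡ a` at `P` with `a ∈ 𝔽₈` different from `0` and `1`, then `a + 1 + 1 / a` has trace zero
and `y² + y = x + 1 + 1 / x` has two solutions in the residue field. -/
theorem Place.exists_valuation_add_sq_add_lt_one_of_not_isBad {k F : Type*} [Field k] [Field F]
    [Algebra k F] {x : F} (hk : Nat.card k = 8) {P : Place k F} (hd : P.degree = 1)
    (hgood : ¬ P.IsBad x) :
    ∃ c : k, P.valuation (x + 1 + 1 / x + algebraMap k F c ^ 2 + algebraMap k F c) < 1 := by
  have h2 : (2 : F) = 0 := by
    simpa only [map_ofNat, map_zero] using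
      congrArg (algebraMap k F) (two_eq_zero_of_card_eq_eight hk)
  have hv := Place.valuation_eq_one_of_not_isBad hgood
  obtain ⟨a, ha0, ha1, ha⟩ :=
    Place.exists_valuation_sub_lt_one_of_not_isBad h2 hd hgood
  obtain ⟨c, hc⟩ := exists_sq_add_self_eq hk ha0 ha1
  have hx0 : x ≠ 0 := by rintro rfl; simp at hv
  have haF : algebraMap k F a ≠ 0 := (map_ne_zero _).2 ha0
  have hcF : algebraMap k F c ^ 2 + algebraMap k F c =
      algebraMap k F a + 1 + 1 / algebraMap k F a := by
    simpa only [map_add, map_pow, map_one, map_div₀] using congrArg (algebraMap k F) hc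
  have hfactor : x + 1 + 1 / x + (algebraMap k F a + 1 + 1 / algebraMap k F a) =
      (x - algebraMap k F a) * (1 - 1 / (x * algebraMap k F a)) := by
    field_simp
    linear_combination (x * algebraMap k F a ^ 2 + x * algebraMap k F a + x) * h2
  refine ⟨c, ?_⟩
  rw [add_assoc, hcF, hfactor, map_mul]
  refine mul_lt_one_of_nonneg_of_lt_one_left zero_le ha
    ((P.valuation.map_sub _ _).trans (max_le (map_one _).le ?_))
  rw [one_div, map_inv₀, map_mul, hv, P.valuation_algebraMap ha0, mul_one, inv_one]

namespace IsArtinSchreier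

variable {k F F' : Type*} [Field k] [Field F] [Field F'] [Algebra k F] [Algebra k F']
  [Algebra F F'] [IsScalarTower k F F'] {y : F'} {x u : F}

theorem isBad_iff [Algebra.IsSeparable F F'] (h : IsArtinSchreier y (x + 1 + 1 / x)) (hx0 : x ≠ 0)
    (P' : Place k F') : P'.IsBad y ↔ (P'.restrict F).IsBad x := by
  have hxy : y ^ 2 + y = algebraMap F F' x + 1 + 1 / algebraMap F F' x := by rw [h.eq]; simp
  rw [P'.isBad_iff_isBad ((map_ne_zero _).2 hx0) hxy, Place.IsBad, Place.IsBad, ← not_le,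
    ← not_le (a := (P'.restrict F).valuation x), P'.valuation_algebraMap_le_one_iff,
    P'.valuation_algebraMap_lt_one_iff, ← P'.valuation_algebraMap_lt_one_iff (x + 1),
    ← P'.valuation_algebraMap_lt_one_iff (x ^ 2 + x + 1)]
  simp only [map_add, map_pow, map_one]

section Restrict

variable [FiniteDimensional F F'] [Algebra.IsSeparable F F']

theorem sum_weight_le_of_forall (h : IsArtinSchreier y u) {P : Place k F} {c : ℝ}
    (hc : ∀ P' ∈ P.fiber F', P'.weight y ≤ P'.ramIdx F * c) :
    ∑ P' ∈ P.fiber F', (P'.degree : ℝ) * P'.weight y ≤ 2 * P.degree * c := by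
  have hsum : ((∑ P' ∈ P.fiber F', P'.ramIdx F * P'.degree : ℕ) : ℝ) = 2 * P.degree := by
    rw [P.sum_ramIdx_mul_degree, h.finrank_eq]
    push_cast
    ring
  rw [← hsum, Nat.cast_sum, Finset.sum_mul]
  refine Finset.sum_le_sum fun P' hP' => ?_
  have hmul := mul_le_mul_of_nonneg_left (hc P' hP') (Nat.cast_nonneg (α := ℝ) P'.degree)
  push_cast
  linarith

theorem exists_valuation_eq_exp_of_pole (h : IsArtinSchreier y u) {P : Place k F} {m : ℤ}
    (hm : 0 < m) (hu : P.valuation u = exp m) {P' : Place k F'} (hP' : P' ∈ P.fiber F') :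
    ∃ n : ℤ, 0 < n ∧ P'.valuation y = exp n ∧ 2 * n = P'.ramIdx F * m := by
  have he : (0 : ℤ) < P'.ramIdx F := by exact_mod_cast P'.ramIdx_pos (F := F)
  have hval : P'.valuation (y ^ 2 + y) = exp (P'.ramIdx F * m) := by
    rw [h.eq, P'.valuation_algebraMap_eq_pow, Place.mem_fiber.1 hP', hu, ← exp_nsmul,
      nsmul_eq_mul]
  have hy : 1 < P'.valuation y := by
    rw [← not_le, ← valuation_sq_add_self_le_one_iff, hval, ← exp_zero, exp_le_exp, not_le]
    exact mul_pos he hm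
  rw [valuation_sq_add_self_of_one_lt _ hy] at hval
  obtain ⟨n, hn⟩ := P'.exists_eq_exp (f := y) (by rintro rfl; simp at hy)
  rw [hn, ← exp_nsmul, exp_inj, nsmul_eq_mul, Nat.cast_ofNat] at hval
  rw [hn, ← exp_zero, exp_lt_exp] at hy
  exact ⟨n, hy, hn, hval⟩

theorem weight_le_of_pole (h : IsArtinSchreier y u) {P : Place k F} {m : ℤ} (hm : 0 < m)
    (hu : P.valuation u = exp m) {P' : Place k F'} (hP' : P' ∈ P.fiber F') :
    P'.weight y ≤ P'.ramIdx F * √(m / 2 : ℝ) := by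
  obtain ⟨n, hn, hy, hnm⟩ := h.exists_valuation_eq_exp_of_pole hm hu hP'
  have hn' : (n : ℝ) = P'.ramIdx F * (m / 2) := by
    have : (2 : ℝ) * n = P'.ramIdx F * m := by exact_mod_cast hnm
    linarith
  rw [P'.weight_of_valuation_eq hn.ne' hy, abs_of_pos hn, hn']
  exact sqrt_mul_le_mul_sqrt (by exact_mod_cast P'.ramIdx_pos)

theorem sum_weight_le_of_pole (h : IsArtinSchreier y u) {P : Place k F} {m : ℤ} (hm : 0 < m)
    (hu : P.valuation u = exp m) :
    ∑ P' ∈ P.fiber F', (P'.degree : ℝ) * P'.weight y ≤ √2 * (P.degree * √(m : ℝ)) :=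
  calc _ ≤ 2 * P.degree * √(m / 2 : ℝ) :=
        h.sum_weight_le_of_forall fun _ hP' => h.weight_le_of_pole hm hu hP'
    _ = √2 * (P.degree * √(m : ℝ)) := by
        rw [Real.sqrt_div (by exact_mod_cast hm.le)]
        nth_rw 1 [← Real.mul_self_sqrt (zero_le_two (α := ℝ))]
        field_simp

end Restrict

section Weight

variable [FiniteDimensional F F'] [Algebra.IsSeparable F F']
  (h : IsArtinSchreier y (x + 1 + 1 / x)) {P : Place k F}
include h

theorem sum_weight_le_of_valuation_ne_one (hx0 : x ≠ 0) (hx : P.valuation x ≠ 1) :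
    ∑ P' ∈ P.fiber F', (P'.degree : ℝ) * P'.weight y ≤ √2 * (P.degree * P.weight x) := by
  obtain ⟨n, hn⟩ := P.exists_eq_exp hx0
  have hn0 : n ≠ 0 := by rintro rfl; exact hx (by rw [hn, exp_zero])
  rw [P.weight_of_valuation_eq hn0 hn]
  refine h.sum_weight_le_of_pole (abs_pos.2 hn0) ?_
  rcases hn0.lt_or_gt with hneg | hpos
  · have hlt : P.valuation x < 1 := by rwa [hn, ← exp_zero, exp_lt_exp]
    rw [valuation_add_one_add_inv_of_lt_one _ hx0 hlt, hn, abs_of_neg hneg, exp_neg]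
  · have hgt : 1 < P.valuation x := by rwa [hn, ← exp_zero, exp_lt_exp]
    rw [valuation_add_one_add_inv_of_one_lt _ hgt, hn, abs_of_pos hpos]

theorem weight_le_of_valuation_add_one_lt_one {n : ℤ} (hn0 : n < 0)
    (hn : P.valuation (x + 1) = exp n) {P' : Place k F'} (hP' : P' ∈ P.fiber F') :
    P'.weight y ≤ P'.ramIdx F * (5 / 2 * √(2 * |n| : ℤ)) := by
  have hx := valuation_eq_one_of_valuation_add_one_lt_one P.valuation
    (x := x) (by rwa [hn, ← exp_zero, exp_lt_exp])
  have hval : P'.valuation (y ^ 2 + y + 1) = exp (P'.ramIdx F * (2 * n)) := by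
    rw [h.eq, ← map_one (algebraMap F F'), ← map_add, P'.valuation_algebraMap_eq_pow,
      Place.mem_fiber.1 hP', valuation_add_one_add_inv_add_one _ hx, hn, ← exp_nsmul, ← exp_nsmul]
    simp only [nsmul_eq_mul, Nat.cast_ofNat]
  have he : 0 < P'.ramIdx F := P'.ramIdx_pos
  rw [P'.weight_of_valuation_sq_add_self_add_one_eq
      (mul_neg_of_pos_of_neg (by exact_mod_cast he) (by omega)) hval, abs_mul, abs_mul,
    Nat.abs_cast, abs_two, mul_left_comm (P'.ramIdx F : ℝ) (5 / 2)]
  refine mul_le_mul_of_nonneg_left ?_ (by norm_num)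
  rw [Int.cast_mul, Int.cast_natCast]
  exact sqrt_mul_le_mul_sqrt (by exact_mod_cast he)

theorem sum_weight_le_of_valuation_add_one_lt_one (hx1 : x + 1 ≠ 0)
    (hx : P.valuation (x + 1) < 1) :
    ∑ P' ∈ P.fiber F', (P'.degree : ℝ) * P'.weight y ≤
      4 / 3 * √2 * (P.degree * P.weight x) := by
  obtain ⟨n, hn⟩ := P.exists_eq_exp hx1
  have hn0 : n < 0 := by rwa [hn, ← exp_zero, exp_lt_exp] at hx
  refine (h.sum_weight_le_of_forall fun _ hP' =>
    h.weight_le_of_valuation_add_one_lt_one hn0 hn hP').trans_eq ?_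
  rw [P.weight_of_valuation_add_one_eq hn0 hn, Int.cast_mul, Int.cast_ofNat,
    Real.sqrt_mul zero_le_two]
  ring

/-- The place `P` splits: `y` vanishes at one of the two places above it and `y + 1` at the other,
both to the same order as `x² + x + 1` at `P`. -/
theorem sum_weight_eq_of_valuation_sq_add_self_add_one_lt_one (hP : 0 < P.degree)
    (hx2 : x ^ 2 + x + 1 ≠ 0) (hx : P.valuation (x ^ 2 + x + 1) < 1) :
    ∑ P' ∈ P.fiber F', (P'.degree : ℝ) * P'.weight y = 19 / 10 * (P.degree * P.weight x) := by
  classical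
  obtain ⟨n, hn⟩ := P.exists_eq_exp hx2
  have hn0 : n < 0 := by rwa [hn, ← exp_zero, exp_lt_exp] at hx
  have hu : P.valuation (x + 1 + 1 / x) = exp n := by
    rw [valuation_add_one_add_inv_of_eq_one _
      (valuation_eq_one_of_valuation_sq_add_self_add_one_lt_one _ hx).1, hn]
  obtain ⟨P₀, P₁, hne, hfiber, hunram, hy₀, hy₁⟩ :=
    h.split hP (by rw [hu, ← hn]; exact hx)
  have hprod (P' : Place k F') (hP' : P' ∈ P.fiber F') :
      P'.valuation y * P'.valuation (y + 1) = exp n := by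
    rw [← map_mul, show y * (y + 1) = y ^ 2 + y by ring, h.eq, P'.valuation_algebraMap_eq_pow,
      (hunram P' hP').1, pow_one, Place.mem_fiber.1 hP', hu]
  have hP₀ : P₀ ∈ P.fiber F' := (hfiber _).2 (Or.inl rfl)
  have hP₁ : P₁ ∈ P.fiber F' := (hfiber _).2 (Or.inr rfl)
  have hn₀ : P₀.valuation y = exp n := by
    rw [← hprod P₀ hP₀, P₀.valuation.map_add_eq_of_lt_right (by rwa [map_one]), map_one, mul_one]
  have hn₁ : P₁.valuation (y + 1) = exp n := by
    rw [← hprod P₁ hP₁, valuation_eq_one_of_valuation_add_one_lt_one _ hy₁, one_mul]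
  rw [show P.fiber F' = {P₀, P₁} by ext Q; rw [hfiber]; simp, Finset.sum_pair hne,
    P₀.weight_of_valuation_eq hn0.ne hn₀, P₁.weight_of_valuation_add_one_eq hn0 hn₁,
    P.weight_of_valuation_sq_add_self_add_one_eq hn0 hn, (hunram P₀ hP₀).2, (hunram P₁ hP₁).2]
  ring

theorem sum_weight_le (hP : 0 < P.degree) (hbad : P.IsBad x) (hx0 : x ≠ 0) (hx1 : x + 1 ≠ 0)
    (hx2 : x ^ 2 + x + 1 ≠ 0) :
    ∑ P' ∈ P.fiber F', (P'.degree : ℝ) * P'.weight y ≤ 19 / 10 * (P.degree * P.weight x) := by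
  have hsqrt : √2 ≤ (57 / 40 : ℝ) := by
    rw [Real.sqrt_le_left (by norm_num)]
    norm_num
  have hnonneg : 0 ≤ (P.degree : ℝ) * P.weight x :=
    mul_nonneg (Nat.cast_nonneg _) (zero_le_one.trans (P.one_le_weight hbad hx0 hx1 hx2))
  rcases hbad with hx | hx | hx | hx
  · exact (h.sum_weight_le_of_valuation_ne_one hx0 hx.ne').trans
      (mul_le_mul_of_nonneg_right (by linarith) hnonneg)
  · exact (h.sum_weight_le_of_valuation_ne_one hx0 hx.ne).trans
      (mul_le_mul_of_nonneg_right (by linarith) hnonneg)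
  · exact (h.sum_weight_le_of_valuation_add_one_lt_one hx1 hx).trans
      (mul_le_mul_of_nonneg_right (by linarith) hnonneg)
  · exact (h.sum_weight_eq_of_valuation_sq_add_self_add_one_lt_one hP hx2 hx).le

end Weight

theorem card_fiber_of_not_isBad [FiniteDimensional F F'] [Algebra.IsSeparable F F']
    (h : IsArtinSchreier y (x + 1 + 1 / x)) (hk : Nat.card k = 8) {P : Place k F}
    (hd : P.degree = 1) (hgood : ¬ P.IsBad x) :
    (P.fiber F').card = 2 ∧ ∀ P' ∈ P.fiber F', P'.degree = 1 := by
  classical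
  obtain ⟨c, hc⟩ := Place.exists_valuation_add_sq_add_lt_one_of_not_isBad hk hd hgood
  obtain ⟨P₀, P₁, hne, hfiber, hunram, -, -⟩ :=
    (h.add (algebraMap k F c)).split (hd ▸ one_pos) hc
  rw [show P.fiber F' = {P₀, P₁} by ext Q; rw [hfiber]; simp, Finset.card_pair hne]
  refine ⟨rfl, fun P' hP' => ?_⟩
  rw [(hunram P' ((hfiber _).2 (by simpa using hP'))).2, hd]

end IsArtinSchreier

theorem finiteDimensional_adjoin_algebraMap {k F F' : Type*} [Field k] [Field F] [Field F']
    [Algebra k F] [Algebra k F'] [Algebra F F'] [IsScalarTower k F F'] [FiniteDimensional F F']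
    (z : F) [FiniteDimensional (IntermediateField.adjoin k {z}) F] :
    FiniteDimensional (IntermediateField.adjoin k {algebraMap F F' z}) F' := by
  let K := IntermediateField.adjoin k {z}
  let K' := IntermediateField.adjoin k {algebraMap F F' z}
  have hmap : K.map (IsScalarTower.toAlgHom k F F') = K' := by
    rw [IntermediateField.adjoin_map, Set.image_singleton, IsScalarTower.coe_toAlgHom']
  have hmem (a : K) : algebraMap F F' a ∈ K' := hmap ▸ ⟨a, a.2, rfl⟩
  let _ : Algebra K K' :=
    (((algebraMap F F').comp (algebraMap K F)).codRestrict K' hmem).toAlgebra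
  have : IsScalarTower K K' F' := IsScalarTower.of_algebraMap_eq fun _ => rfl
  have : Module.Finite K F' := Module.Finite.trans F F'
  exact Module.Finite.of_restrictScalars_finite K K' F'

theorem IsRationalGenerator.adjoin_eq_top {k F : Type*} [Field k] [Field F] [Algebra k F] {x : F}
    (hx : IsRationalGenerator k x) : IntermediateField.adjoin k {x} = ⊤ := by
  refine eq_top_iff.2 fun f _ => ?_
  obtain ⟨p, q, -, rfl⟩ := hx.exists_div f
  have hmem (r : Polynomial k) : Polynomial.aeval x r ∈ IntermediateField.adjoin k {x} :=
    IntermediateField.algebra_adjoin_le_adjoin k _ (Polynomial.aeval_mem_adjoin_singleton k x)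
  exact div_mem (hmem p) (hmem q)

namespace Place

variable {k F F' : Type*} [Field k] [Field F] [Field F'] [Algebra k F] [Algebra k F']
  [Algebra F F'] [IsScalarTower k F F'] [FiniteDimensional F F'] [Algebra.IsSeparable F F']

variable (F') in
open Classical in
/-- The finite set of places above a finite set of places. -/
def fibers (S : Finset (Place k F)) : Finset (Place k F') := S.biUnion fun P => P.fiber F'

variable {S : Finset (Place k F)}

theorem mem_fibers {P' : Place k F'} : P' ∈ fibers F' S ↔ P'.restrict F ∈ S := by
  simp [fibers]

theorem pairwiseDisjoint_fiber :
    (S : Set (Place k F)).PairwiseDisjoint fun P => P.fiber F' := by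
  intro P _ Q _ hPQ
  rw [Function.onFun, Finset.disjoint_left]
  exact fun P' hP hQ => hPQ ((mem_fiber.1 hP).symm.trans (mem_fiber.1 hQ))

theorem sum_fibers {M : Type*} [AddCommMonoid M] (f : Place k F' → M) :
    ∑ P' ∈ fibers F' S, f P' = ∑ P ∈ S, ∑ P' ∈ P.fiber F', f P' := by
  classical exact Finset.sum_biUnion pairwiseDisjoint_fiber

theorem card_fibers : (fibers F' S).card = ∑ P ∈ S, (P.fiber F').card := by
  classical exact Finset.card_biUnion pairwiseDisjoint_fiber

end Place

theorem IsArtinSchreier.sum_degree_fibers {k F F' : Type*} [Field k] [Field F] [Field F']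
    [Algebra k F] [Algebra k F'] [Algebra F F'] [IsScalarTower k F F'] [FiniteDimensional F F']
    [Algebra.IsSeparable F F'] {y : F'} {u : F} (h : IsArtinSchreier y u)
    (hdeg : ∀ P : Place k F, 0 < P.degree) (hweak : ∀ P : Place k F, P.WeakAt u)
    (S : Finset (Place k F)) :
    ∑ P' ∈ Place.fibers F' S, P'.degree + ∑ P ∈ S, P.wild u * P.degree =
      2 * ∑ P ∈ S, P.degree := by
  rw [Place.sum_fibers, ← Finset.sum_add_distrib, Finset.mul_sum]
  exact Finset.sum_congr rfl fun P _ => h.sum_degree_fiber (hdeg P) (hweak P)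

/-- A level `F = k(x₀, …, xₙ)` of the tower, with the invariants that determine its genus and its
number of rational points, in terms of `x = xₙ` and of the degree `N = 2ⁿ` of `F` over `k(x₀)`. -/
structure TowerLevel (k : Type*) {F : Type*} [Field k] [Field F] [Algebra k F] (x : F) (N : ℕ)
    where
  /-- the places at which `x` has one of the five bad values `∞, 0, 1, ω, ω²` -/
  badPlaces : Finset (Place k F)
  /-- the rational places at which `x` has a good value -/
  goodRationalPlaces : Finset (Place k F)
  exists_finite : ∃ z : F, Transcendental k z ∧
    FiniteDimensional (IntermediateField.adjoin k {z}) F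
  exists_pole : ∃ P : Place k F, P.degree = 1 ∧ P.valuation x = exp (1 : ℤ)
  mem_badPlaces : ∀ P, P ∈ badPlaces ↔ P.IsBad x
  mem_goodRationalPlaces : ∀ P, P ∈ goodRationalPlaces ↔ P.degree = 1 ∧ ¬ P.IsBad x
  card_goodRationalPlaces : goodRationalPlaces.card = 6 * N
  hasGenus : HasGenus k F (4 * N + 1 - (∑ P ∈ badPlaces, P.degree : ℕ))

/-- The level `k(x₀)` of the tower. -/
def IsRationalGenerator.towerLevel {k F : Type*} [Field k] [Field F] [Algebra k F] {x : F}
    (hx : IsRationalGenerator k x) (hk : Nat.card k = 8) : TowerLevel k x 1 :=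
  have := finite_of_card_eq_eight hk
  have hne := sq_add_self_add_one_ne_zero_of_card_eq_eight hk
  have hq := irreducible_sq_add_X_add_one hne
  { badPlaces := hx.badPlaces hq
    goodRationalPlaces := hx.goodRationalPlaces
    exists_finite := ⟨x, hx.transcendental, FiniteDimensional.of_finrank_pos (by
      rw [hx.adjoin_eq_top, IntermediateField.finrank_top]
      exact one_pos)⟩
    exists_pole := ⟨hx.placeInfty, hx.degree_placeInfty, hx.valuation_placeInfty⟩
    mem_badPlaces := fun _ => hx.mem_badPlaces hq
    mem_goodRationalPlaces := fun _ =>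
      hx.mem_goodRationalPlaces (two_eq_zero_of_card_eq_eight hk) hne
    card_goodRationalPlaces := by rw [hx.card_goodRationalPlaces, hk]
    hasGenus := by
      rw [hx.sum_degree_badPlaces]
      exact hx.hasGenus_zero }

namespace TowerLevel

section

variable {k F : Type*} [Field k] [Field F] [Algebra k F] {x : F} {N : ℕ} (l : TowerLevel k x N)
include l

theorem exists_simple_pole_add_one_add_inv :
    ∃ P : Place k F, P.degree = 1 ∧ P.valuation (x + 1 + 1 / x) = exp (1 : ℤ) := by
  obtain ⟨P, hdeg, hP⟩ := l.exists_pole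
  have hlt : 1 < P.valuation x := by
    rw [hP, ← exp_zero, exp_lt_exp]
    exact one_pos
  exact ⟨P, hdeg, (valuation_add_one_add_inv_of_one_lt _ hlt).trans hP⟩

/-- The right hand side has a pole of odd order. -/
theorem sq_add_self_ne (z : F) : z ^ 2 + z ≠ x + 1 + 1 / x := by
  intro h
  obtain ⟨P, -, hP⟩ := l.exists_simple_pole_add_one_add_inv
  rw [← h] at hP
  have hz : 1 < P.valuation z := by
    rw [← not_le, ← valuation_sq_add_self_le_one_iff, hP, not_le, ← exp_zero, exp_lt_exp]
    exact one_pos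
  rw [valuation_sq_add_self_of_one_lt _ hz] at hP
  obtain ⟨n, hn⟩ := P.exists_eq_exp (f := z) (by rintro rfl; simp at hz)
  rw [hn, ← exp_nsmul, exp_inj, nsmul_eq_mul, Nat.cast_ofNat] at hP
  omega

theorem isCurveFunctionField : IsCurveFunctionField k F where
  exists_finite := l.exists_finite
  exact_constants _ ha := by
    obtain ⟨P, hdeg, -⟩ := l.exists_pole
    exact Place.mem_range_of_isAlgebraic hdeg ha

/-- The number of bad places of the level, each counted with its degree and its weight. -/
def totalWeight : ℝ := ∑ P ∈ l.badPlaces, P.degree * P.weight x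

theorem sum_degree_badPlaces_le_totalWeight (hx0 : x ≠ 0) (hx1 : x + 1 ≠ 0)
    (hx2 : x ^ 2 + x + 1 ≠ 0) : (∑ P ∈ l.badPlaces, P.degree : ℕ) ≤ l.totalWeight := by
  rw [totalWeight, Nat.cast_sum]
  exact Finset.sum_le_sum fun P hP => le_mul_of_one_le_right (Nat.cast_nonneg _)
    (P.one_le_weight ((l.mem_badPlaces P).1 hP) hx0 hx1 hx2)

theorem genus_eq : genus k F = 4 * N + 1 - (∑ P ∈ l.badPlaces, P.degree : ℕ) :=
  l.hasGenus.genus_eq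

theorem numRationalPoints_eq :
    numRationalPoints k F = 6 * N + (l.badPlaces.filter fun P => P.degree = 1).card := by
  classical
  have hmem (P : Place k F) :
      P ∈ l.goodRationalPlaces ∪ l.badPlaces.filter (fun P => P.degree = 1) ↔ P.degree = 1 := by
    rw [Finset.mem_union, l.mem_goodRationalPlaces, Finset.mem_filter, l.mem_badPlaces]
    by_cases hbad : P.IsBad x <;> simp [hbad]
  rw [numRationalPoints, Nat.subtype_card _ hmem, Finset.card_union_of_disjoint,
    l.card_goodRationalPlaces]
  rw [Finset.disjoint_left]
  exact fun P hgood hbad => ((l.mem_goodRationalPlaces P).1 hgood).2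
    ((l.mem_badPlaces P).1 (Finset.mem_filter.1 hbad).1)

theorem card_filter_badPlaces_le :
    (l.badPlaces.filter fun P => P.degree = 1).card ≤ ∑ P ∈ l.badPlaces, P.degree :=
  calc _ ≤ l.badPlaces.card := Finset.card_filter_le _ _
    _ ≤ ∑ P ∈ l.badPlaces, P.degree := by
        rw [Finset.card_eq_sum_ones]
        exact Finset.sum_le_sum fun P _ => l.hasGenus.degree_pos P

end

variable {k F F' : Type*} [Field k] [Field F] [Field F'] [Algebra k F] [Algebra k F']
  [Algebra F F'] [IsScalarTower k F F'] {x : F} {y : F'} {N : ℕ} (l : TowerLevel k x N)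
  (h : IsArtinSchreier y (x + 1 + 1 / x))
include h

include l in
theorem exists_pole_of_isArtinSchreier :
    ∃ P' : Place k F', P'.degree = 1 ∧ P'.valuation y = exp (1 : ℤ) := by
  have := h.finiteDimensional
  have := h.isSeparable
  obtain ⟨P, hdeg, hP⟩ := l.exists_simple_pole_add_one_add_inv
  obtain ⟨P', -, -, hdeg', hy⟩ := h.ramified (hdeg ▸ one_pos) hP
  exact ⟨P', hdeg'.trans hdeg, hy⟩

variable [FiniteDimensional F F'] [Algebra.IsSeparable F F']

theorem hasGenus_of_isArtinSchreier (hweak : ∀ P : Place k F, P.WeakAt (x + 1 + 1 / x)) :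
    HasGenus k F' (4 * (2 * N : ℕ) + 1 - (∑ P' ∈ Place.fibers F' l.badPlaces, P'.degree : ℕ)) := by
  have hsum := h.sum_degree_fibers l.hasGenus.degree_pos hweak l.badPlaces
  convert h.hasGenus l.hasGenus hweak l.badPlaces fun P hP => ?_ using 1
  · zify at hsum
    push_cast at hsum ⊢
    linarith
  · exact valuation_add_one_add_inv_le_one _
      (Place.valuation_eq_one_of_not_isBad ((l.mem_badPlaces P).not.1 hP))

theorem mem_fibers_badPlaces (hx0 : x ≠ 0) (P' : Place k F') :
    P' ∈ Place.fibers F' l.badPlaces ↔ P'.IsBad y := by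
  rw [Place.mem_fibers, l.mem_badPlaces, h.isBad_iff hx0]

variable (hk : Nat.card k = 8)
include hk

theorem mem_fibers_goodRationalPlaces (hx0 : x ≠ 0) (P' : Place k F') :
    P' ∈ Place.fibers F' l.goodRationalPlaces ↔ P'.degree = 1 ∧ ¬ P'.IsBad y := by
  rw [Place.mem_fibers, l.mem_goodRationalPlaces, h.isBad_iff hx0]
  refine and_congr_left fun hgood => ⟨fun hdeg => ?_, fun hdeg => ?_⟩
  · exact (h.card_fiber_of_not_isBad hk hdeg hgood).2 P' (Place.mem_fiber.2 rfl)
  · exact Nat.dvd_one.1 (hdeg ▸ P'.degree_restrict_dvd)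

theorem card_fibers_goodRationalPlaces :
    (Place.fibers F' l.goodRationalPlaces).card = 6 * (2 * N) := by
  have hcard (P : Place k F) (hP : P ∈ l.goodRationalPlaces) : (P.fiber F').card = 2 := by
    obtain ⟨hdeg, hgood⟩ := (l.mem_goodRationalPlaces P).1 hP
    exact (h.card_fiber_of_not_isBad hk hdeg hgood).1
  rw [Place.card_fibers, Finset.sum_const_nat hcard, l.card_goodRationalPlaces]
  ring

/-- The level above a given one. -/
def succ (hweak : ∀ P : Place k F, P.WeakAt (x + 1 + 1 / x)) (hx0 : x ≠ 0) :
    TowerLevel k y (2 * N) where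
  badPlaces := Place.fibers F' l.badPlaces
  goodRationalPlaces := Place.fibers F' l.goodRationalPlaces
  exists_finite := by
    obtain ⟨z, hz, hfinite⟩ := l.exists_finite
    exact ⟨algebraMap F F' z, (transcendental_algebraMap_iff (algebraMap F F').injective).2 hz,
      finiteDimensional_adjoin_algebraMap z⟩
  exists_pole := l.exists_pole_of_isArtinSchreier h
  mem_badPlaces := l.mem_fibers_badPlaces h hx0
  mem_goodRationalPlaces := l.mem_fibers_goodRationalPlaces h hk hx0
  card_goodRationalPlaces := l.card_fibers_goodRationalPlaces h hk
  hasGenus := l.hasGenus_of_isArtinSchreier h hweak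

theorem totalWeight_succ_le (hweak : ∀ P : Place k F, P.WeakAt (x + 1 + 1 / x)) (hx0 : x ≠ 0)
    (hx1 : x + 1 ≠ 0) (hx2 : x ^ 2 + x + 1 ≠ 0) :
    (l.succ h hk hweak hx0).totalWeight ≤ 19 / 10 * l.totalWeight := by
  rw [totalWeight, totalWeight, Finset.mul_sum]
  refine (Place.sum_fibers _).trans_le (Finset.sum_le_sum fun P hP => ?_)
  exact h.sum_weight_le (l.hasGenus.degree_pos P) ((l.mem_badPlaces P).1 hP) hx0 hx1 hx2

end TowerLevel

theorem sq_add_self_eq_inv_of_sq_add_self_eq {L : Type*} [Field L] (h2 : (2 : L) = 0) {x y : L}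
    (hx : x ≠ 0) (hy : y ^ 2 + y + 1 ≠ 0) (hxy : y ^ 2 + y = x + 1 + 1 / x) :
    ((x + 1) / (y ^ 2 + y + 1)) ^ 2 + (x + 1) / (y ^ 2 + y + 1) = (y ^ 2 + y + 1)⁻¹ := by
  have hsq : (x + 1) ^ 2 = (y ^ 2 + y + 1) * x := by
    rw [hxy]
    field_simp
    ring
  rw [div_pow, hsq, pow_two (_ + 1), mul_div_mul_left _ _ hy, ← add_div, inv_eq_one_div]
  congr 1
  linear_combination x * h2

section Inclusion

open Polynomial IntermediateField

theorem exists_eq_add_mul_of_mem_adjoin {K L : Type*} [Field K] [Field L] [Algebra K L] {y : L}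
    {u : K} (hy : y ^ 2 + y = algebraMap K L u) {z : L} (hz : z ∈ adjoin K {y}) :
    ∃ a b : K, z = algebraMap K L a + algebraMap K L b * y := by
  let q : K[X] := IsArtinSchreier.poly u
  have hmonic : q.Monic := IsArtinSchreier.monic_poly
  have hdeg : q.natDegree = 2 := IsArtinSchreier.natDegree_poly
  have hroot : aeval y q = 0 := by simp [q, IsArtinSchreier.poly, hy]
  have hint : IsIntegral K y := ⟨q, hmonic, hroot⟩
  rw [← mem_toSubalgebra, adjoin_simple_toSubalgebra_of_isAlgebraic hint.isAlgebraic,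
    Algebra.adjoin_singleton_eq_range_aeval] at hz
  obtain ⟨p, rfl⟩ := hz
  have hrem : (p %ₘ q).natDegree < q.natDegree :=
    natDegree_modByMonic_lt p hmonic fun h => by simp [h] at hdeg
  obtain ⟨b, a, hab⟩ := exists_eq_X_add_C_of_natDegree_le_one (p := p %ₘ q) (by omega)
  refine ⟨a, b, ?_⟩
  rw [AlgHom.toRingHom_eq_coe, RingHom.coe_coe, ← aeval_modByMonic_eq_self_of_root hroot, hab]
  simp only [map_add, map_mul, aeval_X, aeval_C]
  exact add_comm _ _

variable {k L : Type*} [Field k] [Field L] [Algebra k L] {K K' : IntermediateField k L}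

theorem isArtinSchreier_inclusion (h2 : (2 : k) = 0) (hle : K ≤ K') {y : K'} {u : K}
    (heq : (y : L) ^ 2 + y = u) (hy : (y : L) ∉ K)
    (hgen : K' ≤ (adjoin K {(y : L)}).restrictScalars k) :
    letI := (inclusion hle).toRingHom.toAlgebra
    IsArtinSchreier y u := by
  let _ := (inclusion hle).toRingHom.toAlgebra
  refine ⟨?_, Subtype.ext heq, fun a ha => hy (by rw [ha]; exact a.2), fun z => ?_⟩
  · rw [← map_ofNat (algebraMap k K) 2, h2, map_zero]
  · obtain ⟨a, b, hz⟩ := exists_eq_add_mul_of_mem_adjoin (u := u) heq (hgen z.2)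
    exact ⟨a, b, Subtype.ext hz⟩

theorem eq_of_le_adjoin_of_mem (hle : K ≤ K') {y : L} (hy : y ∈ K)
    (hgen : K' ≤ (adjoin K {y}).restrictScalars k) : K' = K := by
  refine le_antisymm (hgen.trans fun z hz => ?_) hle
  have hbot : adjoin K {y} = ⊥ := adjoin_simple_eq_bot_iff.2 ⟨⟨y, hy⟩, rfl⟩
  rw [mem_restrictScalars, hbot] at hz
  obtain ⟨w, rfl⟩ := hz
  exact w.2

theorem degree_pos_of_le_adjoin (h2 : (2 : k) = 0) (hle : K ≤ K') {y : L} (hy : y ∈ K')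
    (hu : y ^ 2 + y ∈ K) (hgen : K' ≤ (adjoin K {y}).restrictScalars k)
    (hdeg : ∀ P : Place k K, 0 < P.degree) (P' : Place k K') : 0 < P'.degree := by
  by_cases hyK : y ∈ K
  · obtain rfl := eq_of_le_adjoin_of_mem hle hyK hgen
    exact hdeg P'
  let _ := (inclusion hle).toRingHom.toAlgebra
  have : IsScalarTower k K K' := IsScalarTower.of_algebraMap_eq fun _ => rfl
  have h : IsArtinSchreier (⟨y, hy⟩ : K') (⟨_, hu⟩ : K) :=
    isArtinSchreier_inclusion h2 hle rfl hyK hgen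
  have := h.finiteDimensional
  have := h.isSeparable
  exact P'.degree_pos_of_restrict (F := K) (hdeg _)

/-- `WeakAt` at all places of `K`, for an element `u` of `K` that is given in the ambient field so
that `K` may vary. -/
def WeakOn (K : IntermediateField k L) (u : L) : Prop :=
  ∀ (P : Place k K) (z : K), (z : L) = u → P.WeakAt z

theorem WeakOn.of_le_adjoin [Finite k] (h2 : (2 : k) = 0) (hle : K ≤ K') {y u : L} (hy : y ∈ K')
    (hy₂ : y ^ 2 + y ∈ K) (hu : u ∈ K) (hgen : K' ≤ (adjoin K {y}).restrictScalars k)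
    (hdeg : ∀ P : Place k K, 0 < P.degree) (hwy : WeakOn K (y ^ 2 + y)) (hwu : WeakOn K u) :
    WeakOn K' u := by
  by_cases hyK : y ∈ K
  · obtain rfl := eq_of_le_adjoin_of_mem hle hyK hgen
    exact hwu
  let _ := (inclusion hle).toRingHom.toAlgebra
  have : IsScalarTower k K K' := IsScalarTower.of_algebraMap_eq fun _ => rfl
  have h : IsArtinSchreier (⟨y, hy⟩ : K') (⟨_, hy₂⟩ : K) :=
    isArtinSchreier_inclusion h2 hle rfl hyK hgen
  have := h.finiteDimensional
  have := h.isSeparable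
  intro P' z hz
  rw [show z = algebraMap K K' ⟨u, hu⟩ from Subtype.ext hz]
  exact h.weakAt_algebraMap (hdeg _) (hwy _ _ rfl) (hwu _ _ rfl) (Place.mem_fiber.2 rfl)

theorem isRationalGenerator_of_eq_adjoin {x : K} (hx : Transcendental k (x : L))
    (hK : K = adjoin k {(x : L)}) : IsRationalGenerator k x where
  transcendental h := hx ((isAlgebraic_algebraMap_iff (algebraMap K L).injective).2 h)
  exists_div f := by
    have hcoe (r : k[X]) : ((aeval x r : K) : L) = aeval (x : L) r :=
      (aeval_algebraMap_apply L x r).symm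
    obtain ⟨p, q, hpq⟩ := (mem_adjoin_simple_iff k _).1 (hK.le f.2)
    by_cases hq : q = 0
    · exact ⟨0, 1, one_ne_zero, Subtype.ext (by simp [hpq, hq])⟩
    · refine ⟨p, q, hq, Subtype.ext ?_⟩
      rw [hpq, ← hcoe, ← hcoe]
      rfl

end Inclusion

section TowerField

open IntermediateField

variable {k L : Type*} [Field k] [Field L] [Algebra k L] {x : ℕ → L}

theorem mem_towerField {i n : ℕ} (hi : i ≤ n) : x i ∈ towerField k x n :=
  subset_adjoin _ _ ⟨i, hi, rfl⟩

theorem towerField_le_iff {n : ℕ} {M : IntermediateField k L} :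
    towerField k x n ≤ M ↔ ∀ i ≤ n, x i ∈ M := by
  simp [towerField, adjoin_le_iff, Set.subset_def]

theorem towerField_mono : Monotone (towerField k x) := fun _ _ hab =>
  towerField_le_iff.2 fun _ hi => mem_towerField (hi.trans hab)

theorem towerField_shift_le (n : ℕ) :
    towerField k (fun i => x (i + 1)) n ≤ towerField k x (n + 1) :=
  towerField_le_iff.2 fun _ hi => mem_towerField (Nat.succ_le_succ hi)

theorem towerField_zero : towerField k x 0 = adjoin k {x 0} := by
  rw [towerField, show Set.Iic 0 = {0} from Set.ext fun _ => Nat.le_zero, Set.image_singleton]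

theorem towerField_succ_le (n : ℕ) :
    towerField k x (n + 1) ≤ (adjoin (towerField k x n) {x (n + 1)}).restrictScalars k := by
  refine towerField_le_iff.2 fun i hi => ?_
  rcases Nat.of_le_succ hi with hi | rfl
  · exact (adjoin (towerField k x n) {x (n + 1)}).algebraMap_mem ⟨x i, mem_towerField hi⟩
  · exact (mem_restrictScalars k).2 (mem_adjoin_simple_self (towerField k x n) (x (n + 1)))

theorem add_one_add_inv_mem_towerField (n : ℕ) : x n + 1 + 1 / x n ∈ towerField k x n :=
  have hn := mem_towerField le_rfl
  add_mem (add_mem hn (one_mem _)) (div_mem (one_mem _) hn)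

theorem sq_add_self_add_one_mem_towerField (n : ℕ) :
    x 0 ^ 2 + x 0 + 1 ∈ towerField k x n :=
  have h0 := mem_towerField n.zero_le
  add_mem (add_mem (pow_mem h0 2) h0) (one_mem _)

/-- `xₙ` as an element of `k(x₀, …, xₙ)`. -/
def towerGenerator (k : Type*) {L : Type*} [Field k] [Field L] [Algebra k L] (x : ℕ → L) (n : ℕ) :
    towerField k x n :=
  ⟨x n, mem_towerField le_rfl⟩

instance towerAlgebra (n : ℕ) : Algebra (towerField k x n) (towerField k x (n + 1)) :=
  (inclusion (towerField_mono n.le_succ)).toRingHom.toAlgebra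

instance isScalarTower_tower (n : ℕ) :
    IsScalarTower k (towerField k x n) (towerField k x (n + 1)) :=
  IsScalarTower.of_algebraMap_eq fun _ => rfl

end TowerField

namespace IsTowerSequence

open IntermediateField

variable {k L : Type*} [Field k] [Field L] [Algebra k L] {x : ℕ → L}

section Elements

variable (h : IsTowerSequence k x)
include h

/-- If `x₁` were algebraic, then `x₀` would be a root of `X² + (1 - c) X + 1` with
`c = x₁² + x₁` algebraic. -/
theorem transcendental_one : Transcendental k (x 1) := by
  refine fun halg => h.transcendental ?_
  have hx0 : x 0 ≠ 0 := by
    intro h0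
    exact h.transcendental (h0 ▸ isAlgebraic_zero)
  have hmem : x 1 ∈ algebraicClosure k L := mem_algebraicClosure_iff.2 halg
  let c : algebraicClosure k L := ⟨x 1 ^ 2 + x 1, add_mem (pow_mem hmem 2) hmem⟩
  have hc : algebraMap (algebraicClosure k L) L c = x 0 + 1 + 1 / x 0 := h.recursion 0
  have hx : IsAlgebraic (algebraicClosure k L) (x 0) := by
    refine ⟨Polynomial.X ^ 2 + (Polynomial.C (1 - c) * Polynomial.X + 1),
      Polynomial.Monic.ne_zero (by monicity!), ?_⟩
    simp only [map_add, map_pow, map_mul, map_sub, map_one, Polynomial.aeval_X,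
      Polynomial.aeval_C, hc]
    field_simp
    ring
  have : Algebra.IsAlgebraic k (algebraicClosure k L) := inferInstance
  exact hx.restrictScalars k

theorem shift : IsTowerSequence k fun i => x (i + 1) :=
  ⟨h.transcendental_one, fun i => h.recursion (i + 1)⟩

theorem transcendental_apply (i : ℕ) : Transcendental k (x i) := by
  induction i generalizing x with
  | zero => exact h.transcendental
  | succ _ ih => exact ih h.shift

theorem ne_zero (i : ℕ) : x i ≠ 0 := fun h0 =>
  h.transcendental_apply i (h0 ▸ isAlgebraic_zero)

theorem add_one_ne_zero (i : ℕ) : x i + 1 ≠ 0 := fun h0 =>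
  h.transcendental_apply i (eq_neg_of_add_eq_zero_left h0 ▸ isAlgebraic_one.neg)

theorem sq_add_self_add_one_ne_zero (i : ℕ) : x i ^ 2 + x i + 1 ≠ 0 := fun h0 =>
  h.transcendental_apply i ⟨Polynomial.X ^ 2 + Polynomial.X + 1,
    Polynomial.Monic.ne_zero (by monicity!), by simpa using h0⟩

end Elements

theorem towerField_succ_le_adjoin_shift (h : IsTowerSequence k x) (n : ℕ) :
    towerField k x (n + 1) ≤ (adjoin (towerField k (fun i => x (i + 1)) n)
      {(x 0 + 1) / (x 1 ^ 2 + x 1 + 1)}).restrictScalars k := by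
  set K := towerField k (fun i => x (i + 1)) n
  set w := (x 0 + 1) / (x 1 ^ 2 + x 1 + 1)
  have hbase {z : L} (hz : z ∈ K) : z ∈ (adjoin K {w}).restrictScalars k :=
    (adjoin K {w}).algebraMap_mem ⟨z, hz⟩
  refine towerField_le_iff.2 fun i hi => ?_
  rcases i with _ | i
  · have hx : x 0 = w * (x 1 ^ 2 + x 1 + 1) - 1 := by
      rw [div_mul_cancel₀ _ (h.sq_add_self_add_one_ne_zero 1), add_sub_cancel_right]
    rw [hx]
    exact sub_mem (mul_mem ((mem_restrictScalars k).2 (mem_adjoin_simple_self K w))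
      (hbase (sq_add_self_add_one_mem_towerField (x := fun i => x (i + 1)) n))) (one_mem _)
  · exact hbase (mem_towerField (x := fun i => x (i + 1)) (Nat.le_of_succ_le_succ hi))

section WeakRamification

variable (h : IsTowerSequence k x)
include h

theorem isRationalGenerator {z : towerField k x 0} (hz : (z : L) = x 0) :
    IsRationalGenerator k z :=
  isRationalGenerator_of_eq_adjoin (hz ▸ h.transcendental) (hz ▸ towerField_zero)

theorem degree_pos (h2 : (2 : k) = 0) (n : ℕ) : ∀ P : Place k (towerField k x n), 0 < P.degree := by
  induction n with
  | zero => exact (h.isRationalGenerator (z := towerGenerator k x 0) rfl).degree_pos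
  | succ n ih =>
    exact degree_pos_of_le_adjoin h2 (towerField_mono n.le_succ) (mem_towerField le_rfl)
      (h.recursion n ▸ add_one_add_inv_mem_towerField n) (towerField_succ_le n) ih

variable [Finite k] (h2 : (2 : k) = 0)
include h2

theorem weakOn_inv_succ {n : ℕ} (hw : WeakOn (towerField k x n) (x n + 1 + 1 / x n))
    (hw₀ : WeakOn (towerField k x n) (x 0 ^ 2 + x 0 + 1)⁻¹) :
    WeakOn (towerField k x (n + 1)) (x 0 ^ 2 + x 0 + 1)⁻¹ :=
  .of_le_adjoin h2 (towerField_mono n.le_succ) (mem_towerField le_rfl)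
    (h.recursion n ▸ add_one_add_inv_mem_towerField n)
    (inv_mem (sq_add_self_add_one_mem_towerField n)) (towerField_succ_le n) (h.degree_pos h2 n)
    (h.recursion n ▸ hw) hw₀

/-- `k(x₀, …, xₙ₊₁)` is also an Artin-Schreier extension of `k(x₁, …, xₙ₊₁)`, generated by
`w = (x₀ + 1) / (x₁² + x₁ + 1)` with `w² + w = 1 / (x₁² + x₁ + 1)`. -/
theorem weakOn_add_one_add_inv_succ {n : ℕ}
    (hw : WeakOn (towerField k (fun i => x (i + 1)) n) (x (n + 1) + 1 + 1 / x (n + 1)))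
    (hw₀ : WeakOn (towerField k (fun i => x (i + 1)) n) (x 1 ^ 2 + x 1 + 1)⁻¹) :
    WeakOn (towerField k x (n + 1)) (x (n + 1) + 1 + 1 / x (n + 1)) := by
  have h2L : (2 : L) = 0 := by rw [← map_ofNat (algebraMap k L) 2, h2, map_zero]
  have heq := sq_add_self_eq_inv_of_sq_add_self_eq h2L (h.ne_zero 0)
    (h.sq_add_self_add_one_ne_zero 1) (h.recursion 0)
  have hmem := sq_add_self_add_one_mem_towerField (k := k) (x := fun i => x (i + 1)) n
  exact .of_le_adjoin h2 (towerField_shift_le n)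
    (div_mem (add_mem (mem_towerField (Nat.zero_le _)) (one_mem _)) (towerField_shift_le n hmem))
    (heq ▸ inv_mem hmem) (add_one_add_inv_mem_towerField (x := fun i => x (i + 1)) n)
    (h.towerField_succ_le_adjoin_shift n) (h.shift.degree_pos h2 n) (heq ▸ hw₀) hw

theorem weakOn (hk : ∀ a : k, a ^ 2 + a + 1 ≠ 0) (n : ℕ) :
    WeakOn (towerField k x n) (x n + 1 + 1 / x n) ∧
      WeakOn (towerField k x n) (x 0 ^ 2 + x 0 + 1)⁻¹ := by
  induction n generalizing x with
  | zero =>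
    have hgen := h.isRationalGenerator (z := towerGenerator k x 0) rfl
    refine ⟨fun P z hz => ?_, fun P z hz => ?_⟩
    · convert hgen.weakAt_add_one_add_inv P
      exact Subtype.ext hz
    · convert hgen.weakAt_inv_aeval (irreducible_sq_add_X_add_one hk) P
      exact Subtype.ext (by simpa [towerGenerator] using hz)
  | succ n ih =>
    have hshift := ih h.shift
    exact ⟨h.weakOn_add_one_add_inv_succ h2 hshift.1 hshift.2,
      h.weakOn_inv_succ h2 (ih h).1 (ih h).2⟩

end WeakRamification

end IsTowerSequence

namespace IsTowerSequence

open IntermediateField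

variable {k L : Type*} [Field k] [Field L] [Algebra k L] {x : ℕ → L} (h : IsTowerSequence k x)
include h

theorem towerGenerator_ne_zero (n : ℕ) : towerGenerator k x n ≠ 0 := fun h0 =>
  h.ne_zero n (congrArg Subtype.val h0)

theorem towerGenerator_add_one_ne_zero (n : ℕ) : towerGenerator k x n + 1 ≠ 0 := fun h0 =>
  h.add_one_ne_zero n (congrArg Subtype.val h0)

theorem towerGenerator_sq_add_self_add_one_ne_zero (n : ℕ) :
    towerGenerator k x n ^ 2 + towerGenerator k x n + 1 ≠ 0 := fun h0 =>
  h.sq_add_self_add_one_ne_zero n (congrArg Subtype.val h0)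

theorem isArtinSchreier (h2 : (2 : k) = 0) {n N : ℕ}
    (l : TowerLevel k (towerGenerator k x n) N) :
    IsArtinSchreier (towerGenerator k x (n + 1))
      (towerGenerator k x n + 1 + 1 / towerGenerator k x n) :=
  isArtinSchreier_inclusion h2 (towerField_mono n.le_succ) (h.recursion n)
    (fun hn => l.sq_add_self_ne ⟨x (n + 1), hn⟩ (Subtype.ext (h.recursion n)))
    (towerField_succ_le n)

variable (hk : Nat.card k = 8)
include hk

theorem exists_towerLevel : ∃ C : ℝ, ∀ n,
    ∃ l : TowerLevel k (towerGenerator k x n) (2 ^ n), l.totalWeight ≤ (19 / 10) ^ n * C := by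
  have := finite_of_card_eq_eight hk
  have h2 := two_eq_zero_of_card_eq_eight hk
  let l₀ : TowerLevel k (towerGenerator k x 0) 1 := (h.isRationalGenerator rfl).towerLevel hk
  refine ⟨l₀.totalWeight, fun n => ?_⟩
  induction n with
  | zero => exact ⟨l₀, by simp⟩
  | succ n ih =>
    obtain ⟨l, hl⟩ := ih
    have has := h.isArtinSchreier h2 l
    have := has.finiteDimensional
    have := has.isSeparable
    have hweak (P : Place k (towerField k x n)) :
        P.WeakAt (towerGenerator k x n + 1 + 1 / towerGenerator k x n) :=
      (h.weakOn h2 (sq_add_self_add_one_ne_zero_of_card_eq_eight hk) n).1 P _ rfl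
    rw [pow_succ', pow_succ', mul_assoc]
    refine ⟨l.succ has hk hweak (h.towerGenerator_ne_zero n), ?_⟩
    exact (l.totalWeight_succ_le has hk hweak (h.towerGenerator_ne_zero n)
      (h.towerGenerator_add_one_ne_zero n)
      (h.towerGenerator_sq_add_self_add_one_ne_zero n)).trans (by gcongr)

theorem isCurveFunctionField (n : ℕ) : IsCurveFunctionField k (towerField k x n) :=
  have ⟨_, hC⟩ := h.exists_towerLevel hk
  have ⟨l, _⟩ := hC n
  l.isCurveFunctionField

theorem relfinrank_succ (n : ℕ) :
    relfinrank (towerField k x n) (towerField k x (n + 1)) = 2 := by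
  obtain ⟨C, hC⟩ := h.exists_towerLevel hk
  obtain ⟨l, -⟩ := hC n
  rw [relfinrank_eq_finrank_of_le (towerField_mono n.le_succ)]
  exact (h.isArtinSchreier (two_eq_zero_of_card_eq_eight hk) l).finrank_eq

/-- Here `s n` is the total degree of the bad places of the `n`-th level, and `m n` the number of
rational ones among them. -/
theorem exists_genus_numRationalPoints_eq : ∃ s m : ℕ → ℕ,
    Tendsto (fun n => (s n / 2 ^ n : ℝ)) atTop (𝓝 0) ∧ ∀ n, m n ≤ s n ∧
      genus k (towerField k x n) = 4 * 2 ^ n + 1 - s n ∧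
      numRationalPoints k (towerField k x n) = 6 * 2 ^ n + m n := by
  obtain ⟨C, hC⟩ := h.exists_towerLevel hk
  choose l hl using hC
  refine ⟨fun n => ∑ P ∈ (l n).badPlaces, P.degree,
    fun n => ((l n).badPlaces.filter fun P => P.degree = 1).card, ?_, fun n =>
    ⟨(l n).card_filter_badPlaces_le, mod_cast (l n).genus_eq, (l n).numRationalPoints_eq⟩⟩
  have hlim : Tendsto (fun n : ℕ => (19 / 20 : ℝ) ^ n * C) atTop (𝓝 0) := by
    simpa only [zero_mul] using (tendsto_pow_atTop_nhds_zero_of_lt_one (r := (19 / 20 : ℝ))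
      (by norm_num) (by norm_num)).mul_const C
  refine squeeze_zero (fun n => by positivity) (fun n => ?_) hlim
  rw [div_le_iff₀ (by positivity)]
  calc ((∑ P ∈ (l n).badPlaces, P.degree : ℕ) : ℝ) ≤ (l n).totalWeight :=
        (l n).sum_degree_badPlaces_le_totalWeight (h.towerGenerator_ne_zero n)
          (h.towerGenerator_add_one_ne_zero n) (h.towerGenerator_sq_add_self_add_one_ne_zero n)
    _ ≤ (19 / 10) ^ n * C := hl n
    _ = (19 / 20) ^ n * C * 2 ^ n := by
        rw [mul_right_comm, ← mul_pow]
        norm_num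

theorem tendsto_genus_div_two_pow :
    Tendsto (fun n => (genus k (towerField k x n) / 2 ^ n : ℝ)) atTop (𝓝 4) := by
  obtain ⟨s, m, hs, heq⟩ := h.exists_genus_numRationalPoints_eq hk
  have hpow : Tendsto (fun n : ℕ => (1 / 2 : ℝ) ^ n) atTop (𝓝 0) :=
    tendsto_pow_atTop_nhds_zero_of_lt_one (by norm_num) (by norm_num)
  have hlim := (hpow.const_add 4).sub hs
  rw [add_zero, sub_zero] at hlim
  refine hlim.congr fun n => ?_
  rw [(heq n).2.1, one_div, inv_pow]
  push_cast
  field_simp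

theorem tendsto_numRationalPoints_div_two_pow :
    Tendsto (fun n => (numRationalPoints k (towerField k x n) / 2 ^ n : ℝ)) atTop (𝓝 6) := by
  obtain ⟨s, m, hs, heq⟩ := h.exists_genus_numRationalPoints_eq hk
  have hm : Tendsto (fun n => (m n / 2 ^ n : ℝ)) atTop (𝓝 0) := by
    refine squeeze_zero (fun n => by positivity) (fun n => ?_) hs
    have := (heq n).1
    gcongr
  have hlim := hm.const_add 6
  rw [add_zero] at hlim
  refine hlim.congr fun n => ?_
  rw [(heq n).2.2]
  push_cast
  field_simp

theorem tendsto_pointGenusRatio :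
    Tendsto (pointGenusRatio k (towerField k x)) atTop (𝓝 (3 / 2)) := by
  have hlim := (h.tendsto_numRationalPoints_div_two_pow hk).div (h.tendsto_genus_div_two_pow hk)
    four_ne_zero
  rw [show (6 / 4 : ℝ) = 3 / 2 by norm_num] at hlim
  exact hlim.congr fun n => div_div_div_cancel_right₀ (by positivity) _ _

theorem isAsymptoticallyGoodTower : IsAsymptoticallyGoodTower k (towerField k x) where
  curve := h.isCurveFunctionField hk
  mono := towerField_mono
  one_lt_genus := by
    obtain ⟨n, hn⟩ := ((h.tendsto_genus_div_two_pow hk).eventually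
      (lt_mem_nhds (by norm_num : (1 : ℝ) < 4))).exists
    refine ⟨n, ?_⟩
    rw [lt_div_iff₀ (by positivity), one_mul] at hn
    exact_mod_cast (one_le_pow₀ one_le_two).trans_lt hn
  limit_pos := ⟨3 / 2, by norm_num, h.tendsto_pointGenusRatio hk⟩

end IsTowerSequence

theorem exists_sq_add_self_eq_of_isAlgClosed {L : Type*} [Field L] [IsAlgClosed L] (u : L) :
    ∃ z : L, z ^ 2 + z = u := by
  have hdeg : (IsArtinSchreier.poly u).degree ≠ 0 := by
    rw [Polynomial.degree_eq_natDegree IsArtinSchreier.monic_poly.ne_zero,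
      IsArtinSchreier.natDegree_poly]
    exact two_ne_zero
  obtain ⟨z, hz⟩ := IsAlgClosed.exists_root _ hdeg
  exact ⟨z, sub_eq_zero.1 (by simpa [IsArtinSchreier.poly] using hz)⟩

theorem exists_isTowerSequence {k L : Type*} [Field k] [Field L] [Algebra k L] [IsAlgClosed L]
    {t : L} (ht : Transcendental k t) : ∃ x : ℕ → L, IsTowerSequence k x := by
  choose f hf using exists_sq_add_self_eq_of_isAlgClosed (L := L)
  exact ⟨fun n => Nat.rec t (fun _ z => f (z + 1 + 1 / z)) n, ht, fun i => hf _⟩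

end

theorem mainTheorem1 (k : Type*) [Field k] (hk : Nat.card k = 8) :
    (∃ x : ℕ → AlgebraicClosure (RatFunc k), IsTowerSequence k x) ∧
    ∀ (L : Type*) [Field L] [Algebra k L] (x : ℕ → L), IsTowerSequence k x →
      (∀ i, IntermediateField.relfinrank (towerField k x i) (towerField k x (i + 1)) = 2) ∧
      IsAsymptoticallyGoodTower k (towerField k x) ∧
      Tendsto (pointGenusRatio k (towerField k x)) atTop (𝓝 (3 / 2)) := by
  refine ⟨exists_isTowerSequence (t := algebraMap (RatFunc k) _ RatFunc.X) ?_,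
    fun L _ _ x h => ⟨h.relfinrank_succ hk, h.isAsymptoticallyGoodTower hk,
      h.tendsto_pointGenusRatio hk⟩⟩
  rw [transcendental_algebraMap_iff (algebraMap (RatFunc k) _).injective]
  exact RatFunc.transcendental_X
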